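/- Let $n\ge 2$, $1<p<\infty$, and let $F:\mathbb R^n\to[0,\infty)$ be a Finsler norm: $F$ is convex, $F(t\xi)=|t|F(\xi)$ for $t\in\mathbb R$, $F(\xi)\ge a|\xi|$ for some constant $a>0$, $F\in C^2(\mathbb R^n\setminus\{0\})$, and the Hessian of $F^p$ is positive definite on $\mathbb R^n\setminus\{0\}$. Let $F^o(v)=\sup_{\xi\neq0}\langle\xi,v\rangle/F(\xi)$ be the polar norm. Let $\Omega\subset\mathbb R^n$ be a nonempty bounded open set with $C^\infty$ boundary and outward unit normal $\nu_{\partial\Omega}$. Put $\nu^F_{\partial\Omega}=\nabla F(\nu_{\partial\Omega})$ and $H^F_{\partial\Omega}=\operatorname{div}^{\partial\Omega}\nu^F_{\partial\Omega}$ on $\partial\Omega$, where $\operatorname{div}^{\partial\Omega}T=\operatorname{div}T-\langle\nabla T\,\nu_{\partial\Omega},\nu_{\partial\Omega}\rangle$ is the tangential divergence. For a bounded open set $E$ with $C^1$ boundary let $$M_F(E)=\int_{\partial E}(F^o)^pF(\nu_{\partial E})\,d\mathcal H^{n-1},\qquad P_F(E)=\int_{\partial E}F(\nu_{\partial E})\,d\mathcal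 H^{n-1},\qquad \mathcal F(E)=\frac{M_F(E)}{P_F(E)\,V(E)^{p/n}},$$ where $V$ denotes Lebesgue measure. Let $\varphi\in C^\infty_c(\mathbb R^n)$, let $\nu^F_{\partial\Omega}$ be extended from $\partial\Omega$ to an arbitrary $C^1$ vector field on $\mathbb R^n$ (denoted by the same symbol), and let $\Omega(t)=\{x+t\varphi(x)\nu^F_{\partial\Omega}(x): x\in\Omega\}$ for $t\in\mathbb R$. Then the functions $t\mapsto M_F(\Omega(t))$, $P_F(\Omega(t))$, $V(\Omega(t))$, $\mathcal F(\Omega(t))$ are differentiable at $t=0$, and, writing $\nu=\nu_{\partial\Omega}$, $\nu^F=\nu^F_{\partial\Omega}$, $H^F=H^F_{\partial\Omega}$, $$\frac{d}{dt}M_F(\Omega(t))\Big|_{t=0}=p\int_{\partial\Omega}(F^o)^{p-1}\langle\nabla F^o,\varphi\,\nu^F\rangle F(\nu)\,d\mathcal H^{n-1}+\int_{\partial\Omega}(F^o)^pF(\nu)H^F\varphi\,d\mathcal H^{n-1},$$ $$\frac{d}{dt}P_F(\Omega(t))\Big|_{t=0}=\int_{\partial\Omega}H^F\varphi F(\nu)\,d\mathcal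 H^{n-1},\qquad \frac{d}{dt}V(\Omega(t))\Big|_{t=0}=\int_{\partial\Omega}\varphi F(\nu)\,d\mathcal H^{n-1},$$ $$\frac{d}{dt}\mathcal F(\Omega(t))\Big|_{t=0}=\frac{1}{P_F(\Omega)V(\Omega)^{p/n}}\Big[p\int_{\partial\Omega}\Big((F^o)^{p-1}\langle\nabla F^o,\nu^F\rangle F(\nu)-\frac{M_F(\Omega)}{nV(\Omega)}F(\nu)\Big)\varphi\,d\mathcal H^{n-1}+\int_{\partial\Omega}\Big((F^o)^p-\frac{M_F(\Omega)}{P_F(\Omega)}\Big)H^FF(\nu)\varphi\,d\mathcal H^{n-1}\Big].$$ (If $0\in\partial\Omega$, the integrands containing $(F^o)^{p-1}\nabla F^o$ are given by reading this factor as $0$ at the origin.) -/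

import Mathlib

open MeasureTheory Set Filter Topology
open scoped ContDiff RealInnerProductSpace

noncomputable section

/-- `F` is a Finsler norm on `ℝⁿ`: convex, nonnegative, absolutely homogeneous of degree one,
bounded below by a positive multiple of the Euclidean norm, of class `C²` away from the origin, and
such that the Hessian of `F ^ p` is positive definite away from the origin. -/
structure IsFinslerNorm {n : ℕ} (p : ℝ) (F : EuclideanSpace ℝ (Fin n) → ℝ) : Prop where
  convexOn : ConvexOn ℝ univ F
  nonneg : ∀ ξ, 0 ≤ F ξ
  homogeneous : ∀ (t : ℝ) (ξ : EuclideanSpace ℝ (Fin n)), F (t • ξ) = |t| * F ξ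
  lower_bound : ∃ a : ℝ, 0 < a ∧ ∀ ξ, a * ‖ξ‖ ≤ F ξ
  contDiffOn : ContDiffOn ℝ 2 F {0}ᶜ
  hessian_pos : ∀ ξ : EuclideanSpace ℝ (Fin n), ξ ≠ 0 → ∀ v : EuclideanSpace ℝ (Fin n), v ≠ 0 →
    0 < fderiv ℝ (fderiv ℝ (fun η => F η ^ p)) ξ v v

/-- The polar function `F°(v) = sup_{ξ ≠ 0} ⟨ξ, v⟩ / F(ξ)`. -/
def polarNorm {n : ℕ} (F : EuclideanSpace ℝ (Fin n) → ℝ) (v : EuclideanSpace ℝ (Fin n)) : ℝ :=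
  sSup {r : ℝ | ∃ ξ : EuclideanSpace ℝ (Fin n), ξ ≠ 0 ∧ r = ⟪ξ, v⟫ / F ξ}

/-- `Ω` has `C^∞` boundary: near each of its boundary points, `Ω` is the sublevel set `{ρ < 0}` of
a smooth function `ρ` whose differential does not vanish at that point. -/
def HasSmoothBoundary {n : ℕ} (Ω : Set (EuclideanSpace ℝ (Fin n))) : Prop :=
  ∀ x ∈ frontier Ω, ∃ (U : Set (EuclideanSpace ℝ (Fin n))) (ρ : EuclideanSpace ℝ (Fin n) → ℝ),
    IsOpen U ∧ x ∈ U ∧ ContDiffOn ℝ ∞ ρ U ∧ fderiv ℝ ρ x ≠ 0 ∧ ∀ y ∈ U, y ∈ Ω ↔ ρ y < 0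

/-- The unit vector `ν` is the outward unit normal to `∂Ω` at `x`: infinitesimally at `x`, the set
`Ω` is the half-space `{y | ⟨y - x, ν⟩ < 0}`, up to arbitrarily thin cones around its boundary.
There is at most one such `ν`; at a boundary point where `∂Ω` is locally the graph of a function
differentiable at that point, with `Ω` on one side, it is the usual normal. -/
def IsOutwardUnitNormal {n : ℕ} (Ω : Set (EuclideanSpace ℝ (Fin n)))
    (x ν : EuclideanSpace ℝ (Fin n)) : Prop :=
  ‖ν‖ = 1 ∧ ∀ ε : ℝ, 0 < ε → ∀ᶠ y in 𝓝 x,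
    (⟪y - x, ν⟫ < -(ε * ‖y - x‖) → y ∈ Ω) ∧ (ε * ‖y - x‖ < ⟪y - x, ν⟫ → y ∉ Ω)

open Classical in
/-- The outward unit normal `ν_{∂Ω}(x)` (with the value `0` where there is none). -/
def outwardNormal {n : ℕ} (Ω : Set (EuclideanSpace ℝ (Fin n))) (x : EuclideanSpace ℝ (Fin n)) :
    EuclideanSpace ℝ (Fin n) :=
  if h : ∃ ν, IsOutwardUnitNormal Ω x ν then h.choose else 0

/-- The `F`-normal (Cahn-Hoffman field) `ν^F_{∂Ω}(x) = ∇F(ν_{∂Ω}(x))`. -/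
def anisotropicNormal {n : ℕ} (F : EuclideanSpace ℝ (Fin n) → ℝ)
    (Ω : Set (EuclideanSpace ℝ (Fin n))) (x : EuclideanSpace ℝ (Fin n)) :
    EuclideanSpace ℝ (Fin n) :=
  gradient F (outwardNormal Ω x)

/-- The tangential divergence `div T - ⟨∇T ν, ν⟩` on `∂Ω` of a field `T` of which only the values
on `∂Ω` matter. The differential is taken along `∂Ω`; it is determined on the tangent hyperplane
only, and the expression does not depend on how it acts on the normal. In particular, it may be
computed with the differential of any differentiable extension of `T` to a neighbourhood. -/
def tangentialDivergence {n : ℕ} (Ω : Set (EuclideanSpace ℝ (Fin n)))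
    (T : EuclideanSpace ℝ (Fin n) → EuclideanSpace ℝ (Fin n)) (x : EuclideanSpace ℝ (Fin n)) : ℝ :=
  LinearMap.trace ℝ (EuclideanSpace ℝ (Fin n)) (fderivWithin ℝ T (frontier Ω) x).toLinearMap
    - ⟪fderivWithin ℝ T (frontier Ω) x (outwardNormal Ω x), outwardNormal Ω x⟫

/-- The `F`-mean curvature `H^F_{∂Ω} = div^{∂Ω} ν^F_{∂Ω}`. -/
def anisotropicMeanCurvature {n : ℕ} (F : EuclideanSpace ℝ (Fin n) → ℝ)
    (Ω : Set (EuclideanSpace ℝ (Fin n))) (x : EuclideanSpace ℝ (Fin n)) : ℝ :=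
  tangentialDivergence Ω (anisotropicNormal F Ω) x

/-- The integral `∫_{∂Ω} f dℋⁿ⁻¹`, with the Hausdorff measure normalized so as to agree with the
Lebesgue measure on `(n-1)`-dimensional Euclidean spaces. -/
def boundaryIntegral {n : ℕ} (Ω : Set (EuclideanSpace ℝ (Fin n)))
    (f : EuclideanSpace ℝ (Fin n) → ℝ) : ℝ :=
  ∫ x in frontier Ω, f x ∂(μHE[n - 1])

/-- The anisotropic perimeter `P_F(Ω)`. -/
def anisotropicPerimeter {n : ℕ} (F : EuclideanSpace ℝ (Fin n) → ℝ)
    (Ω : Set (EuclideanSpace ℝ (Fin n))) : ℝ :=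
  boundaryIntegral Ω fun x => F (outwardNormal Ω x)

/-- The anisotropic `p`-boundary momentum `M_F(Ω)`. -/
def anisotropicMomentum {n : ℕ} (p : ℝ) (F : EuclideanSpace ℝ (Fin n) → ℝ)
    (Ω : Set (EuclideanSpace ℝ (Fin n))) : ℝ :=
  boundaryIntegral Ω fun x => polarNorm F x ^ p * F (outwardNormal Ω x)

/-- The scale invariant functional `𝓕(Ω) = M_F(Ω) / (P_F(Ω) V(Ω)^{p/n})`. -/
def momentumFunctional {n : ℕ} (p : ℝ) (F : EuclideanSpace ℝ (Fin n) → ℝ)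
    (Ω : Set (EuclideanSpace ℝ (Fin n))) : ℝ :=
  anisotropicMomentum p F Ω /
    (anisotropicPerimeter F Ω * volume.real Ω ^ (p / (n : ℝ)))

/-- The deformed set `Ω(t) = {x + t φ(x) N(x) | x ∈ Ω}`. -/
def deformedSet {n : ℕ} (Ω : Set (EuclideanSpace ℝ (Fin n))) (φ : EuclideanSpace ℝ (Fin n) → ℝ)
    (N : EuclideanSpace ℝ (Fin n) → EuclideanSpace ℝ (Fin n)) (t : ℝ) :
    Set (EuclideanSpace ℝ (Fin n)) :=
  (fun x => x + t • φ x • N x) '' Ω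

end

/-! Put `X = φ • N` and let `displacement X t` be the map x ↦ x + tX(x), with differential A = 1 + t
DX. For small t it is a homeomorphism of the whole space. It carries the normal ν to the direction
of A⁻ᵀν and multiplies boundary area by |det A| |A⁻ᵀν|. Since F is absolutely homogeneous, the two
factors merge: integrating G F(ν) over the moved boundary equals integrating G(x + tX) F(cof(A) ν)
over the fixed one, where cof(A) = det A · A⁻ᵀ (`setIntegral_frontier_displacement_image`). This
rests on an area formula for hypersurfaces, `setIntegral_image_euclideanHausdorffMeasure`.

Everything is now on the fixed set ∂Ω and can be differentiated under the integral. The derivative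
of cof(1 + tB) at t = 0 is tr B − Bᵀ, so the area element contributes (div X) F(ν) − ⟨DX ∇F(ν), ν⟩.
For X = φN the two terms containing ∇φ cancel because ⟨N, ν⟩ = F(ν). The rest is φ F(ν) H because DN
maps tangent vectors to tangent vectors: along ∂Ω the function y ↦ ⟨ν(x), ∇F(ν(y))⟩ has its maximum
at x (`inner_fderiv_outwardNormal_eq_zero`, `trace_mul_sub_inner_eq`). The weight G = 1 gives the
perimeter, and G = (F°)^p the momentum.

The momentum also needs F° to be differentiable off the origin. Positive definiteness of the Hessian
of F^p makes the maximiser defining F° unique, hence continuous, and an envelope argument identifies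
it as the gradient (`hasGradientAt_polarNorm`). At the origin p > 1 makes the derivative of (F°)^p
vanish.

The volume is the integral of det(1 + t DX) over Ω. Its derivative is the integral of div X, which
the divergence theorem (`setIntegral_trace_fderiv_eq`, obtained by straightening the boundary) turns
into the boundary integral of ⟨ν, X⟩ = φF(ν). The functional then follows by the quotient rule. -/

section AreaFormula
open Asymptotics Measure Module
open scoped ENNReal NNReal

/-! ### Comparison of Hausdorff measures and the local area estimate. -/

section Comparison

variable {X Y Z : Type*} [EMetricSpace X] [MeasurableSpace X] [BorelSpace X]
  [EMetricSpace Y] [MeasurableSpace Y] [BorelSpace Y]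

theorem LipschitzOnWith.euclideanHausdorffMeasure_image_le {K : ℝ≥0} {f : X → Y} {s : Set X}
    (h : LipschitzOnWith K f s) (d : ℕ) :
    μHE[d] (f '' s) ≤ (K : ℝ≥0∞) ^ d * μHE[d] s := by
  have := h.hausdorffMeasure_image_le (d := d) (Nat.cast_nonneg d)
  rw [ENNReal.rpow_natCast] at this
  simp_rw [euclideanHausdorffMeasure_def, Measure.smul_apply, nnreal_smul_coe_apply]
  rw [mul_left_comm]
  gcongr

/-- On `s`, equal values of `g` force equal values of `f`, so `f` factors through a `K`-Lipschitz
map on `g '' s`. This compares two images of one set without asking either map to be injective. -/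
theorem euclideanHausdorffMeasure_image_le_of_edist_le {W : Type*} {K : ℝ≥0} {f : W → Y}
    {g : W → X} {s : Set W} (d : ℕ)
    (h : ∀ x ∈ s, ∀ y ∈ s, edist (f x) (f y) ≤ K * edist (g x) (g y)) :
    μHE[d] (f '' s) ≤ (K : ℝ≥0∞) ^ d * μHE[d] (g '' s) := by
  rcases s.eq_empty_or_nonempty with rfl | ⟨x₀, -⟩
  · simp
  have : Nonempty W := ⟨x₀⟩
  set r := Function.invFunOn g s
  have hr : ∀ x ∈ s, r (g x) ∈ s ∧ g (r (g x)) = g x := fun x hx =>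
    ⟨Function.invFunOn_mem ⟨x, hx, rfl⟩, Function.invFunOn_eq ⟨x, hx, rfl⟩⟩
  have himg : f '' s = (f ∘ r) '' (g '' s) := by
    rw [image_image]
    refine image_congr fun x hx => ?_
    have := h x hx _ (hr x hx).1
    rw [(hr x hx).2, edist_self, mul_zero, nonpos_iff_eq_zero, edist_eq_zero] at this
    exact this
  rw [himg]
  refine LipschitzOnWith.euclideanHausdorffMeasure_image_le ?_ d
  rintro _ ⟨x, hx, rfl⟩ _ ⟨y, hy, rfl⟩
  have := h _ (hr x hx).1 _ (hr y hy).1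
  rwa [(hr x hx).2, (hr y hy).2] at this

end Comparison

/-- A countable subcover, made disjoint, globalises the estimate for each fixed `k`; then `k` tends
to 1. No finiteness of either measure enters. -/
theorem MeasureTheory.Measure.le_of_locally_le {X : Type*} [TopologicalSpace X]
    [SecondCountableTopology X] [MeasurableSpace X] [OpensMeasurableSpace X] {μ ν : Measure X}
    (h : ∀ k : ℝ≥0, 1 < k → ∀ x, ∃ U ∈ 𝓝 x, ∀ B ⊆ U, MeasurableSet B → μ B ≤ k * ν B) :
    μ ≤ ν := by
  refine Measure.le_iff.2 fun A hA => ?_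
  have key : ∀ k : ℝ≥0, 1 < k → μ A ≤ k * ν A := by
    intro k hk
    choose U hU hB using h k hk
    obtain ⟨s, hs, hcov⟩ := TopologicalSpace.countable_cover_nhds
      (f := fun x => interior (U x)) fun x => interior_mem_nhds.2 (hU x)
    rcases s.eq_empty_or_nonempty with rfl | hne
    · have : A = ∅ := by
        rw [← subset_empty_iff]
        calc A ⊆ univ := subset_univ _
          _ = ∅ := by rw [← hcov]; simp
      simp [this]
    obtain ⟨u, rfl⟩ := hs.exists_eq_range hne
    set W : ℕ → Set X := fun i => interior (U (u i))
    have hWm : ∀ i, MeasurableSet (disjointed W i) :=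
      fun i => MeasurableSet.disjointed (fun i => isOpen_interior.measurableSet) i
    have hAW : A = ⋃ i, A ∩ disjointed W i := by
      rw [← inter_iUnion, iUnion_disjointed]
      have : ⋃ i, W i = univ := by rw [← hcov, biUnion_range]
      rw [this, inter_univ]
    have hdisj : Pairwise (Function.onFun Disjoint fun i => A ∩ disjointed W i) := fun i j hij =>
      (disjoint_disjointed W hij).mono inter_subset_right inter_subset_right
    rw [hAW, measure_iUnion hdisj fun i => hA.inter (hWm i),
      measure_iUnion hdisj fun i => hA.inter (hWm i), ← ENNReal.tsum_mul_left]
    refine ENNReal.tsum_le_tsum fun i => hB (u i) _ ?_ (hA.inter (hWm i))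
    exact inter_subset_right.trans ((disjointed_subset W i).trans interior_subset)
  have hlim : Tendsto (fun k : ℝ≥0 => (k : ℝ≥0∞) * ν A) (𝓝[>] 1) (𝓝 (((1 : ℝ≥0) : ℝ≥0∞) * ν A)) := by
    refine ENNReal.Tendsto.mul_const ?_ (Or.inl (by simp))
    exact (ENNReal.continuous_coe.tendsto 1).mono_left nhdsWithin_le_nhds
  rw [ENNReal.coe_one, one_mul] at hlim
  exact ge_of_tendsto hlim (eventually_nhdsWithin_of_forall fun k hk => key k hk)

theorem exists_nhds_forall_of_eventually_prod {W : Type*} [TopologicalSpace W]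
    {S : Set W} {x : W} {P : W → W → Prop}
    (h : ∀ᶠ p : W × W in 𝓝 (x, x) ⊓ 𝓟 (S ×ˢ S), P p.1 p.2) :
    ∃ U ∈ 𝓝 x, ∀ y ∈ S ∩ U, ∀ z ∈ S ∩ U, P y z := by
  rw [eventually_inf_principal, nhds_prod_eq, eventually_prod_iff] at h
  obtain ⟨p, hp, q, hq, hpq⟩ := h
  refine ⟨{y | p y ∧ q y}, hp.and hq, fun y hy z hz => hpq hy.2.1 hz.2.2 ⟨hy.1, hz.1⟩⟩

variable {V : Type*} [NormedAddCommGroup V] [InnerProductSpace ℝ V] [FiniteDimensional ℝ V]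

theorem finrank_orthogonal_singleton {ν : V} (hν : ν ≠ 0) :
    finrank ℝ (ℝ ∙ ν)ᗮ = finrank ℝ V - 1 := by
  have h1 := (ℝ ∙ ν).finrank_add_finrank_orthogonal
  rw [finrank_span_singleton hν] at h1
  omega

/-- The vector `w` is normal to the image of the hyperplane. After an isometry taking `w / ‖w‖` to
`ν`, the map preserves the hyperplane and acts on the one-dimensional quotient as `‖w‖⁻¹`, so its
determinant is the determinant on the hyperplane times `‖w‖⁻¹`. -/
theorem LinearMap.normDet_domRestrict_orthogonal (A : V →ₗ[ℝ] V) {ν w : V} (hν : ‖ν‖ = 1)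
    (hA : ∀ v, ⟪w, A v⟫ = ⟪ν, v⟫) :
    (A.domRestrict (ℝ ∙ ν)ᗮ).normDet = |A.det| * ‖w‖ := by
  have hν0 : ν ≠ 0 := by rintro rfl; simp at hν
  have hw : w ≠ 0 := by
    rintro rfl
    have := hA ν
    rw [inner_zero_left, real_inner_self_eq_norm_sq, hν] at this
    norm_num at this
  have hw' : ‖w‖ ≠ 0 := norm_ne_zero_iff.2 hw
  set T := (ℝ ∙ ν)ᗮ
  have hT : ∀ v, v ∈ T ↔ ⟪ν, v⟫ = 0 := fun v => Submodule.mem_orthogonal_singleton_iff_inner_right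
  obtain ⟨R, hR⟩ : ∃ R : V ≃ₗᵢ[ℝ] V, R (‖w‖⁻¹ • w) = ν :=
    ⟨_, Submodule.reflection_sub (by rw [norm_smul, norm_inv, norm_norm, inv_mul_cancel₀ hw', hν])⟩
  set C : V →ₗ[ℝ] V := R.toLinearIsometry.toLinearMap ∘ₗ A with hC
  have hCv : ∀ v, ⟪ν, C v⟫ = ‖w‖⁻¹ * ⟪ν, v⟫ := by
    intro v
    have : C v = R (A v) := rfl
    rw [this, ← hR, LinearIsometryEquiv.inner_map_map, inner_smul_left, hA, hR]
    rfl
  have hCT : ∀ v ∈ T, C v ∈ T := fun v hv => by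
    rw [hT] at hv ⊢
    rw [hCv, hv, mul_zero]
  have hdetR : |LinearMap.det R.toLinearIsometry.toLinearMap| = 1 := by
    rw [← normDet_eq_abs_det, LinearIsometry.normDet_eq_one]
  have hdetC : |C.det| = |A.det| := by
    rw [hC, LinearMap.det_comp, abs_mul, hdetR, one_mul]
  have hq : (T.mapQ T C hCT).det = ‖w‖⁻¹ := by
    have : T.mapQ T C hCT = ‖w‖⁻¹ • LinearMap.id := by
      refine Submodule.linearMap_qext _ (LinearMap.ext fun v => ?_)
      simp only [LinearMap.comp_apply, Submodule.mkQ_apply, Submodule.mapQ_apply,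
        LinearMap.smul_apply, LinearMap.id_apply]
      rw [← Submodule.Quotient.mk_smul, Submodule.Quotient.eq, hT, inner_sub_right, hCv,
        inner_smul_right, sub_self]
    rw [this, LinearMap.det_smul]
    have h1 := T.finrank_quotient_add_finrank
    have h2 := (ℝ ∙ ν).finrank_add_finrank_orthogonal
    rw [finrank_span_singleton hν0] at h2
    have : finrank ℝ (V ⧸ T) = 1 := by
      change 1 + finrank ℝ T = _ at h2
      omega
    rw [this, LinearMap.det_id, pow_one, mul_one]
  have hdet := LinearMap.det_eq_det_mul_det T C hCT
  have h1 : (C.restrict hCT).normDet = |C.det| * ‖w‖ := by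
    rw [normDet_eq_abs_det, hdet, hq, abs_mul, abs_inv, abs_norm, mul_assoc, inv_mul_cancel₀ hw',
      mul_one]
  have h2 : (C.restrict hCT).normDet = (C.domRestrict T).normDet :=
    normDet_codRestrict (f := C.domRestrict T) fun c => hCT c.1 c.2
  have h3 : C.domRestrict T = R.toLinearIsometry.toLinearMap ∘ₗ A.domRestrict T := rfl
  have h4 : (R.toLinearIsometry.toLinearMap.domRestrict (A.domRestrict T).range).normDet = 1 :=
    (R.toLinearIsometry.comp (A.domRestrict T).range.subtypeₗᵢ).normDet_eq_one
  rw [← hdetC, ← h1, h2, h3, normDet_comp, h4, one_mul]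

theorem LinearMap.euclideanHausdorffMeasure_image_of_subset_orthogonal [MeasurableSpace V]
    [BorelSpace V] (A : V →ₗ[ℝ] V) {ν w : V} (hν : ‖ν‖ = 1) (hA : ∀ v, ⟪w, A v⟫ = ⟪ν, v⟫)
    {s : Set V} (hs : s ⊆ (ℝ ∙ ν)ᗮ) :
    μHE[finrank ℝ V - 1] (A '' s) = ENNReal.ofReal (|A.det| * ‖w‖) * μHE[finrank ℝ V - 1] s := by
  have hν0 : ν ≠ 0 := by rintro rfl; simp at hν
  obtain ⟨t, rfl⟩ : ∃ t : Set (ℝ ∙ ν)ᗮ, Subtype.val '' t = s :=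
    ⟨Subtype.val ⁻¹' s, by rw [image_preimage_eq_inter_range]; simpa using hs⟩
  have := (A.domRestrict (ℝ ∙ ν)ᗮ).euclideanHausdorffMeasure_image t
  rw [finrank_orthogonal_singleton hν0, A.normDet_domRestrict_orthogonal hν hA] at this
  rw [← isometry_subtype_coe.euclideanHausdorffMeasure_image t] at this
  refine Eq.trans ?_ this
  rw [image_image]
  rfl

/-- Near `x`, the set `S` is tangent to the hyperplane orthogonal to `ν`, in the strict sense. -/
def IsStrictlyTangentAt (S : Set V) (x ν : V) : Prop :=
  (fun p : V × V => ⟪ν, p.1 - p.2⟫) =o[𝓝 (x, x) ⊓ 𝓟 (S ×ˢ S)] fun p => p.1 - p.2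

theorem Asymptotics.IsEquivalent.eventually_norm_le {α β : Type*} [NormedAddCommGroup β]
    {l : Filter α} {u v : α → β} (h : u ~[l] v) {K : ℝ} (hK : 1 < K) :
    ∀ᶠ a in l, ‖u a‖ ≤ K * ‖v a‖ := by
  filter_upwards [h.isLittleO.def (sub_pos.2 hK)] with a ha
  have := norm_le_norm_add_norm_sub' (u a) (v a)
  simp only [Pi.sub_apply] at ha
  linarith

-- Projecting to the tangent plane removes only the normal component, which strict tangency makes
-- negligible.
omit [FiniteDimensional ℝ V] in
theorem IsStrictlyTangentAt.isEquivalent_starProjection {S : Set V} {x ν : V} (hν : ‖ν‖ = 1)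
    (h : IsStrictlyTangentAt S x ν) :
    (fun p : V × V => (ℝ ∙ ν)ᗮ.starProjection (p.1 - p.2)) ~[𝓝 (x, x) ⊓ 𝓟 (S ×ˢ S)]
      fun p => p.1 - p.2 := by
  refine IsLittleO.isEquivalent (IsBigO.trans_isLittleO ?_ h)
  refine IsBigO.of_bound 1 (Eventually.of_forall fun p => ?_)
  have : (ℝ ∙ ν)ᗮ.starProjection (p.1 - p.2) - (p.1 - p.2) = -(⟪ν, p.1 - p.2⟫ • ν) := by
    rw [Submodule.starProjection_orthogonal_val,
      Submodule.starProjection_unit_singleton ℝ hν]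
    abel
  simp only [Pi.sub_apply]
  rw [this, norm_neg, norm_smul, hν, mul_one, one_mul]

/-- Injectivity of `A` bounds increments by their images, so an error that is small against the
increment is small against the linear model too. -/
theorem IsStrictlyTangentAt.isEquivalent_map {S : Set V} {x ν : V} (hν : ‖ν‖ = 1)
    (h : IsStrictlyTangentAt S x ν) {Φ : V → V} {A : V →L[ℝ] V} (hA : Function.Injective A)
    (hΦ : HasStrictFDerivAt Φ A x) :
    (fun p : V × V => Φ p.1 - Φ p.2) ~[𝓝 (x, x) ⊓ 𝓟 (S ×ˢ S)]
      fun p => A ((ℝ ∙ ν)ᗮ.starProjection (p.1 - p.2)) := by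
  have h1 := h.isEquivalent_starProjection hν
  have h2 : (fun p : V × V => p.1 - p.2) =O[𝓝 (x, x) ⊓ 𝓟 (S ×ˢ S)]
      fun p => A ((ℝ ∙ ν)ᗮ.starProjection (p.1 - p.2)) := by
    obtain ⟨K, -, hK⟩ := (A : V →ₗ[ℝ] V).exists_antilipschitzWith (LinearMap.ker_eq_bot.2 hA)
    refine h1.isBigO_symm.trans (IsBigO.of_bound K (Eventually.of_forall fun p => ?_))
    exact ZeroHomClass.bound_of_antilipschitz (A : V →ₗ[ℝ] V) hK _
  refine IsLittleO.isEquivalent (IsLittleO.trans_isBigO ?_ h2)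
  have h3 := (hΦ.isLittleO.mono (inf_le_left : 𝓝 (x, x) ⊓ 𝓟 (S ×ˢ S) ≤ _)).sub
    ((A.isBigO_comp _ _).trans_isLittleO h1.isLittleO)
  refine h3.congr_left fun p => ?_
  simp only [Pi.sub_apply, map_sub]
  abel

/-- Passing from `B` to its tangential projection and from the linear image of that projection to `Φ
'' B` distorts distances by at most `K`. Between the two projected sets the linear area formula is
exact. Projection does not increase measure, hence the single power of `K` in the first bound. -/
theorem IsStrictlyTangentAt.exists_nhds_measure_image_comparison [MeasurableSpace V] [BorelSpace V]
    {S : Set V} {x ν w : V} (hν : ‖ν‖ = 1) (h : IsStrictlyTangentAt S x ν) {Φ : V → V}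
    {A : V →L[ℝ] V} (hA : Function.Injective A) (hΦ : HasStrictFDerivAt Φ A x)
    (hw : ∀ v, ⟪w, A v⟫ = ⟪ν, v⟫) {K : ℝ≥0} (hK : 1 < K) :
    ∃ U ∈ 𝓝 x, ∀ B ⊆ S ∩ U,
      μHE[finrank ℝ V - 1] (Φ '' B) ≤
        K ^ (finrank ℝ V - 1) * (ENNReal.ofReal (|A.det| * ‖w‖) * μHE[finrank ℝ V - 1] B) ∧
      ENNReal.ofReal (|A.det| * ‖w‖) * μHE[finrank ℝ V - 1] B ≤
        K ^ (finrank ℝ V - 1) * (K ^ (finrank ℝ V - 1) * μHE[finrank ℝ V - 1] (Φ '' B)) := by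
  set d := finrank ℝ V - 1
  have h1 := h.isEquivalent_starProjection hν
  have h2 := h.isEquivalent_map hν hA hΦ
  set P := (ℝ ∙ ν)ᗮ.starProjection
  have hK' : (1 : ℝ) < K := hK
  obtain ⟨U, hU, hyz⟩ := exists_nhds_forall_of_eventually_prod
    (P := fun y z => ‖y - z‖ ≤ K * ‖P (y - z)‖ ∧ ‖Φ y - Φ z‖ ≤ K * ‖A (P (y - z))‖ ∧
      ‖A (P (y - z))‖ ≤ K * ‖Φ y - Φ z‖)
    ((h1.symm.eventually_norm_le hK').and
      ((h2.eventually_norm_le hK').and (h2.symm.eventually_norm_le hK')))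
  have hed : ∀ {a b c e : V} {M : ℝ≥0}, ‖a - b‖ ≤ M * ‖c - e‖ → edist a b ≤ M * edist c e := by
    intro a b c e M hh
    rw [edist_dist, edist_dist, dist_eq_norm, dist_eq_norm, ← ENNReal.ofReal_coe_nnreal,
      ← ENNReal.ofReal_mul M.coe_nonneg]
    exact ENNReal.ofReal_le_ofReal hh
  refine ⟨U, hU, fun B hB => ?_⟩
  have hlin : μHE[d] ((fun y => A (P y)) '' B) =
      ENNReal.ofReal (|A.det| * ‖w‖) * μHE[d] (P '' B) := by
    rw [← LinearMap.euclideanHausdorffMeasure_image_of_subset_orthogonal (A : V →ₗ[ℝ] V) hν hw,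
      image_image]
    · rfl
    · rintro _ ⟨y, -, rfl⟩
      exact Submodule.starProjection_apply_mem _ _
  have hPle : μHE[d] (P '' B) ≤ μHE[d] B := by
    have := euclideanHausdorffMeasure_image_le_of_edist_le (K := 1) (f := P) (g := id) (s := B) d ?_
    · simpa using this
    · intro y _ z _
      refine hed ?_
      rw [← map_sub, NNReal.coe_one, one_mul]
      exact Submodule.norm_starProjection_apply_le _ _
  have hleP : μHE[d] B ≤ K ^ d * μHE[d] (P '' B) := by
    have := euclideanHausdorffMeasure_image_le_of_edist_le (K := K) (f := id) (g := P) (s := B) d ?_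
    · simpa using this
    · intro y hy z hz
      refine hed ?_
      rw [← map_sub]
      exact (hyz y (hB hy) z (hB hz)).1
  have h3 : μHE[d] (Φ '' B) ≤ K ^ d * μHE[d] ((fun y => A (P y)) '' B) :=
    euclideanHausdorffMeasure_image_le_of_edist_le d fun y hy z hz => hed (by
      rw [← map_sub, ← map_sub]
      exact (hyz y (hB hy) z (hB hz)).2.1)
  have h4 : μHE[d] ((fun y => A (P y)) '' B) ≤ K ^ d * μHE[d] (Φ '' B) :=
    euclideanHausdorffMeasure_image_le_of_edist_le d fun y hy z hz => hed (by
      rw [← map_sub, ← map_sub]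
      exact (hyz y (hB hy) z (hB hz)).2.2)
  constructor
  · refine h3.trans ?_
    rw [hlin]
    gcongr
  · calc _ ≤ ENNReal.ofReal (|A.det| * ‖w‖) * (K ^ d * μHE[d] (P '' B)) := by gcongr
      _ = K ^ d * μHE[d] ((fun y => A (P y)) '' B) := by rw [hlin]; ring
      _ ≤ _ := by gcongr

end AreaFormula

/-! ### The area formula for hypersurfaces. -/

section AreaIntegral
open Asymptotics Measure Module
open scoped ENNReal NNReal

variable {V : Type*} [NormedAddCommGroup V] [InnerProductSpace ℝ V] [FiniteDimensional ℝ V]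

/-- The Jacobian of `A` along the hyperplane orthogonal to `ν`, where `w` is the image of `ν` under
the inverse of the adjoint of `A`. -/
noncomputable def surfaceJacobian (A : V →L[ℝ] V) (w : V) : ℝ := |A.det| * ‖w‖

theorem surfaceJacobian_pos {A : V →L[ℝ] V} {ν w : V} (hν : ‖ν‖ = 1) (hA : Function.Injective A)
    (hw : ∀ v, ⟪w, A v⟫ = ⟪ν, v⟫) : 0 < surfaceJacobian A w := by
  refine mul_pos (abs_pos.2 fun h => ?_) (norm_pos_iff.2 ?_)
  · have : LinearMap.ker (A : V →ₗ[ℝ] V) = ⊥ := LinearMap.ker_eq_bot.2 hA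
    exact absurd this (LinearMap.bot_lt_ker_of_det_eq_zero h).ne'
  · rintro rfl
    have := hw ν
    rw [inner_zero_left, real_inner_self_eq_norm_sq, hν] at this
    norm_num at this

theorem exists_one_lt_pow_le {k : ℝ≥0} (hk : 1 < k) (m : ℕ) : ∃ K : ℝ≥0, 1 < K ∧ K ^ m ≤ k := by
  have h : ∀ᶠ K : ℝ≥0 in 𝓝[>] 1, K ^ m < k :=
    ((continuous_pow m).tendsto (1 : ℝ≥0)).mono_left nhdsWithin_le_nhds
      |>.eventually_lt_const (by simpa using hk)
  obtain ⟨K, hK, hK1⟩ := (h.and self_mem_nhdsWithin).exists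
  exact ⟨K, hK1, hK.le⟩

variable [MeasurableSpace V] [BorelSpace V] {S : Set V} {ν w : V → V} {Φ : V → V} {Φ' : V → V →L[ℝ] V}

theorem measurableEmbedding_domRestrict (hS : MeasurableSet S)
    (hΦ : ContinuousOn Φ S) (hinj : InjOn Φ S) : MeasurableEmbedding (S.domRestrict Φ) :=
  hΦ.measurableEmbedding hS hinj

/-- Both measures live on the subtype `S`, where each inequality can be tested locally up to a
factor close to 1: the linear comparison applies near a point, and continuity lets the Jacobian be
frozen at that point. -/
theorem comap_domRestrict_euclideanHausdorffMeasure (hS : MeasurableSet S)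
    (hν : ∀ x ∈ S, ‖ν x‖ = 1) (ht : ∀ x ∈ S, IsStrictlyTangentAt S x (ν x))
    (hΦ : ∀ x ∈ S, HasStrictFDerivAt Φ (Φ' x) x) (hΦ' : ∀ x ∈ S, Function.Injective (Φ' x))
    (hw : ∀ x ∈ S, ∀ v, ⟪w x, Φ' x v⟫ = ⟪ν x, v⟫)
    (hJ : ContinuousOn (fun x => surfaceJacobian (Φ' x) (w x)) S) (hinj : InjOn Φ S) :
    comap (S.domRestrict Φ) μHE[finrank ℝ V - 1] =
      (comap (Subtype.val : S → V) μHE[finrank ℝ V - 1]).withDensity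
        fun x => ENNReal.ofReal (surfaceJacobian (Φ' x) (w x)) := by
  set d := finrank ℝ V - 1
  have hψ := measurableEmbedding_domRestrict hS
    (fun x hx => (hΦ x hx).continuousAt.continuousWithinAt) hinj
  have hj := MeasurableEmbedding.subtype_coe hS
  have hα : ∀ B : Set S, comap (S.domRestrict Φ) μHE[d] B = μHE[d] (Φ '' (Subtype.val '' B)) :=
    fun B => by rw [hψ.comap_apply, image_image]; rfl
  have hlocal : ∀ K : ℝ≥0, 1 < K → ∀ x : S, ∃ U ∈ 𝓝 x, ∀ B ⊆ U, MeasurableSet B →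
      comap (S.domRestrict Φ) μHE[d] B ≤ K ^ d * (K * ((comap (Subtype.val : S → V)
        μHE[d]).withDensity fun x => ENNReal.ofReal (surfaceJacobian (Φ' x) (w x))) B) ∧
      ((comap (Subtype.val : S → V) μHE[d]).withDensity
        fun x => ENNReal.ofReal (surfaceJacobian (Φ' x) (w x))) B ≤
        K * (K ^ d * (K ^ d * comap (S.domRestrict Φ) μHE[d] B)) := by
    rintro K hK ⟨x, hx⟩
    obtain ⟨U, hU, hcomp⟩ := (ht x hx).exists_nhds_measure_image_comparison (hν x hx) (hΦ' x hx)
      (hΦ x hx) (hw x hx) hK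
    change ∀ B ⊆ S ∩ U, μHE[d] (Φ '' B) ≤
        K ^ d * (ENNReal.ofReal (surfaceJacobian (Φ' x) (w x)) * μHE[d] B) ∧
      ENNReal.ofReal (surfaceJacobian (Φ' x) (w x)) * μHE[d] B ≤
        K ^ d * (K ^ d * μHE[d] (Φ '' B)) at hcomp
    have hJ' : Continuous fun y : S => surfaceJacobian (Φ' y) (w y) :=
      continuousOn_iff_continuous_domRestrict.1 hJ
    set J₀ := surfaceJacobian (Φ' x) (w x)
    have hJ₀ : 0 < J₀ := surfaceJacobian_pos (hν x hx) (hΦ' x hx) (hw x hx)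
    have hK' : (1 : ℝ) < K := hK
    have e1 : ∀ᶠ y : S in 𝓝 ⟨x, hx⟩, surfaceJacobian (Φ' y) (w y) < K * J₀ :=
      (hJ'.tendsto ⟨x, hx⟩).eventually_lt_const (show J₀ < K * J₀ by nlinarith)
    have e2 : ∀ᶠ y : S in 𝓝 ⟨x, hx⟩, J₀ < K * surfaceJacobian (Φ' y) (w y) :=
      ((hJ'.tendsto ⟨x, hx⟩).const_mul (K : ℝ)).eventually_const_lt
        (show J₀ < K * J₀ by nlinarith)
    have e3 : ∀ᶠ y : S in 𝓝 ⟨x, hx⟩, (y : V) ∈ U := continuous_subtype_val.tendsto _ hU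
    refine ⟨_, (e1.and e2).and e3, fun B hB hBm => ?_⟩
    have hBU : Subtype.val '' B ⊆ S ∩ U := by
      rintro _ ⟨y, hy, rfl⟩
      exact ⟨y.2, (hB hy).2⟩
    obtain ⟨c1, c2⟩ := hcomp _ hBU
    have hμ : comap (Subtype.val : S → V) μHE[d] B = μHE[d] (Subtype.val '' B) :=
      hj.comap_apply _ _
    rw [hα, withDensity_apply _ hBm]
    constructor
    · refine c1.trans ?_
      refine mul_le_mul_right ?_ _
      rw [← hμ, ← setLIntegral_const, ← lintegral_const_mul' _ _ ENNReal.coe_ne_top]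
      refine setLIntegral_mono' hBm fun y hy => ?_
      rw [← ENNReal.ofReal_coe_nnreal, ← ENNReal.ofReal_mul K.coe_nonneg]
      exact ENNReal.ofReal_le_ofReal (hB hy).1.2.le
    · calc _ ≤ ∫⁻ y in B, K * ENNReal.ofReal J₀ ∂(comap (Subtype.val : S → V) μHE[d]) := by
            refine setLIntegral_mono' hBm fun y hy => ?_
            rw [← ENNReal.ofReal_coe_nnreal, ← ENNReal.ofReal_mul K.coe_nonneg]
            exact ENNReal.ofReal_le_ofReal (hB hy).1.1.le
        _ = K * (ENNReal.ofReal J₀ * μHE[d] (Subtype.val '' B)) := by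
            rw [setLIntegral_const, hμ, mul_assoc]
        _ ≤ _ := by gcongr
  refine le_antisymm (Measure.le_of_locally_le fun k hk x => ?_)
    (Measure.le_of_locally_le fun k hk x => ?_)
  -- The exponent counts `d` factors from the metric comparison and one from freezing the Jacobian;
  -- the reverse inequality uses the metric comparison twice.
  · obtain ⟨K, hK, hKk⟩ := exists_one_lt_pow_le hk (d + 1)
    obtain ⟨U, hU, h⟩ := hlocal K hK x
    refine ⟨U, hU, fun B hB hBm => (h B hB hBm).1.trans ?_⟩
    rw [← mul_assoc, ← pow_succ]
    gcongr
    exact_mod_cast hKk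
  · obtain ⟨K, hK, hKk⟩ := exists_one_lt_pow_le hk (d + d + 1)
    obtain ⟨U, hU, h⟩ := hlocal K hK x
    refine ⟨U, hU, fun B hB hBm => (h B hB hBm).2.trans ?_⟩
    rw [← mul_assoc (_ ^ d), ← pow_add, ← mul_assoc, ← pow_succ']
    gcongr
    exact_mod_cast hKk

/-- **Area formula** for the image of a hypersurface under a map defined around it. -/
theorem setIntegral_image_euclideanHausdorffMeasure (hS : MeasurableSet S)
    (hν : ∀ x ∈ S, ‖ν x‖ = 1) (ht : ∀ x ∈ S, IsStrictlyTangentAt S x (ν x))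
    (hΦ : ∀ x ∈ S, HasStrictFDerivAt Φ (Φ' x) x) (hΦ' : ∀ x ∈ S, Function.Injective (Φ' x))
    (hw : ∀ x ∈ S, ∀ v, ⟪w x, Φ' x v⟫ = ⟪ν x, v⟫)
    (hJ : ContinuousOn (fun x => surfaceJacobian (Φ' x) (w x)) S) (hinj : InjOn Φ S) (g : V → ℝ) :
    ∫ y in Φ '' S, g y ∂μHE[finrank ℝ V - 1] =
      ∫ x in S, surfaceJacobian (Φ' x) (w x) * g (Φ x) ∂μHE[finrank ℝ V - 1] := by
  have hψ := measurableEmbedding_domRestrict hS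
    (fun x hx => (hΦ x hx).continuousAt.continuousWithinAt) hinj
  have hj := MeasurableEmbedding.subtype_coe hS
  have hrange : range (S.domRestrict Φ) = Φ '' S := by ext; simp
  have hJ' : Continuous fun y : S => surfaceJacobian (Φ' y) (w y) :=
    continuousOn_iff_continuous_domRestrict.1 hJ
  rw [← hrange, ← hψ.map_comap, hψ.integral_map,
    comap_domRestrict_euclideanHausdorffMeasure hS hν ht hΦ hΦ' hw hJ hinj]
  simp only [ENNReal.ofReal]
  rw [integral_withDensity_eq_integral_smul hJ'.measurable.real_toNNReal, ← map_comap_subtype_coe hS,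
    hj.integral_map]
  refine integral_congr_ae (Eventually.of_forall fun x => ?_)
  simp only [domRestrict_apply, NNReal.smul_def, smul_eq_mul]
  rw [Real.coe_toNNReal _ (surfaceJacobian_pos (hν x x.2) (hΦ' x x.2) (hw x x.2)).le]

end AreaIntegral

/-! ### Geometry of a boundary given by a defining function. -/

section DefiningFunction
open Asymptotics

variable {V : Type*} [NormedAddCommGroup V] [InnerProductSpace ℝ V] [FiniteDimensional ℝ V]

theorem inner_gradient_eq_fderiv (f : V → ℝ) (x v : V) : ⟪gradient f x, v⟫ = fderiv ℝ f x v := by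
  rw [gradient, InnerProductSpace.toDual_symm_apply]

theorem innerSL_gradient (f : V → ℝ) (x : V) : innerSL ℝ (gradient f x) = fderiv ℝ f x :=
  ContinuousLinearMap.ext fun v => inner_gradient_eq_fderiv f x v

/-- On the open set `U`, the set `Ω` is the sublevel set `{ρ < 0}` of a `C¹` function `ρ` without
critical points. -/
structure IsDefiningFunctionOn (Ω U : Set V) (ρ : V → ℝ) : Prop where
  isOpen : IsOpen U
  contDiffOn : ContDiffOn ℝ 1 ρ U
  gradient_ne_zero : ∀ x ∈ U, gradient ρ x ≠ 0
  mem_iff : ∀ y ∈ U, y ∈ Ω ↔ ρ y < 0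

namespace IsDefiningFunctionOn

variable {Ω U : Set V} {ρ : V → ℝ}

theorem contDiffAt (h : IsDefiningFunctionOn Ω U ρ) {x : V} (hx : x ∈ U) : ContDiffAt ℝ 1 ρ x :=
  h.contDiffOn.contDiffAt (h.isOpen.mem_nhds hx)

theorem hasStrictFDerivAt (h : IsDefiningFunctionOn Ω U ρ) {x : V} (hx : x ∈ U) :
    HasStrictFDerivAt ρ (innerSL ℝ (gradient ρ x)) x := by
  rw [innerSL_gradient]
  exact (h.contDiffAt hx).hasStrictFDerivAt one_ne_zero

theorem continuousOn_gradient (h : IsDefiningFunctionOn Ω U ρ) : ContinuousOn (gradient ρ) U :=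
  (LinearIsometryEquiv.continuous _).comp_continuousOn
    (h.contDiffOn.continuousOn_fderiv_of_isOpen h.isOpen le_rfl)

theorem continuousAt (h : IsDefiningFunctionOn Ω U ρ) {x : V} (hx : x ∈ U) : ContinuousAt ρ x :=
  (h.contDiffAt hx).continuousAt

/-- At a zero of `ρ`, a small move against the nonzero gradient makes `ρ` negative, so the zero is a
limit of points of `Ω`. The converse is continuity of `ρ` and openness of `Ω`. -/
theorem mem_frontier_iff (h : IsDefiningFunctionOn Ω U ρ) (hΩ : IsOpen Ω) {x : V} (hx : x ∈ U) :
    x ∈ frontier Ω ↔ ρ x = 0 := by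
  have hU := h.isOpen.mem_nhds hx
  constructor
  · rintro ⟨hcl, hint⟩
    rw [hΩ.interior_eq, h.mem_iff x hx, not_lt] at hint
    refine le_antisymm (not_lt.1 fun hpos => ?_) hint
    obtain ⟨y, hy, hyΩ⟩ := mem_closure_iff_nhds.1 hcl _
      (inter_mem hU ((h.continuousAt hx).eventually_const_lt hpos))
    exact lt_asymm hy.2 ((h.mem_iff y hy.1).1 hyΩ)
  · intro hρ
    refine ⟨?_, ?_⟩
    · set g := gradient ρ x
      have hg : 0 < ⟪g, g⟫ := by
        rw [real_inner_self_eq_norm_sq]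
        exact pow_pos (norm_pos_iff.2 (h.gradient_ne_zero x hx)) 2
      have hc : HasDerivAt (fun s : ℝ => x - s • g) (-g) 0 := by
        simpa using ((hasDerivAt_id (0 : ℝ)).smul_const g).const_sub x
      have hd : HasDerivAt (fun s : ℝ => ρ (x - s • g)) (-⟪g, g⟫) 0 := by
        have := HasFDerivAt.comp_hasDerivAt_of_eq (0 : ℝ) (h.hasStrictFDerivAt hx).hasFDerivAt hc
          (by simp)
        rwa [map_neg, innerSL_apply_apply] at this
      have h0 : Tendsto (fun s : ℝ => x - s • g) (𝓝[>] 0) (𝓝 x) := by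
        have := hc.continuousAt.tendsto
        simp only [zero_smul, sub_zero] at this
        exact this.mono_left nhdsWithin_le_nhds
      refine mem_closure_of_tendsto h0 ?_
      have h1 := (hasDerivAt_iff_tendsto_slope_zero.1 hd).mono_left
        (nhdsWithin_mono (0 : ℝ) (fun s (hs : 0 < s) => (ne_of_gt hs : s ≠ 0)))
      filter_upwards [h1.eventually_lt_const (neg_lt_zero.2 hg), h0.eventually hU,
        self_mem_nhdsWithin] with s hs hsU hs0
      rw [h.mem_iff _ hsU]
      simp only [zero_add, zero_smul, sub_zero, hρ, smul_eq_mul] at hs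
      have hs0' : (0 : ℝ) < s⁻¹ := inv_pos.2 hs0
      by_contra hcon
      exact absurd hs (not_lt.2 (mul_nonneg hs0'.le (not_lt.1 hcon)))
    · rw [hΩ.interior_eq, h.mem_iff x hx, hρ]
      exact lt_irrefl _

theorem exists_of_contDiffOn {W : Set V} (hW : IsOpen W) (hρ : ContDiffOn ℝ 1 ρ W)
    {x : V} (hx : x ∈ W) (hne : fderiv ℝ ρ x ≠ 0) (hΩ : ∀ y ∈ W, y ∈ Ω ↔ ρ y < 0) :
    ∃ U, x ∈ U ∧ IsDefiningFunctionOn Ω U ρ := by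
  have hc : ContinuousOn (fderiv ℝ ρ) W := hρ.continuousOn_fderiv_of_isOpen hW le_rfl
  refine ⟨W ∩ fderiv ℝ ρ ⁻¹' {0}ᶜ, ⟨hx, hne⟩, hc.isOpen_inter_preimage hW isOpen_compl_singleton,
    hρ.mono inter_subset_left, fun y hy h0 => hy.2 ?_, fun y hy => hΩ y hy.1⟩
  rw [← innerSL_gradient, h0, map_zero]
  rfl

/-- The unit normal given by a defining function. -/
noncomputable def _root_.unitGradient (ρ : V → ℝ) (x : V) : V := ‖gradient ρ x‖⁻¹ • gradient ρ x

theorem norm_unitGradient (h : IsDefiningFunctionOn Ω U ρ) {x : V} (hx : x ∈ U) :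
    ‖unitGradient ρ x‖ = 1 := by
  rw [unitGradient, norm_smul, norm_inv, norm_norm,
    inv_mul_cancel₀ (norm_ne_zero_iff.2 (h.gradient_ne_zero x hx))]

theorem continuousOn_unitGradient (h : IsDefiningFunctionOn Ω U ρ) :
    ContinuousOn (unitGradient ρ) U :=
  (h.continuousOn_gradient.norm.inv₀ fun x hx => norm_ne_zero_iff.2 (h.gradient_ne_zero x hx)).smul
    h.continuousOn_gradient

/-- Since `ρ` vanishes at both points of a pair on the frontier, strict differentiability of `ρ`
leaves only the linear term, which must therefore be negligible. -/
theorem isStrictlyTangentAt (h : IsDefiningFunctionOn Ω U ρ) (hΩ : IsOpen Ω) {x : V}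
    (hx : x ∈ U) : IsStrictlyTangentAt (frontier Ω) x (unitGradient ρ x) := by
  have h1 := ((h.hasStrictFDerivAt hx).isLittleO.mono
    (inf_le_left : 𝓝 (x, x) ⊓ 𝓟 (frontier Ω ×ˢ frontier Ω) ≤ _)).const_mul_left (-‖gradient ρ x‖⁻¹)
  refine h1.congr' ?_ EventuallyEq.rfl
  rw [EventuallyEq, eventually_inf_principal]
  filter_upwards [prod_mem_nhds (h.isOpen.mem_nhds hx) (h.isOpen.mem_nhds hx)] with p hp hpf
  rw [(h.mem_frontier_iff hΩ hp.1).1 hpf.1, (h.mem_frontier_iff hΩ hp.2).1 hpf.2, unitGradient,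
    inner_smul_left, innerSL_apply_apply, sub_self, zero_sub, RCLike.conj_to_real, neg_mul_neg]

/-- The differential of the straightening map `x ↦ x + (ρ x - ⟪e, x⟫) e`, where `g` is the gradient
of `ρ`. -/
noncomputable def _root_.straighteningDeriv (e g : V) : V →L[ℝ] V :=
  ContinuousLinearMap.id ℝ V + (innerSL ℝ (g - e)).smulRight e

omit [FiniteDimensional ℝ V] in
theorem _root_.straighteningDeriv_apply (e g v : V) :
    straighteningDeriv e g v = v + (⟪g, v⟫ - ⟪e, v⟫) • e := by
  simp [straighteningDeriv]

omit [FiniteDimensional ℝ V] in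
theorem _root_.inner_straighteningDeriv {e : V} (he : ‖e‖ = 1) (g v : V) :
    ⟪e, straighteningDeriv e g v⟫ = ⟪g, v⟫ := by
  rw [straighteningDeriv_apply, inner_add_right, inner_smul_right, real_inner_self_eq_norm_sq, he]
  ring

theorem _root_.det_straighteningDeriv {e : V} (he : ‖e‖ = 1) (g : V) :
    (straighteningDeriv e g).det = ⟪g, e⟫ := by
  have h1 : ((straighteningDeriv e g : V →L[ℝ] V) : V →ₗ[ℝ] V) =
      LinearMap.transvection (innerSL ℝ (g - e) : V →L[ℝ] ℝ).toLinearMap e := by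
    ext v
    simp [straighteningDeriv, LinearMap.transvection.apply]
  rw [ContinuousLinearMap.det, h1, LinearMap.transvection.det]
  simp [he]

omit [FiniteDimensional ℝ V] in
theorem _root_.straighteningDeriv_injective {e g : V} (he : ‖e‖ = 1) (hg : ⟪g, e⟫ ≠ 0) :
    Function.Injective (straighteningDeriv e g) := by
  refine (injective_iff_map_eq_zero _).2 fun v hv => ?_
  have h1 := inner_straighteningDeriv he g v
  rw [hv, inner_zero_right] at h1
  rw [straighteningDeriv_apply, ← h1, zero_sub, neg_smul, ← sub_eq_add_neg, sub_eq_zero] at hv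
  rw [hv, inner_smul_right] at h1
  rw [hv, (mul_eq_zero.1 h1.symm).resolve_right hg, zero_smul]

/-- The differential of the straightening map as an equivalence. -/
noncomputable def _root_.straighteningEquiv {e g : V} (he : ‖e‖ = 1) (hg : ⟪g, e⟫ ≠ 0) : V ≃L[ℝ] V :=
  (LinearEquiv.ofInjectiveEndo (straighteningDeriv e g : V →ₗ[ℝ] V)
    (straighteningDeriv_injective he hg)).toContinuousLinearEquiv

/-- The map `x ↦ x + (ρ x - ⟪e, x⟫) e` which straightens the level sets of `ρ`. -/
noncomputable def _root_.straightening (e : V) (ρ : V → ℝ) (x : V) : V := x + (ρ x - ⟪e, x⟫) • e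

omit [FiniteDimensional ℝ V] in
theorem _root_.inner_straightening {e : V} (he : ‖e‖ = 1) (ρ : V → ℝ) (x : V) :
    ⟪e, straightening e ρ x⟫ = ρ x := by
  rw [straightening, inner_add_right, inner_smul_right, real_inner_self_eq_norm_sq, he]
  ring

theorem hasStrictFDerivAt_straightening (h : IsDefiningFunctionOn Ω U ρ) (e : V) {x : V}
    (hx : x ∈ U) : HasStrictFDerivAt (straightening e ρ) (straighteningDeriv e (gradient ρ x)) x := by
  have h1 := (hasStrictFDerivAt_id x).add
    (((h.hasStrictFDerivAt hx).sub (innerSL ℝ e).hasStrictFDerivAt).smul_const e)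
  rw [← map_sub] at h1
  exact h1

theorem contDiffAt_straightening (h : IsDefiningFunctionOn Ω U ρ) (e : V) {x : V}
    (hx : x ∈ U) : ContDiffAt ℝ 1 (straightening e ρ) x :=
  contDiffAt_id.add (((h.contDiffAt hx).sub (innerSL ℝ e).contDiff.contDiffAt).smul contDiffAt_const)

/-- The local inverse of the straightening map bends the line with direction `τ` into a curve on the
frontier, and its velocity at `x` is still `τ`. -/
theorem mem_posTangentConeAt (h : IsDefiningFunctionOn Ω U ρ) (hΩ : IsOpen Ω) {x : V} (hx : x ∈ U)
    (hxf : x ∈ frontier Ω) {τ : V} (hτ : ⟪unitGradient ρ x, τ⟫ = 0) :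
    τ ∈ posTangentConeAt (frontier Ω) x := by
  set e := unitGradient ρ x
  have he : ‖e‖ = 1 := h.norm_unitGradient hx
  have hg0 : ‖gradient ρ x‖ ≠ 0 := norm_ne_zero_iff.2 (h.gradient_ne_zero x hx)
  have hge : gradient ρ x = ‖gradient ρ x‖ • e := by
    rw [show e = ‖gradient ρ x‖⁻¹ • gradient ρ x from rfl, smul_smul, mul_inv_cancel₀ hg0, one_smul]
  have hgτ : ⟪gradient ρ x, τ⟫ = 0 := by rw [hge, inner_smul_left, hτ, mul_zero]
  have hne : ⟪gradient ρ x, e⟫ ≠ 0 := by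
    rw [hge, inner_smul_left, real_inner_self_eq_norm_sq, he]
    simpa using hg0
  have hs : HasStrictFDerivAt (straightening e ρ) (straighteningEquiv he hne : V →L[ℝ] V) x :=
    h.hasStrictFDerivAt_straightening e hx
  set Ψ := hs.localInverse
  have hΨ := hs.to_localInverse.hasFDerivAt
  have hsymm : (straighteningEquiv he hne).symm τ = τ := by
    rw [ContinuousLinearEquiv.symm_apply_eq]
    change τ = straighteningDeriv e (gradient ρ x) τ
    rw [straighteningDeriv_apply, hgτ, hτ, sub_zero, zero_smul, add_zero]
  have hline : HasDerivAt (fun s : ℝ => straightening e ρ x + s • τ) τ 0 := by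
    simpa using ((hasDerivAt_id (0 : ℝ)).smul_const τ).const_add (straightening e ρ x)
  have hγ : HasDerivAt (fun s : ℝ => Ψ (straightening e ρ x + s • τ)) τ 0 := by
    have := HasFDerivAt.comp_hasDerivAt_of_eq (0 : ℝ) hΨ hline (by simp)
    change HasDerivAt _ ((straighteningEquiv he hne).symm τ) 0 at this
    rwa [hsymm] at this
  have hΨx : Ψ (straightening e ρ x) = x := hs.localInverse_apply_image
  have hlim : Tendsto (fun s : ℝ => straightening e ρ x + s • τ) (𝓝[>] 0)
      (𝓝 (straightening e ρ x)) := by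
    have := hline.continuousAt.tendsto
    simp only [zero_smul, add_zero] at this
    exact this.mono_left nhdsWithin_le_nhds
  have hΨlim : Tendsto (fun s : ℝ => Ψ (straightening e ρ x + s • τ)) (𝓝[>] 0) (𝓝 x) := by
    have := hγ.continuousAt.tendsto
    simp only [zero_smul, add_zero, hΨx] at this
    exact this.mono_left nhdsWithin_le_nhds
  -- The positive tangent cone has nonnegative scalars, so the factor `s⁻¹` is taken in `NNReal`
  -- along `s > 0`.
  refine mem_tangentConeAt_of_seq (𝓝[>] (0 : ℝ)) (fun s => s.toNNReal⁻¹)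
    (fun s => Ψ (straightening e ρ x + s • τ) - x) ?_ ?_ ?_
  · simpa using hΨlim.sub_const x
  · filter_upwards [hlim.eventually hs.eventually_right_inverse,
      hΨlim.eventually (h.isOpen.mem_nhds hx)] with s hs1 hs2
    rw [add_sub_cancel, h.mem_frontier_iff hΩ hs2, ← inner_straightening he ρ, hs1, inner_add_right,
      inner_smul_right, hτ, inner_straightening he, (h.mem_frontier_iff hΩ hx).1 hxf]
    ring
  · have h1 := (hasDerivAt_iff_tendsto_slope_zero.1 hγ).mono_left
      (nhdsWithin_mono (0 : ℝ) (show Ioi (0 : ℝ) ⊆ {0}ᶜ from fun s hs => ne_of_gt hs))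
    refine h1.congr' ?_
    filter_upwards [self_mem_nhdsWithin] with s hs
    have hs : 0 < s := hs
    rw [NNReal.smul_def, NNReal.coe_inv, Real.coe_toNNReal s hs.le, zero_add, zero_smul, add_zero,
      hΨx]

/-- Near `x` the projection to the tangent plane has a 2-Lipschitz inverse on the frontier, and its
image is a bounded set in a space of dimension one less, hence of finite measure. -/
theorem exists_nhds_measure_frontier_lt_top [MeasurableSpace V] [BorelSpace V]
    (h : IsDefiningFunctionOn Ω U ρ) (hΩ : IsOpen Ω) {x : V} (hx : x ∈ U) :
    ∃ W ∈ 𝓝 x, μHE[Module.finrank ℝ V - 1] (frontier Ω ∩ W) < ⊤ := by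
  set ν := unitGradient ρ x
  have hν : ‖ν‖ = 1 := h.norm_unitGradient hx
  have hν0 : ν ≠ 0 := by rintro h0; simp [h0] at hν
  obtain ⟨W, hW, hyz⟩ := exists_nhds_forall_of_eventually_prod
    (P := fun y z => ‖y - z‖ ≤ 2 * ‖(ℝ ∙ ν)ᗮ.starProjection (y - z)‖)
    (((h.isStrictlyTangentAt hΩ hx).isEquivalent_starProjection hν).symm.eventually_norm_le
      one_lt_two)
  refine ⟨W ∩ Metric.ball x 1, inter_mem hW (Metric.ball_mem_nhds x one_pos), ?_⟩
  set B := frontier Ω ∩ (W ∩ Metric.ball x 1)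
  have h1 := euclideanHausdorffMeasure_image_le_of_edist_le (K := 2) (f := id)
    (g := (ℝ ∙ ν)ᗮ.orthogonalProjectionOnto) (s := B) (Module.finrank ℝ V - 1) (by
      intro y hy z hz
      have := hyz y ⟨hy.1, hy.2.1⟩ z ⟨hz.1, hz.2.1⟩
      rw [edist_dist, edist_dist, dist_eq_norm, dist_eq_norm, ← ENNReal.ofReal_coe_nnreal,
        ← ENNReal.ofReal_mul NNReal.zero_le_coe, ← map_sub]
      exact ENNReal.ofReal_le_ofReal this)
  rw [image_id] at h1
  refine h1.trans_lt (ENNReal.mul_lt_top (by finiteness) ?_)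
  rw [← finrank_orthogonal_singleton hν0]
  refine Bornology.IsBounded.measure_lt_top ?_
  refine ((ℝ ∙ ν)ᗮ.orthogonalProjectionOnto.lipschitz.isBounded_image ?_)
  exact Metric.isBounded_ball.subset (inter_subset_right.trans inter_subset_right)

end IsDefiningFunctionOn

end DefiningFunction

/-! ### Outward normals and smooth boundaries. -/

section SmoothBoundary

variable {n : ℕ} {Ω : Set (EuclideanSpace ℝ (Fin n))}

theorem HasSmoothBoundary.exists_isDefiningFunctionOn (h : HasSmoothBoundary Ω)
    {x : EuclideanSpace ℝ (Fin n)} (hx : x ∈ frontier Ω) :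
    ∃ U ρ, x ∈ U ∧ IsDefiningFunctionOn Ω U ρ := by
  obtain ⟨W, ρ, hW, hxW, hρ, hne, hmem⟩ := h x hx
  obtain ⟨U, hU⟩ := IsDefiningFunctionOn.exists_of_contDiffOn hW
    (hρ.of_le (by exact_mod_cast le_top)) hxW hne hmem
  exact ⟨U, ρ, hU⟩

/-- For unit vectors, `d = ν₁ - ν₂` satisfies ⟨d, ν₁⟩ = ‖d‖²/2 = −⟨d, ν₂⟩. A short move along `d`
would thus leave `Ω` according to `ν₁` and enter it according to `ν₂`. -/
theorem IsOutwardUnitNormal.unique {x ν₁ ν₂ : EuclideanSpace ℝ (Fin n)}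
    (h₁ : IsOutwardUnitNormal Ω x ν₁) (h₂ : IsOutwardUnitNormal Ω x ν₂) : ν₁ = ν₂ := by
  by_contra hne
  set d := ν₁ - ν₂ with hd
  have hdn : 0 < ‖d‖ := norm_pos_iff.2 (sub_ne_zero.2 hne)
  have hd2 : ‖d‖ ^ 2 = 2 * ⟪d, ν₁⟫ := by
    rw [hd, @norm_sub_sq_real, inner_sub_left, real_inner_self_eq_norm_sq, h₁.1, h₂.1,
      real_inner_comm ν₁ ν₂]
    ring
  have hd3 : ⟪d, ν₂⟫ = -⟪d, ν₁⟫ := by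
    rw [hd, inner_sub_left, inner_sub_left, real_inner_self_eq_norm_sq,
      real_inner_self_eq_norm_sq, h₁.1, h₂.1, real_inner_comm ν₁ ν₂]
    ring
  have ht : Tendsto (fun s : ℝ => x + s • d) (𝓝[>] 0) (𝓝 x) := by
    have : Continuous fun s : ℝ => x + s • d := by fun_prop
    have := this.tendsto 0
    simp only [zero_smul, add_zero] at this
    exact this.mono_left nhdsWithin_le_nhds
  -- The aperture `‖d‖ / 4` puts the direction `d` strictly inside both cones, since s‖d‖²/4 <
  -- s‖d‖²/2.
  have hε : 0 < ‖d‖ / 4 := by positivity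
  obtain ⟨s, ⟨hs1, hs2⟩, hs0⟩ := (((ht.eventually (h₁.2 _ hε)).and (ht.eventually (h₂.2 _ hε))).and
    self_mem_nhdsWithin).exists
  have hs0 : 0 < s := hs0
  simp only [add_sub_cancel_left, norm_smul, inner_smul_left, Real.norm_eq_abs, abs_of_pos hs0,
    conj_trivial, hd3] at hs1 hs2
  refine hs1.2 ?_ (hs2.1 ?_) <;> nlinarith [mul_pos hs0 (pow_pos hdn 2)]

theorem IsOutwardUnitNormal.outwardNormal_eq {x ν : EuclideanSpace ℝ (Fin n)}
    (h : IsOutwardUnitNormal Ω x ν) : outwardNormal Ω x = ν := by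
  have hex : ∃ ν, IsOutwardUnitNormal Ω x ν := ⟨ν, h⟩
  rw [outwardNormal, dif_pos hex]
  exact hex.choose_spec.unique h

namespace IsDefiningFunctionOn

variable {U : Set (EuclideanSpace ℝ (Fin n))} {ρ : EuclideanSpace ℝ (Fin n) → ℝ}

theorem isOutwardUnitNormal (h : IsDefiningFunctionOn Ω U ρ) (hΩ : IsOpen Ω)
    {x : EuclideanSpace ℝ (Fin n)} (hx : x ∈ U) (hxf : x ∈ frontier Ω) :
    IsOutwardUnitNormal Ω x (unitGradient ρ x) := by
  refine ⟨h.norm_unitGradient hx, fun ε hε => ?_⟩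
  have hg0 : 0 < ‖gradient ρ x‖ := norm_pos_iff.2 (h.gradient_ne_zero x hx)
  filter_upwards [(h.hasStrictFDerivAt hx).hasFDerivAt.isLittleO.def (mul_pos hε hg0),
    h.isOpen.mem_nhds hx] with y hy hyU
  rw [(h.mem_frontier_iff hΩ hx).1 hxf, sub_zero, innerSL_apply_apply, Real.norm_eq_abs,
    abs_le] at hy
  rw [h.mem_iff y hyU, unitGradient, inner_smul_right, real_inner_comm, inv_mul_eq_div, div_lt_iff₀ hg0,
    lt_div_iff₀ hg0]
  constructor <;> intro h1
  · linarith
  · linarith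

theorem outwardNormal_eq (h : IsDefiningFunctionOn Ω U ρ) (hΩ : IsOpen Ω)
    {x : EuclideanSpace ℝ (Fin n)} (hx : x ∈ U) (hxf : x ∈ frontier Ω) :
    outwardNormal Ω x = unitGradient ρ x :=
  (h.isOutwardUnitNormal hΩ hx hxf).outwardNormal_eq

end IsDefiningFunctionOn

namespace HasSmoothBoundary

theorem isOutwardUnitNormal_outwardNormal (h : HasSmoothBoundary Ω) (hΩ : IsOpen Ω)
    {x : EuclideanSpace ℝ (Fin n)} (hx : x ∈ frontier Ω) :
    IsOutwardUnitNormal Ω x (outwardNormal Ω x) := by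
  obtain ⟨U, ρ, hxU, hU⟩ := h.exists_isDefiningFunctionOn hx
  rw [hU.outwardNormal_eq hΩ hxU hx]
  exact hU.isOutwardUnitNormal hΩ hxU hx

theorem norm_outwardNormal (h : HasSmoothBoundary Ω) (hΩ : IsOpen Ω)
    {x : EuclideanSpace ℝ (Fin n)} (hx : x ∈ frontier Ω) : ‖outwardNormal Ω x‖ = 1 :=
  (h.isOutwardUnitNormal_outwardNormal hΩ hx).1

theorem continuousOn_outwardNormal (h : HasSmoothBoundary Ω) (hΩ : IsOpen Ω) :
    ContinuousOn (outwardNormal Ω) (frontier Ω) := by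
  intro x hx
  obtain ⟨U, ρ, hxU, hU⟩ := h.exists_isDefiningFunctionOn hx
  have h1 : ContinuousWithinAt (unitGradient ρ) (frontier Ω) x :=
    (hU.continuousOn_unitGradient.continuousAt (hU.isOpen.mem_nhds hxU)).continuousWithinAt
  refine h1.congr_of_eventuallyEq ?_ (hU.outwardNormal_eq hΩ hxU hx)
  filter_upwards [self_mem_nhdsWithin, mem_nhdsWithin_of_mem_nhds (hU.isOpen.mem_nhds hxU)]
    with y hy hyU
  exact hU.outwardNormal_eq hΩ hyU hy

theorem isStrictlyTangentAt (h : HasSmoothBoundary Ω) (hΩ : IsOpen Ω)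
    {x : EuclideanSpace ℝ (Fin n)} (hx : x ∈ frontier Ω) :
    IsStrictlyTangentAt (frontier Ω) x (outwardNormal Ω x) := by
  obtain ⟨U, ρ, hxU, hU⟩ := h.exists_isDefiningFunctionOn hx
  rw [hU.outwardNormal_eq hΩ hxU hx]
  exact hU.isStrictlyTangentAt hΩ hxU

theorem mem_posTangentConeAt (h : HasSmoothBoundary Ω) (hΩ : IsOpen Ω)
    {x : EuclideanSpace ℝ (Fin n)} (hx : x ∈ frontier Ω) {τ : EuclideanSpace ℝ (Fin n)}
    (hτ : ⟪outwardNormal Ω x, τ⟫ = 0) : τ ∈ posTangentConeAt (frontier Ω) x := by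
  obtain ⟨U, ρ, hxU, hU⟩ := h.exists_isDefiningFunctionOn hx
  rw [hU.outwardNormal_eq hΩ hxU hx] at hτ
  exact hU.mem_posTangentConeAt hΩ hxU hx hτ

theorem mem_tangentConeAt (h : HasSmoothBoundary Ω) (hΩ : IsOpen Ω)
    {x : EuclideanSpace ℝ (Fin n)} (hx : x ∈ frontier Ω) {τ : EuclideanSpace ℝ (Fin n)}
    (hτ : ⟪outwardNormal Ω x, τ⟫ = 0) : τ ∈ tangentConeAt ℝ (frontier Ω) x :=
  tangentConeAt_mono_field (h.mem_posTangentConeAt hΩ hx hτ)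

theorem measure_frontier_lt_top (h : HasSmoothBoundary Ω) (hΩ : IsOpen Ω)
    (hb : Bornology.IsBounded Ω) :
    (μHE[n - 1] : Measure (EuclideanSpace ℝ (Fin n))) (frontier Ω) < ⊤ := by
  have hc : IsCompact (frontier Ω) :=
    Metric.isCompact_of_isClosed_isBounded isClosed_frontier
      (hb.closure.subset frontier_subset_closure)
  have hloc : ∀ x ∈ frontier Ω, ∃ W ∈ 𝓝[frontier Ω] x,
      (μHE[n - 1] : Measure (EuclideanSpace ℝ (Fin n))) W < ⊤ := by
    intro x hx
    obtain ⟨U, ρ, hxU, hU⟩ := h.exists_isDefiningFunctionOn hx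
    obtain ⟨W, hW, hlt⟩ := hU.exists_nhds_measure_frontier_lt_top hΩ hxU
    rw [finrank_euclideanSpace_fin] at hlt
    exact ⟨frontier Ω ∩ W, inter_mem self_mem_nhdsWithin (mem_nhdsWithin_of_mem_nhds hW), hlt⟩
  exact hc.measure_lt_top_of_nhdsWithin hloc

end HasSmoothBoundary

end SmoothBoundary

/-! ### The divergence theorem on a half-space. -/

section HalfSpace

variable {V : Type*} [NormedAddCommGroup V] [InnerProductSpace ℝ V] [FiniteDimensional ℝ V]
  [MeasurableSpace V] [BorelSpace V]

/-- Coordinates `(s, τ) ↦ s e + τ` adapted to a hyperplane preserve the volume. -/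
theorem exists_measurePreserving_smul_add_orthogonal {e : V} (he : ‖e‖ = 1) :
    ∃ L : ℝ × (ℝ ∙ e)ᗮ ≃ᵐ V, MeasurePreserving L ∧ ∀ p, L p = p.1 • e + p.2 := by
  let a : ℝ ≃ₗᵢ[ℝ] (ℝ ∙ e) := LinearIsometryEquiv.toSpanUnitSingleton e he
  have h1 : MeasurePreserving (Prod.map a (id : (ℝ ∙ e)ᗮ → _)) (volume : Measure (ℝ × (ℝ ∙ e)ᗮ))
      volume := a.measurePreserving.prod (MeasurePreserving.id volume)
  have h2 := ((ℝ ∙ e).measurePreserving_measurableEquivProd (0 : V)).symm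
  rw [InnerProductSpace.euclideanHausdorffMeasure_eq_volume] at h2
  refine ⟨(MeasurableEquiv.prodCongr a.toHomeomorph.toMeasurableEquiv (MeasurableEquiv.refl _)).trans
    ((ℝ ∙ e).measurableEquivProd (0 : V)).symm, h2.comp h1, fun p => ?_⟩
  rw [MeasurableEquiv.trans_apply, Submodule.measurableEquivProd_symm_apply, vadd_eq_add, add_zero]
  rfl

/-- Fubini in coordinates adapted to `e`, with the fundamental theorem of calculus on each half-line
parallel to `e`. -/
theorem setIntegral_halfspace_fderiv {ψ : V → ℝ} (hψ : ContDiff ℝ 1 ψ) (hc : HasCompactSupport ψ)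
    {e : V} (he : ‖e‖ = 1) :
    ∫ y in {y : V | ⟪e, y⟫ < 0}, fderiv ℝ ψ y e =
      ∫ y in ((ℝ ∙ e)ᗮ : Set V), ψ y ∂μHE[Module.finrank ℝ V - 1] := by
  have he0 : e ≠ 0 := by rintro rfl; simp at he
  obtain ⟨L, hL, hLp⟩ := exists_measurePreserving_smul_add_orthogonal he
  have horth : ∀ τ : (ℝ ∙ e)ᗮ, ⟪e, (τ : V)⟫ = 0 := fun τ =>
    Submodule.mem_orthogonal_singleton_iff_inner_right.1 τ.2
  have hpre : L ⁻¹' {y : V | ⟪e, y⟫ < 0} = Iio 0 ×ˢ univ := by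
    ext p
    simp [hLp, inner_add_right, inner_smul_right, horth, he]
  have hint : Integrable fun y => fderiv ℝ ψ y e :=
    ((hψ.continuous_fderiv one_ne_zero).clm_apply continuous_const).integrable_of_hasCompactSupport
      (hc.fderiv_apply (𝕜 := ℝ) e)
  rw [← hL.setIntegral_preimage_emb L.measurableEmbedding, hpre, Measure.volume_eq_prod,
    ← setIntegral_prod_swap, setIntegral_prod]
  · have hline : ∀ τ : (ℝ ∙ e)ᗮ, ∫ s in Iio (0 : ℝ), fderiv ℝ ψ (L (s, τ)) e = ψ τ := by
      intro τ
      have hd : ∀ s : ℝ, HasDerivAt (fun s : ℝ => ψ (L (s, τ))) (fderiv ℝ ψ (L (s, τ)) e) s := by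
        intro s
        have h1 : HasDerivAt (fun s : ℝ => L (s, τ)) e s := by
          simp only [hLp]
          simpa using ((hasDerivAt_id s).smul_const e).add_const (τ : V)
        exact (hψ.differentiable one_ne_zero _).hasFDerivAt.comp_hasDerivAt s h1
      have hcd : ContDiff ℝ 1 fun s : ℝ => ψ (L (s, τ)) := by
        simp only [hLp]
        fun_prop
      have hcc : HasCompactSupport fun s : ℝ => ψ (L (s, τ)) := by
        refine hc.comp_isClosedEmbedding (g := fun s : ℝ => L (s, τ)) ?_
        simp only [hLp]
        have : Isometry fun s : ℝ => s • e + (τ : V) := Isometry.of_dist_eq fun s t => by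
          rw [dist_add_right, dist_eq_norm, ← sub_smul, norm_smul, he, mul_one, dist_eq_norm]
        exact this.isClosedEmbedding
      have := hcc.integral_Iic_deriv_eq hcd 0
      rw [integral_Iic_eq_integral_Iio] at this
      simp only [(hd _).deriv] at this
      rw [this, hLp]
      simp
    simp only [Prod.swap_prod_mk, hline, Measure.restrict_univ]
    have hT : μHE[Module.finrank ℝ V - 1].map (Subtype.val : (ℝ ∙ e)ᗮ → V) =
        μHE[Module.finrank ℝ V - 1].restrict ((ℝ ∙ e)ᗮ : Set V) := by
      rw [isometry_subtype_coe.map_euclideanHausdorffMeasure, Subtype.range_coe]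
    rw [← hT, (MeasurableEmbedding.subtype_coe
      (Submodule.closed_of_finiteDimensional _).measurableSet).integral_map,
      ← finrank_orthogonal_singleton he0, InnerProductSpace.euclideanHausdorffMeasure_eq_volume]
    rfl
  · have h3 := (hL.integrable_comp_emb L.measurableEmbedding).2 hint
    exact h3.swap.integrableOn

end HalfSpace

/-! ### The divergence theorem in a straightening chart. -/

namespace IsDefiningFunctionOn

variable {V : Type*} [NormedAddCommGroup V] [InnerProductSpace ℝ V] [FiniteDimensional ℝ V]
  {Ω U : Set V} {ρ : V → ℝ}

/-- A local homeomorphism which straightens the boundary. -/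
theorem exists_straightening_chart (h : IsDefiningFunctionOn Ω U ρ) {e : V} (he : ‖e‖ = 1) {x : V}
    (hx : x ∈ U) (hpos : 0 < ⟪gradient ρ x, e⟫) :
    ∃ G : OpenPartialHomeomorph V V, x ∈ G.source ∧ G.source ⊆ U ∧
      (∀ y, G y = straightening e ρ y) ∧ ∀ y ∈ G.source, 0 < ⟪gradient ρ y, e⟫ := by
  have hs : HasStrictFDerivAt (straightening e ρ) (straighteningEquiv he hpos.ne' : V →L[ℝ] V) x :=
    h.hasStrictFDerivAt_straightening e hx
  have hop : IsOpen (U ∩ (fun y => ⟪gradient ρ y, e⟫) ⁻¹' Ioi 0) :=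
    (h.continuousOn_gradient.inner continuousOn_const).isOpen_inter_preimage h.isOpen isOpen_Ioi
  refine ⟨(hs.toOpenPartialHomeomorph _).restrOpen _ hop, ?_, ?_, fun y => rfl, ?_⟩
  · rw [OpenPartialHomeomorph.restrOpen_source]
    exact ⟨hs.mem_toOpenPartialHomeomorph_source, hx, hpos⟩
  · rw [OpenPartialHomeomorph.restrOpen_source]
    exact fun y hy => hy.2.1
  · rw [OpenPartialHomeomorph.restrOpen_source]
    exact fun y hy => hy.2.2

-- The transported function vanishes off the compact image of the support, which lies in the open
-- target, so extension by zero creates no singularity at the edge of the target.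
omit [FiniteDimensional ℝ V] in
theorem _root_.OpenPartialHomeomorph.contDiff_indicator_comp_symm {G : OpenPartialHomeomorph V V}
    (hG : ∀ y ∈ G.target, ContDiffAt ℝ 1 G.symm y) {f : V → ℝ} (hf : ContDiff ℝ 1 f)
    (hfc : HasCompactSupport f) (hfs : tsupport f ⊆ G.source) :
    ContDiff ℝ 1 (G.target.indicator (f ∘ G.symm)) ∧
      HasCompactSupport (G.target.indicator (f ∘ G.symm)) ∧
      tsupport (G.target.indicator (f ∘ G.symm)) ⊆ G.target := by
  have hK : IsCompact (G '' tsupport f) := hfc.isCompact.image_of_continuousOn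
    (G.continuousOn.mono hfs)
  have hzero : ∀ y ∉ G '' tsupport f, G.target.indicator (f ∘ G.symm) y = 0 := by
    intro y hy
    by_cases hyt : y ∈ G.target
    · rw [indicator_of_mem hyt]
      exact image_eq_zero_of_notMem_tsupport (f := f) fun hmem => hy ⟨_, hmem, G.right_inv hyt⟩
    · exact indicator_of_notMem hyt _
  refine ⟨contDiff_iff_contDiffAt.2 fun y => ?_, HasCompactSupport.intro hK hzero,
    (closure_minimal (Function.support_subset_iff'.2 hzero) hK.isClosed).trans ?_⟩
  · by_cases hyt : y ∈ G.target
    · refine ((hf.contDiffAt).comp y (hG y hyt)).congr_of_eventuallyEq ?_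
      filter_upwards [G.open_target.mem_nhds hyt] with z hz
      exact indicator_of_mem hz _
    · have hyK : y ∉ G '' tsupport f := by
        rintro ⟨z, hz, rfl⟩
        exact hyt (G.map_source (hfs hz))
      refine (contDiffAt_const (c := (0 : ℝ))).congr_of_eventuallyEq ?_
      filter_upwards [hK.isClosed.isOpen_compl.mem_nhds hyK] with z hz
      exact hzero z hz
  · rintro _ ⟨z, hz, rfl⟩
    exact G.map_source (hfs hz)

variable [MeasurableSpace V] [BorelSpace V]

/-- The divergence theorem for functions supported in the domain of a straightening chart and
derivatives in a transversal direction. -/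
theorem exists_nhds_setIntegral_fderiv_eq (h : IsDefiningFunctionOn Ω U ρ) (hΩ : IsOpen Ω) {e : V}
    (he : ‖e‖ = 1) {x : V} (hx : x ∈ U) (hpos : 0 < ⟪gradient ρ x, e⟫) :
    ∃ W, IsOpen W ∧ x ∈ W ∧ W ⊆ U ∧ ∀ f : V → ℝ, ContDiff ℝ 1 f → HasCompactSupport f →
      tsupport f ⊆ W → ∫ y in Ω, fderiv ℝ f y e =
        ∫ y in frontier Ω, ⟪unitGradient ρ y, e⟫ * f y ∂μHE[Module.finrank ℝ V - 1] := by
  obtain ⟨G, hxG, hGU, hGe, hGpos⟩ := h.exists_straightening_chart he hx hpos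
  refine ⟨G.source, G.open_source, hxG, hGU, fun f hf hfc hfs => ?_⟩
  have hGe' : (G : V → V) = straightening e ρ := funext hGe
  have hder : ∀ y ∈ G.source, HasStrictFDerivAt G (straighteningDeriv e (gradient ρ y)) y :=
    fun y hy => by rw [hGe']; exact h.hasStrictFDerivAt_straightening e (hGU hy)
  have hsymm : ∀ y ∈ G.target, ContDiffAt ℝ 1 G.symm y := by
    intro y hy
    have hy' := G.map_target hy
    refine G.contDiffAt_symm (f₀' := straighteningEquiv he (hGpos _ hy').ne') hy
      (hder _ hy').hasFDerivAt ?_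
    rw [hGe']
    exact h.contDiffAt_straightening e (hGU hy')
  obtain ⟨hψ, hψc, hψs⟩ := OpenPartialHomeomorph.contDiff_indicator_comp_symm hsymm hf hfc hfs
  set ψ := G.target.indicator (f ∘ G.symm)
  have hψG : ∀ y ∈ G.source, ψ (G y) = f y := fun y hy => by
    rw [show ψ (G y) = (f ∘ G.symm) (G y) from indicator_of_mem (G.map_source hy) _, Function.comp_apply, G.left_inv hy]
  -- The differential of the chart multiplies `e` by ⟨∇ρ, e⟩, which is also its determinant. The
  -- chain rule therefore produces exactly the Jacobian required by the change of variables.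
  have hdf : ∀ y ∈ G.source, fderiv ℝ f y e = |(straighteningDeriv e (gradient ρ y)).det| •
      fderiv ℝ ψ (G y) e := by
    intro y hy
    have h1 : HasFDerivAt f ((fderiv ℝ ψ (G y)).comp (straighteningDeriv e (gradient ρ y))) y := by
      refine ((hψ.differentiable one_ne_zero _).hasFDerivAt.comp y
        (hder y hy).hasFDerivAt).congr_of_eventuallyEq ?_
      filter_upwards [G.open_source.mem_nhds hy] with z hz
      exact (hψG z hz).symm
    rw [h1.fderiv, ContinuousLinearMap.comp_apply, straighteningDeriv_apply,
      det_straighteningDeriv he, abs_of_pos (hGpos y hy), real_inner_self_eq_norm_sq, he]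
    have : e + (⟪gradient ρ y, e⟫ - 1 ^ 2) • e = ⟪gradient ρ y, e⟫ • e := by
      rw [sub_smul]; simp
    rw [this, map_smul]
  have hzero : ∀ y ∉ G.source, f y = 0 := fun y hy =>
    image_eq_zero_of_notMem_tsupport fun hy' => hy (hfs hy')
  have hdzero : ∀ y ∉ G.source, fderiv ℝ f y = 0 := fun y hy =>
    image_eq_zero_of_notMem_tsupport fun hy' => hy (hfs (tsupport_fderiv_subset ℝ hy'))
  have himg1 : G '' (Ω ∩ G.source) = {y | ⟪e, y⟫ < 0} ∩ G.target := by
    ext y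
    constructor
    · rintro ⟨z, hz, rfl⟩
      refine ⟨?_, G.map_source hz.2⟩
      rw [mem_ofPred_eq, hGe, inner_straightening he]
      exact (h.mem_iff z (hGU hz.2)).1 hz.1
    · rintro ⟨hy, hyt⟩
      have hy' := G.map_target hyt
      refine ⟨G.symm y, ⟨(h.mem_iff _ (hGU hy')).2 ?_, hy'⟩, G.right_inv hyt⟩
      rwa [← inner_straightening he ρ, ← hGe, G.right_inv hyt]
  have himg2 : G '' (frontier Ω ∩ G.source) = ((ℝ ∙ e)ᗮ : Set V) ∩ G.target := by
    ext y
    constructor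
    · rintro ⟨z, hz, rfl⟩
      refine ⟨?_, G.map_source hz.2⟩
      rw [SetLike.mem_coe, Submodule.mem_orthogonal_singleton_iff_inner_right, hGe,
        inner_straightening he]
      exact (h.mem_frontier_iff hΩ (hGU hz.2)).1 hz.1
    · rintro ⟨hy, hyt⟩
      have hy' := G.map_target hyt
      rw [SetLike.mem_coe, Submodule.mem_orthogonal_singleton_iff_inner_right] at hy
      refine ⟨G.symm y, ⟨(h.mem_frontier_iff hΩ (hGU hy')).2 ?_, hy'⟩, G.right_inv hyt⟩
      rwa [← inner_straightening he ρ, ← hGe, G.right_inv hyt]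
  have hψzero : ∀ y ∉ G.target, ψ y = 0 := fun y hy => indicator_of_notMem hy _
  have hψdzero : ∀ y ∉ G.target, fderiv ℝ ψ y = 0 := fun y hy =>
    image_eq_zero_of_notMem_tsupport fun hy' => hy (hψs (tsupport_fderiv_subset ℝ hy'))
  have hhalf : MeasurableSet {y : V | ⟪e, y⟫ < 0} :=
    (isOpen_lt (continuous_const.inner continuous_id) continuous_const).measurableSet
  have hTm : MeasurableSet ((ℝ ∙ e)ᗮ : Set V) :=
    (Submodule.closed_of_finiteDimensional _).measurableSet
  have hfm : MeasurableSet (frontier Ω) := isClosed_frontier.measurableSet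
  have hSm : MeasurableSet (frontier Ω ∩ G.source) := hfm.inter G.open_source.measurableSet
  calc ∫ y in Ω, fderiv ℝ f y e
      = ∫ y in Ω ∩ G.source, fderiv ℝ f y e := by
        refine setIntegral_eq_of_subset_of_forall_sdiff_eq_zero hΩ.measurableSet inter_subset_left
          fun y hy => ?_
        rw [hdzero y fun hy' => hy.2 ⟨hy.1, hy'⟩]
        rfl
    _ = ∫ y in Ω ∩ G.source, |(straighteningDeriv e (gradient ρ y)).det| • fderiv ℝ ψ (G y) e :=
        setIntegral_congr_fun (hΩ.measurableSet.inter G.open_source.measurableSet)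
          fun y hy => hdf y hy.2
    _ = ∫ y in G '' (Ω ∩ G.source), fderiv ℝ ψ y e := by
        rw [integral_image_eq_integral_abs_det_fderiv_smul volume
          (hΩ.measurableSet.inter G.open_source.measurableSet)
          (fun y hy => (hder y hy.2).hasFDerivAt.hasFDerivWithinAt)
          (G.injOn.mono inter_subset_right)]
    _ = ∫ y in {y | ⟪e, y⟫ < 0}, fderiv ℝ ψ y e := by
        rw [himg1]
        refine (setIntegral_eq_of_subset_of_forall_sdiff_eq_zero hhalf inter_subset_left
          fun y hy => ?_).symm
        rw [hψdzero y fun hy' => hy.2 ⟨hy.1, hy'⟩]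
        rfl
    _ = ∫ y in ((ℝ ∙ e)ᗮ : Set V), ψ y ∂μHE[Module.finrank ℝ V - 1] :=
        setIntegral_halfspace_fderiv hψ hψc he
    _ = ∫ y in G '' (frontier Ω ∩ G.source), ψ y ∂μHE[Module.finrank ℝ V - 1] := by
        rw [himg2]
        exact setIntegral_eq_of_subset_of_forall_sdiff_eq_zero hTm inter_subset_left
          fun y hy => hψzero y fun hy' => hy.2 ⟨hy.1, hy'⟩
    _ = ∫ y in frontier Ω ∩ G.source, ⟪unitGradient ρ y, e⟫ * f y
          ∂μHE[Module.finrank ℝ V - 1] := by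
        -- The inverse transpose of the differential sends the unit normal to `e / ‖∇ρ‖`, so the
        -- boundary Jacobian ⟨∇ρ, e⟩ / ‖∇ρ‖ is the factor ⟨ν, e⟩ of the Gauss-Green formula.
        have hJ : ∀ y ∈ G.source, surfaceJacobian (straighteningDeriv e (gradient ρ y))
            (‖gradient ρ y‖⁻¹ • e) = ⟪unitGradient ρ y, e⟫ := by
          intro y hy
          rw [surfaceJacobian, det_straighteningDeriv he, abs_of_pos (hGpos y hy), norm_smul, he,
            norm_inv, norm_norm, unitGradient, inner_smul_left, RCLike.conj_to_real]
          ring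
        rw [setIntegral_image_euclideanHausdorffMeasure (ν := unitGradient ρ)
          (w := fun y => ‖gradient ρ y‖⁻¹ • e) hSm
          (fun y hy => h.norm_unitGradient (hGU hy.2))
          (fun y hy => (h.isStrictlyTangentAt hΩ (hGU hy.2)).mono
            (inf_le_inf_left _ (principal_mono.2 (prod_mono inter_subset_left inter_subset_left))))
          (fun y hy => hder y hy.2)
          (fun y hy => straighteningDeriv_injective he (hGpos y hy.2).ne') ?_ ?_
          (G.injOn.mono inter_subset_right)]
        · exact setIntegral_congr_fun hSm fun y hy => by
            simp only [hJ y hy.2, hψG y hy.2]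
        · intro y hy v
          rw [inner_smul_left, inner_straighteningDeriv he, unitGradient, inner_smul_left]
        · refine ContinuousOn.congr ?_ fun y hy => hJ y hy.2
          exact (h.continuousOn_unitGradient.mono fun y hy => hGU hy.2).inner continuousOn_const
    _ = ∫ y in frontier Ω, ⟪unitGradient ρ y, e⟫ * f y ∂μHE[Module.finrank ℝ V - 1] := by
        refine (setIntegral_eq_of_subset_of_forall_sdiff_eq_zero hfm inter_subset_left
          fun y hy => ?_).symm
        rw [hzero y fun hy' => hy.2 ⟨hy.1, hy'⟩, mul_zero]

end IsDefiningFunctionOn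

theorem IsCompact.integrableOn_of_continuousOn_of_measure_lt_top {X : Type*} [TopologicalSpace X]
    [T2Space X] [TopologicalSpace.PseudoMetrizableSpace X] [MeasurableSpace X]
    [OpensMeasurableSpace X] {μ : Measure X} {K : Set X} (hK : IsCompact K) (hμ : μ K < ⊤)
    {f : X → ℝ} (hf : ContinuousOn f K) : IntegrableOn f K μ := by
  obtain ⟨C, hC⟩ := hK.exists_bound_of_continuousOn hf
  exact ⟨hf.aestronglyMeasurable_of_isCompact hK hK.isClosed.measurableSet,
    .restrict_of_bounded (C := C) hμ
      ((ae_restrict_mem hK.isClosed.measurableSet).mono fun x hx => hC x hx)⟩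

/-! ### The global divergence theorem. -/

section DivergenceTheorem

variable {n : ℕ} {Ω : Set (EuclideanSpace ℝ (Fin n))}

theorem isCompact_frontier_of_isBounded (hb : Bornology.IsBounded Ω) : IsCompact (frontier Ω) :=
  Metric.isCompact_of_isClosed_isBounded isClosed_frontier
    (hb.closure.subset frontier_subset_closure)

theorem HasSmoothBoundary.integrableOn_frontier (h : HasSmoothBoundary Ω) (hΩ : IsOpen Ω)
    (hb : Bornology.IsBounded Ω) {f : EuclideanSpace ℝ (Fin n) → ℝ}
    (hf : ContinuousOn f (frontier Ω)) : IntegrableOn f (frontier Ω) μHE[n - 1] :=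
  (isCompact_frontier_of_isBounded hb).integrableOn_of_continuousOn_of_measure_lt_top
    (h.measure_frontier_lt_top hΩ hb) hf

theorem integral_fderiv_eq_zero_of_hasCompactSupport {f : EuclideanSpace ℝ (Fin n) → ℝ}
    (hf : ContDiff ℝ 1 f) (hc : HasCompactSupport f) (e : EuclideanSpace ℝ (Fin n)) :
    ∫ y, fderiv ℝ f y e = 0 := by
  have hint : Integrable fun y => fderiv ℝ f y e :=
    ((hf.continuous_fderiv one_ne_zero).clm_apply continuous_const).integrable_of_hasCompactSupport
      (hc.fderiv_apply (𝕜 := ℝ) e)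
  have := integral_mul_fderiv_eq_neg_fderiv_mul_of_integrable (μ := volume)
    (f := fun _ : EuclideanSpace ℝ (Fin n) => (1 : ℝ)) (g := f) (v := e) (by simp)
    (by simpa using hint) (by simpa using hf.continuous.integrable_of_hasCompactSupport hc)
    (fun _ _ => differentiableAt_const _) (fun _ _ => hf.differentiable one_ne_zero _)
  simpa using this

theorem integrable_fderiv_of_hasCompactSupport {f : EuclideanSpace ℝ (Fin n) → ℝ}
    (hf : ContDiff ℝ 1 f) (hc : HasCompactSupport f) (e : EuclideanSpace ℝ (Fin n)) :
    Integrable fun y => fderiv ℝ f y e :=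
  ((hf.continuous_fderiv one_ne_zero).clm_apply continuous_const).integrable_of_hasCompactSupport
    (hc.fderiv_apply (𝕜 := ℝ) e)

namespace HasSmoothBoundary

theorem integrableOn_inner_outwardNormal_mul (h : HasSmoothBoundary Ω) (hΩ : IsOpen Ω)
    (hb : Bornology.IsBounded Ω) {f : EuclideanSpace ℝ (Fin n) → ℝ} (hf : Continuous f)
    (e : EuclideanSpace ℝ (Fin n)) :
    IntegrableOn (fun y => ⟪outwardNormal Ω y, e⟫ * f y) (frontier Ω) μHE[n - 1] :=
  h.integrableOn_frontier hΩ hb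
    (((h.continuousOn_outwardNormal hΩ).inner continuousOn_const).mul hf.continuousOn)

/-- The chart argument needs a direction with positive component along the normal at `x`. Both sides
are linear in `e`, and every `e` is a combination of two such directions. -/
theorem exists_nhds_frontier_setIntegral_fderiv_eq (h : HasSmoothBoundary Ω) (hΩ : IsOpen Ω)
    (hb : Bornology.IsBounded Ω) {x : EuclideanSpace ℝ (Fin n)} (hx : x ∈ frontier Ω)
    (e : EuclideanSpace ℝ (Fin n)) :
    ∃ W, IsOpen W ∧ x ∈ W ∧ ∀ f : EuclideanSpace ℝ (Fin n) → ℝ, ContDiff ℝ 1 f →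
      HasCompactSupport f → tsupport f ⊆ W → ∫ y in Ω, fderiv ℝ f y e =
        ∫ y in frontier Ω, ⟪outwardNormal Ω y, e⟫ * f y ∂μHE[n - 1] := by
  obtain ⟨U, ρ, hxU, hU⟩ := h.exists_isDefiningFunctionOn hx
  have key : ∀ u : EuclideanSpace ℝ (Fin n), ‖u‖ = 1 → 0 < ⟪gradient ρ x, u⟫ →
      ∃ W, IsOpen W ∧ x ∈ W ∧ ∀ f : EuclideanSpace ℝ (Fin n) → ℝ, ContDiff ℝ 1 f →
        HasCompactSupport f → tsupport f ⊆ W → ∫ y in Ω, fderiv ℝ f y u =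
          ∫ y in frontier Ω, ⟪outwardNormal Ω y, u⟫ * f y ∂μHE[n - 1] := by
    intro u hu hpos
    obtain ⟨W, hWo, hxW, hWU, hW⟩ := hU.exists_nhds_setIntegral_fderiv_eq hΩ hu hxU hpos
    refine ⟨W, hWo, hxW, fun f hf hc hs => ?_⟩
    rw [hW f hf hc hs, finrank_euclideanSpace_fin]
    refine setIntegral_congr_fun isClosed_frontier.measurableSet fun y hy => ?_
    by_cases hyW : y ∈ W
    · simp only [hU.outwardNormal_eq hΩ (hWU hyW) hy]
    · simp only [image_eq_zero_of_notMem_tsupport fun hy' => hyW (hs hy'), mul_zero]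
  set ν := unitGradient ρ x with hνdef
  have hν : ‖ν‖ = 1 := hU.norm_unitGradient hxU
  have hg0 : 0 < ‖gradient ρ x‖ := norm_pos_iff.2 (hU.gradient_ne_zero x hxU)
  have hgν : gradient ρ x = ‖gradient ρ x‖ • ν := by
    rw [hνdef, unitGradient, smul_smul, mul_inv_cancel₀ hg0.ne', one_smul]
  have hpos1 : 0 < ⟪gradient ρ x, ν⟫ := by
    rw [hgν, inner_smul_left, real_inner_self_eq_norm_sq, hν]
    simpa using hg0
  -- As |⟨ν, e⟩| ≤ ‖e‖, this choice gives ⟨ν, e + cν⟩ ≥ 1.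
  set c := ‖e‖ + 1
  set u := e + c • ν
  have hνu : 0 < ⟪ν, u⟫ := by
    rw [inner_add_right, inner_smul_right, real_inner_self_eq_norm_sq, hν]
    have := (abs_le.1 (abs_real_inner_le_norm ν e)).1
    rw [hν] at this
    simp only [c]
    linarith
  have hu0 : 0 < ‖u‖ := norm_pos_iff.2 (by rintro h0; rw [h0, inner_zero_right] at hνu; exact hνu.ne rfl)
  have hpos2 : 0 < ⟪gradient ρ x, ‖u‖⁻¹ • u⟫ := by
    rw [hgν, inner_smul_left, inner_smul_right]
    simp only [conj_trivial]
    positivity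
  obtain ⟨W₁, ho₁, hx₁, hW₁⟩ := key ν hν hpos1
  obtain ⟨W₂, ho₂, hx₂, hW₂⟩ := key (‖u‖⁻¹ • u) (by rw [norm_smul, norm_inv, norm_norm,
    inv_mul_cancel₀ hu0.ne']) hpos2
  refine ⟨W₁ ∩ W₂, ho₁.inter ho₂, ⟨hx₁, hx₂⟩, fun f hf hc hs => ?_⟩
  have e1 := hW₁ f hf hc (hs.trans inter_subset_left)
  have e2 := hW₂ f hf hc (hs.trans inter_subset_right)
  have he : e = ‖u‖ • (‖u‖⁻¹ • u) - c • ν := by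
    rw [smul_smul, mul_inv_cancel₀ hu0.ne', one_smul, add_sub_cancel_right]
  have i1 := (integrable_fderiv_of_hasCompactSupport hf hc ν).integrableOn (s := Ω)
  have i2 := (integrable_fderiv_of_hasCompactSupport hf hc (‖u‖⁻¹ • u)).integrableOn (s := Ω)
  have i3 := h.integrableOn_inner_outwardNormal_mul hΩ hb hf.continuous ν
  have i4 := h.integrableOn_inner_outwardNormal_mul hΩ hb hf.continuous (‖u‖⁻¹ • u)
  generalize ‖u‖⁻¹ • u = e' at *
  have l1 : ∫ y in Ω, fderiv ℝ f y e =
      ‖u‖ * (∫ y in Ω, fderiv ℝ f y e') - c * ∫ y in Ω, fderiv ℝ f y ν := by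
    rw [← integral_const_mul, ← integral_const_mul, ← integral_sub (i2.const_mul _)
      (i1.const_mul _)]
    simp only [he, map_sub, map_smul, smul_eq_mul]
  have l2 : ∫ y in frontier Ω, ⟪outwardNormal Ω y, e⟫ * f y ∂μHE[n - 1] =
      ‖u‖ * ∫ y in frontier Ω, ⟪outwardNormal Ω y, e'⟫ * f y ∂μHE[n - 1]
        - c * ∫ y in frontier Ω, ⟪outwardNormal Ω y, ν⟫ * f y ∂μHE[n - 1] := by
    rw [← integral_const_mul, ← integral_const_mul, ← integral_sub (i4.const_mul _)
      (i3.const_mul _)]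
    simp only [he, inner_sub_right, inner_smul_right, sub_mul, mul_assoc]
  rw [l1, l2, e1, e2]

theorem exists_nhds_setIntegral_fderiv_eq (h : HasSmoothBoundary Ω) (hΩ : IsOpen Ω)
    (hb : Bornology.IsBounded Ω) (x e : EuclideanSpace ℝ (Fin n)) :
    ∃ W, IsOpen W ∧ x ∈ W ∧ ∀ f : EuclideanSpace ℝ (Fin n) → ℝ, ContDiff ℝ 1 f →
      HasCompactSupport f → tsupport f ⊆ W → ∫ y in Ω, fderiv ℝ f y e =
        ∫ y in frontier Ω, ⟪outwardNormal Ω y, e⟫ * f y ∂μHE[n - 1] := by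
  by_cases hx : x ∈ frontier Ω
  · exact h.exists_nhds_frontier_setIntegral_fderiv_eq hΩ hb hx e
  have hfr : ∀ {W : Set (EuclideanSpace ℝ (Fin n))} {f : EuclideanSpace ℝ (Fin n) → ℝ},
      Disjoint W (frontier Ω) → tsupport f ⊆ W →
      ∫ y in frontier Ω, ⟪outwardNormal Ω y, e⟫ * f y ∂μHE[n - 1] = 0 := by
    intro W f hW hs
    refine setIntegral_eq_zero_of_forall_eq_zero fun y hy => ?_
    rw [image_eq_zero_of_notMem_tsupport fun hy' => hW.notMem_of_mem_left (hs hy') hy, mul_zero]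
  by_cases hxΩ : x ∈ Ω
  · refine ⟨Ω, hΩ, hxΩ, fun f hf hc hs => ?_⟩
    rw [hfr (disjoint_frontier_iff_isOpen.2 hΩ).symm hs,
      setIntegral_eq_integral_of_forall_compl_eq_zero,
      integral_fderiv_eq_zero_of_hasCompactSupport hf hc]
    intro y hy
    rw [image_eq_zero_of_notMem_tsupport (f := fderiv ℝ f)
      fun hy' => hy (hs (tsupport_fderiv_subset ℝ hy'))]
    rfl
  · have hxc : x ∉ closure Ω := fun hxc => hx ⟨hxc, by rwa [hΩ.interior_eq]⟩
    refine ⟨(closure Ω)ᶜ, isClosed_closure.isOpen_compl, hxc, fun f hf hc hs => ?_⟩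
    rw [hfr (disjoint_compl_left.mono_right frontier_subset_closure) hs]
    refine setIntegral_eq_zero_of_forall_eq_zero fun y hy => ?_
    rw [image_eq_zero_of_notMem_tsupport (f := fderiv ℝ f)
      fun hy' => hs (tsupport_fderiv_subset ℝ hy') (subset_closure hy)]
    rfl

open scoped Manifold in
/-- **Gauss-Green formula** for compactly supported `C¹` functions. -/
theorem setIntegral_fderiv_eq (h : HasSmoothBoundary Ω) (hΩ : IsOpen Ω)
    (hb : Bornology.IsBounded Ω) {f : EuclideanSpace ℝ (Fin n) → ℝ} (hf : ContDiff ℝ 1 f)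
    (hc : HasCompactSupport f) (e : EuclideanSpace ℝ (Fin n)) :
    ∫ y in Ω, fderiv ℝ f y e =
      ∫ y in frontier Ω, ⟪outwardNormal Ω y, e⟫ * f y ∂μHE[n - 1] := by
  choose W hWo hxW hW using fun x => h.exists_nhds_setIntegral_fderiv_eq hΩ hb x e
  obtain ⟨p, hp⟩ := SmoothPartitionOfUnity.exists_isSubordinate
    𝓘(ℝ, EuclideanSpace ℝ (Fin n)) isClosed_univ W hWo fun x _ => mem_iUnion.2 ⟨x, hxW x⟩
  have hfin := p.locallyFinite.finite_nonempty_inter_compact hc.isCompact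
  set t := hfin.toFinset
  have hsum : f = fun y => ∑ i ∈ t, p i y * f y := by
    funext y
    rw [← Finset.sum_mul]
    by_cases hy : y ∈ tsupport f
    · have h1 := p.sum_eq_one (mem_univ y)
      rw [finsum_eq_sum_of_support_subset (s := t)] at h1
      · rw [h1, one_mul]
      · intro i hi
        exact hfin.mem_toFinset.2 ⟨y, hi, hy⟩
    · rw [image_eq_zero_of_notMem_tsupport hy, mul_zero]
  have hpf : ∀ i, ContDiff ℝ 1 fun y => p i y * f y := fun i =>
    (((p i).contMDiff.contDiff).of_le (by exact_mod_cast le_top)).mul hf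
  have hpc : ∀ i, HasCompactSupport fun y => p i y * f y := fun i => hc.mul_left
  have hps : ∀ i, tsupport (fun y => p i y * f y) ⊆ W i := fun i =>
    (tsupport_mul_subset_left (f := p i) (g := f)).trans (hp i)
  have hl : ∀ y, fderiv ℝ f y e = ∑ i ∈ t, fderiv ℝ (fun y => p i y * f y) y e := by
    intro y
    conv_lhs => rw [hsum]
    rw [fderiv_fun_sum fun i _ => (hpf i).differentiable one_ne_zero y,
      sum_apply]
  have hr : ∀ y, ⟪outwardNormal Ω y, e⟫ * f y =
      ∑ i ∈ t, ⟪outwardNormal Ω y, e⟫ * (p i y * f y) := by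
    intro y
    rw [← Finset.mul_sum]
    congr 1
    exact congrFun hsum y
  simp only [hl]
  rw [integral_congr_ae (Eventually.of_forall hr), integral_finsetSum, integral_finsetSum]
  · exact Finset.sum_congr rfl fun i _ => hW i _ (hpf i) (hpc i) (hps i)
  · exact fun i _ => h.integrableOn_inner_outwardNormal_mul hΩ hb (hpf i).continuous e
  · exact fun i _ => (integrable_fderiv_of_hasCompactSupport (hpf i) (hpc i) e).integrableOn

/-- **Divergence theorem** for compactly supported `C¹` vector fields. -/
theorem setIntegral_trace_fderiv_eq (h : HasSmoothBoundary Ω) (hΩ : IsOpen Ω)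
    (hb : Bornology.IsBounded Ω) {X : EuclideanSpace ℝ (Fin n) → EuclideanSpace ℝ (Fin n)}
    (hX : ContDiff ℝ 1 X) (hc : HasCompactSupport X) :
    ∫ y in Ω, LinearMap.trace ℝ _ (fderiv ℝ X y).toLinearMap =
      ∫ y in frontier Ω, ⟪outwardNormal Ω y, X y⟫ ∂μHE[n - 1] := by
  set b := EuclideanSpace.basisFun (Fin n) ℝ
  have hXi : ∀ i, ContDiff ℝ 1 fun y => ⟪b i, X y⟫ := fun i => contDiff_const.inner ℝ hX
  have hci : ∀ i, HasCompactSupport fun y => ⟪b i, X y⟫ := fun i =>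
    hc.comp_left (g := fun v => ⟪b i, v⟫) (inner_zero_right _)
  have hl : ∀ y, LinearMap.trace ℝ _ (fderiv ℝ X y).toLinearMap =
      ∑ i, fderiv ℝ (fun y => ⟪b i, X y⟫) y (b i) := by
    intro y
    rw [LinearMap.trace_eq_sum_inner _ b]
    refine Finset.sum_congr rfl fun i _ => ?_
    have : HasFDerivAt (fun y => ⟪b i, X y⟫) ((innerSL ℝ (b i)).comp (fderiv ℝ X y)) y :=
      (innerSL ℝ (b i)).hasFDerivAt.comp y (hX.differentiable one_ne_zero y).hasFDerivAt
    rw [this.fderiv]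
    rfl
  have hr : ∀ y, ⟪outwardNormal Ω y, X y⟫ =
      ∑ i, ⟪outwardNormal Ω y, b i⟫ * ⟪b i, X y⟫ := fun y =>
    (b.sum_inner_mul_inner _ _).symm
  simp only [hl]
  rw [integral_congr_ae (Eventually.of_forall hr), integral_finsetSum, integral_finsetSum]
  · exact Finset.sum_congr rfl fun i _ => h.setIntegral_fderiv_eq hΩ hb (hXi i) (hci i) (b i)
  · exact fun i _ => h.integrableOn_inner_outwardNormal_mul hΩ hb (hXi i).continuous (b i)
  · exact fun i _ => (integrable_fderiv_of_hasCompactSupport (hXi i) (hci i) (b i)).integrableOn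

/-- The position vector field, cut off outside a ball containing `Ω`, has divergence `n` on `Ω`. A
null boundary would force `n` times the volume to be zero. -/
theorem measure_frontier_pos (h : HasSmoothBoundary Ω) (hn : n ≠ 0) (hΩ : IsOpen Ω)
    (hne : Ω.Nonempty) (hb : Bornology.IsBounded Ω) :
    0 < (μHE[n - 1] : Measure (EuclideanSpace ℝ (Fin n))) (frontier Ω) := by
  refine pos_iff_ne_zero.2 fun h0 => ?_
  obtain ⟨R, hR0, hR⟩ := hb.subset_ball_lt 0 0
  let χ : ContDiffBump (0 : EuclideanSpace ℝ (Fin n)) := ⟨R, R + 1, hR0, by linarith⟩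
  have hX : ContDiff ℝ 1 fun y : EuclideanSpace ℝ (Fin n) => χ y • y :=
    χ.contDiff.smul contDiff_id
  have hc : HasCompactSupport fun y : EuclideanSpace ℝ (Fin n) => χ y • y :=
    χ.hasCompactSupport.smul_right
  have := h.setIntegral_trace_fderiv_eq hΩ hb hX hc
  rw [Measure.restrict_eq_zero.2 h0, integral_zero_measure] at this
  have hd : ∀ y ∈ Ω, LinearMap.trace ℝ (EuclideanSpace ℝ (Fin n))
      (fderiv ℝ (fun y : EuclideanSpace ℝ (Fin n) => χ y • y) y).toLinearMap = n := by
    intro y hy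
    have he : (fun y : EuclideanSpace ℝ (Fin n) => χ y • y) =ᶠ[𝓝 y] id := by
      filter_upwards [Metric.isOpen_ball.mem_nhds (hR hy)] with z hz
      rw [χ.one_of_mem_closedBall (Metric.ball_subset_closedBall hz), one_smul, id]
    rw [he.fderiv_eq, fderiv_id, ContinuousLinearMap.coe_id, LinearMap.trace_id,
      finrank_euclideanSpace_fin]
  rw [setIntegral_congr_fun hΩ.measurableSet hd, setIntegral_const, smul_eq_mul, mul_eq_zero,
    Nat.cast_eq_zero, or_iff_left hn, measureReal_eq_zero_iff hb.measure_lt_top.ne] at this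
  exact (hΩ.measure_pos volume hne).ne' this

end HasSmoothBoundary

end DivergenceTheorem

/-! ### Finsler norms and their polars. -/

namespace IsFinslerNorm

variable {n : ℕ} {p : ℝ} {F : EuclideanSpace ℝ (Fin n) → ℝ}

theorem map_zero (hF : IsFinslerNorm p F) : F 0 = 0 := by
  simpa using hF.homogeneous 0 0

theorem pos (hF : IsFinslerNorm p F) {x : EuclideanSpace ℝ (Fin n)} (hx : x ≠ 0) : 0 < F x := by
  obtain ⟨a, ha, h⟩ := hF.lower_bound
  exact (mul_pos ha (norm_pos_iff.2 hx)).trans_le (h x)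

theorem map_add_le (hF : IsFinslerNorm p F) (x y : EuclideanSpace ℝ (Fin n)) :
    F (x + y) ≤ F x + F y := by
  have h := hF.convexOn.2 (mem_univ x) (mem_univ y) (by norm_num : (0 : ℝ) ≤ 1 / 2)
    (by norm_num : (0 : ℝ) ≤ 1 / 2) (by norm_num)
  rw [← smul_add, hF.homogeneous, abs_of_pos (by norm_num : (0 : ℝ) < 1 / 2), smul_eq_mul,
    smul_eq_mul] at h
  linarith

theorem continuous (hF : IsFinslerNorm p F) : Continuous F :=
  hF.convexOn.locallyLipschitz.continuous

theorem exists_lipschitzWith (hF : IsFinslerNorm p F) : ∃ K, LipschitzWith K F := by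
  obtain ⟨C, hC⟩ := (isCompact_sphere (0 : EuclideanSpace ℝ (Fin n)) 1).exists_bound_of_continuousOn
    hF.continuous.continuousOn
  have hb : ∀ x, F x ≤ max C 0 * ‖x‖ := by
    intro x
    rcases eq_or_ne x 0 with rfl | hx
    · simp [hF.map_zero]
    · have hx0 : 0 < ‖x‖ := norm_pos_iff.2 hx
      have h1 := hC (‖x‖⁻¹ • x) (by simp [norm_smul, hx0.ne'])
      rw [hF.homogeneous, abs_of_pos (inv_pos.2 hx0), Real.norm_eq_abs,
        abs_of_nonneg (mul_nonneg (inv_pos.2 hx0).le (hF.nonneg x)), inv_mul_eq_div,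
        div_le_iff₀ hx0] at h1
      exact h1.trans (by gcongr; exact le_max_left _ _)
  refine ⟨⟨max C 0, le_max_right _ _⟩, LipschitzWith.of_le_add_mul _ fun x y => ?_⟩
  have := hF.map_add_le y (x - y)
  rw [add_sub_cancel] at this
  rw [dist_eq_norm]
  exact this.trans (by gcongr; exact hb _)

theorem contDiffAt (hF : IsFinslerNorm p F) {x : EuclideanSpace ℝ (Fin n)} (hx : x ≠ 0) :
    ContDiffAt ℝ 2 F x :=
  hF.contDiffOn.contDiffAt (isOpen_compl_singleton.mem_nhds hx)

theorem differentiableAt (hF : IsFinslerNorm p F) {x : EuclideanSpace ℝ (Fin n)} (hx : x ≠ 0) :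
    DifferentiableAt ℝ F x :=
  (hF.contDiffAt hx).differentiableAt two_ne_zero

theorem inner_gradient_self (hF : IsFinslerNorm p F) {x : EuclideanSpace ℝ (Fin n)} (hx : x ≠ 0) :
    ⟪gradient F x, x⟫ = F x := by
  rw [inner_gradient_eq_fderiv]
  have h1 : HasDerivAt (fun s : ℝ => F (x + s • x)) (fderiv ℝ F x x) 0 := by
    have hl : HasDerivAt (fun s : ℝ => x + s • x) x 0 := by
      simpa using ((hasDerivAt_id (0 : ℝ)).smul_const x).const_add x
    exact HasFDerivAt.comp_hasDerivAt_of_eq (0 : ℝ) (hF.differentiableAt hx).hasFDerivAt hl (by simp)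
  have h2 : HasDerivAt (fun s : ℝ => F (x + s • x)) (F x) 0 := by
    have h3 : HasDerivAt (fun s : ℝ => (1 + s) * F x) (F x) 0 := by
      simpa using ((hasDerivAt_id (0 : ℝ)).const_add 1).mul_const (F x)
    refine h3.congr_of_eventuallyEq ?_
    filter_upwards [eventually_gt_nhds (show (-1 : ℝ) < 0 by norm_num)] with s hs
    rw [show x + s • x = (1 + s) • x by rw [add_smul, one_smul], hF.homogeneous,
      abs_of_pos (by linarith)]
  exact h1.unique h2

/-- Divide F(x + sξ) − F(x) ≤ sF(ξ) by `s > 0` and let `s` tend to 0. With Euler's identity, this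
says that ∇F(·) paired with a fixed nonzero ξ is largest at ξ. -/
theorem inner_gradient_le (hF : IsFinslerNorm p F) {x : EuclideanSpace ℝ (Fin n)} (hx : x ≠ 0)
    (ξ : EuclideanSpace ℝ (Fin n)) : ⟪gradient F x, ξ⟫ ≤ F ξ := by
  rw [inner_gradient_eq_fderiv]
  have h1 : HasDerivAt (fun s : ℝ => F (x + s • ξ)) (fderiv ℝ F x ξ) 0 := by
    have hl : HasDerivAt (fun s : ℝ => x + s • ξ) ξ 0 := by
      simpa using ((hasDerivAt_id (0 : ℝ)).smul_const ξ).const_add x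
    exact HasFDerivAt.comp_hasDerivAt_of_eq (0 : ℝ) (hF.differentiableAt hx).hasFDerivAt hl (by simp)
  have h2 := (hasDerivAt_iff_tendsto_slope_zero.1 h1).mono_left
    (nhdsWithin_mono (0 : ℝ) (show Ioi (0 : ℝ) ⊆ {0}ᶜ from fun s hs => ne_of_gt hs))
  refine le_of_tendsto h2 ?_
  filter_upwards [self_mem_nhdsWithin] with s hs
  have hs : 0 < s := hs
  have h3 := hF.map_add_le x (s • ξ)
  rw [hF.homogeneous, abs_of_pos hs] at h3
  simp only [zero_add, zero_smul, add_zero, smul_eq_mul]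
  rw [inv_mul_eq_div, div_le_iff₀ hs]
  linarith

/-- The unit sphere of `F` contains no segment. -/
theorem eq_of_midpoint (hF : IsFinslerNorm p F) {ξ w : EuclideanSpace ℝ (Fin n)} (hξ : ξ ≠ 0)
    (h : ∀ᶠ s : ℝ in 𝓝 0, F (ξ + s • w) = 1) : w = 0 := by
  by_contra hw
  -- Along the line `F ^ p` is constant near `ξ`, so its second derivative in the direction `w`
  -- vanishes there, against positivity of the Hessian.
  set G := fun η => F η ^ p
  have hG : ∀ {η}, η ≠ 0 → ContDiffAt ℝ 2 G η := fun hη =>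
    (hF.contDiffAt hη).rpow_const_of_ne (hF.pos hη).ne'
  have hl : ∀ s : ℝ, HasDerivAt (fun s : ℝ => ξ + s • w) w s := fun s => by
    simpa using ((hasDerivAt_id s).smul_const w).const_add ξ
  have hne : ∀ᶠ s : ℝ in 𝓝 0, ξ + s • w ≠ 0 := by
    have := (hl 0).continuousAt
    exact this.eventually_ne (by simpa using hξ)
  have h1 : ∀ᶠ s : ℝ in 𝓝 0, fderiv ℝ G (ξ + s • w) w = 0 := by
    filter_upwards [h.eventually_nhds, hne] with s hs hs0
    have h2 : HasDerivAt (fun s : ℝ => G (ξ + s • w)) (fderiv ℝ G (ξ + s • w) w) s :=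
      HasFDerivAt.comp_hasDerivAt_of_eq s ((hG hs0).differentiableAt two_ne_zero).hasFDerivAt
        (hl s) rfl
    have h3 : HasDerivAt (fun s : ℝ => G (ξ + s • w)) 0 s := by
      refine (hasDerivAt_const s (1 : ℝ)).congr_of_eventuallyEq ?_
      filter_upwards [hs] with r hr
      simp [G, hr]
    exact h2.unique h3
  have h4 : HasDerivAt (fun s : ℝ => fderiv ℝ G (ξ + s • w) w) (fderiv ℝ (fderiv ℝ G) ξ w w) 0 := by
    have hd : DifferentiableAt ℝ (fderiv ℝ G) ξ :=
      ((hG hξ).fderiv_right (m := 1) (by norm_num)).differentiableAt one_ne_zero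
    have := HasFDerivAt.comp_hasDerivAt_of_eq (0 : ℝ) hd.hasFDerivAt (hl 0) (by simp)
    exact ((ContinuousLinearMap.apply ℝ ℝ w).hasFDerivAt.comp_hasDerivAt (0 : ℝ) this)
  have h5 : HasDerivAt (fun s : ℝ => fderiv ℝ G (ξ + s • w) w) 0 0 :=
    (hasDerivAt_const (0 : ℝ) (0 : ℝ)).congr_of_eventuallyEq h1
  exact (hF.hessian_pos ξ hξ w hw).ne' (h4.unique h5)

theorem inner_le_mul_polarNorm (hF : IsFinslerNorm p F) (ξ v : EuclideanSpace ℝ (Fin n)) :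
    ⟪ξ, v⟫ ≤ F ξ * polarNorm F v := by
  rcases eq_or_ne ξ 0 with rfl | hξ
  · simp [hF.map_zero]
  obtain ⟨a, ha, h⟩ := hF.lower_bound
  have hb : BddAbove {r : ℝ | ∃ ξ : EuclideanSpace ℝ (Fin n), ξ ≠ 0 ∧ r = ⟪ξ, v⟫ / F ξ} := by
    refine ⟨‖v‖ / a, ?_⟩
    rintro _ ⟨η, hη, rfl⟩
    rw [div_le_div_iff₀ (hF.pos hη) ha]
    calc ⟪η, v⟫ * a ≤ ‖η‖ * ‖v‖ * a := by gcongr; exact real_inner_le_norm _ _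
      _ = ‖v‖ * (a * ‖η‖) := by ring
      _ ≤ ‖v‖ * F η := by gcongr; exact h η
  have := le_csSup hb ⟨ξ, hξ, rfl⟩
  rw [div_le_iff₀ (hF.pos hξ)] at this
  rw [mul_comm]
  exact this

theorem exists_inner_eq_polarNorm (hF : IsFinslerNorm p F) (hn : n ≠ 0)
    (v : EuclideanSpace ℝ (Fin n)) : ∃ ξ, F ξ = 1 ∧ ⟪ξ, v⟫ = polarNorm F v := by
  obtain ⟨a, ha, h⟩ := hF.lower_bound
  have : Nonempty (Fin n) := Fin.pos_iff_nonempty.1 (Nat.pos_of_ne_zero hn)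
  have hK : IsCompact {ξ | F ξ = 1} := by
    refine Metric.isCompact_of_isClosed_isBounded (isClosed_eq hF.continuous continuous_const) ?_
    refine (Metric.isBounded_closedBall (x := (0 : EuclideanSpace ℝ (Fin n))) (r := 1 / a)).subset
      fun ξ hξ => ?_
    rw [mem_closedBall_zero_iff, le_div_iff₀ ha, mul_comm]
    exact (h ξ).trans_eq hξ
  have hnorm : ∀ η : EuclideanSpace ℝ (Fin n), η ≠ 0 → F ((F η)⁻¹ • η) = 1 := fun η hη => by
    rw [hF.homogeneous, abs_of_pos (inv_pos.2 (hF.pos hη)), inv_mul_cancel₀ (hF.pos hη).ne']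
  obtain ⟨η, hη⟩ := exists_ne (0 : EuclideanSpace ℝ (Fin n))
  obtain ⟨ξ, hξ, hmax⟩ := hK.exists_isMaxOn ⟨_, hnorm η hη⟩
    (f := fun ξ => ⟪ξ, v⟫) (continuous_id.inner continuous_const).continuousOn
  refine ⟨ξ, hξ, le_antisymm ?_ ?_⟩
  · have := hF.inner_le_mul_polarNorm ξ v
    rwa [show F ξ = 1 from hξ, one_mul] at this
  · refine csSup_le ⟨_, η, hη, rfl⟩ ?_
    rintro _ ⟨ζ, hζ, rfl⟩
    have : ⟪(F ζ)⁻¹ • ζ, v⟫ ≤ ⟪ξ, v⟫ := hmax (hnorm ζ hζ)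
    rwa [inner_smul_left, conj_trivial, inv_mul_eq_div] at this

theorem inner_le_polarNorm (hF : IsFinslerNorm p F) {ξ : EuclideanSpace ℝ (Fin n)} (hξ : F ξ = 1)
    (v : EuclideanSpace ℝ (Fin n)) : ⟪ξ, v⟫ ≤ polarNorm F v := by
  have := hF.inner_le_mul_polarNorm ξ v
  rwa [hξ, one_mul] at this

theorem polarNorm_pos (hF : IsFinslerNorm p F) {v : EuclideanSpace ℝ (Fin n)} (hv : v ≠ 0) :
    0 < polarNorm F v := by
  have h := hF.inner_le_mul_polarNorm v v
  rw [real_inner_self_eq_norm_sq] at h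
  exact pos_of_mul_pos_right ((pow_pos (norm_pos_iff.2 hv) 2).trans_le h) (hF.nonneg v)

theorem polarNorm_zero (hF : IsFinslerNorm p F) (hn : n ≠ 0) : polarNorm F 0 = 0 := by
  obtain ⟨ξ, -, h⟩ := hF.exists_inner_eq_polarNorm hn 0
  rw [← h, inner_zero_right]

theorem polarNorm_nonneg (hF : IsFinslerNorm p F) (hn : n ≠ 0) (v : EuclideanSpace ℝ (Fin n)) :
    0 ≤ polarNorm F v := by
  rcases eq_or_ne v 0 with rfl | hv
  · exact (hF.polarNorm_zero hn).ge
  · exact (hF.polarNorm_pos hv).le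

theorem convexOn_polarNorm (hF : IsFinslerNorm p F) (hn : n ≠ 0) :
    ConvexOn ℝ univ (polarNorm F) := by
  refine ⟨convex_univ, fun x _ y _ a b ha hb _ => ?_⟩
  obtain ⟨ξ, hξ, h⟩ := hF.exists_inner_eq_polarNorm hn (a • x + b • y)
  rw [← h, inner_add_right, inner_smul_right, inner_smul_right, smul_eq_mul, smul_eq_mul]
  gcongr <;> exact hF.inner_le_polarNorm hξ _

/-- Convexity yields the local Lipschitz bound on the momentum weight, including across the origin,
that dominates its difference quotients. -/
theorem convexOn_polarNorm_rpow (hF : IsFinslerNorm p F) (hn : n ≠ 0) (hp : 1 < p) :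
    ConvexOn ℝ univ fun v => polarNorm F v ^ p := by
  refine ⟨convex_univ, fun x hx y hy a b ha hb hab => ?_⟩
  refine (Real.rpow_le_rpow (hF.polarNorm_nonneg hn _)
    ((hF.convexOn_polarNorm hn).2 hx hy ha hb hab) (by linarith)).trans ?_
  exact (convexOn_rpow hp.le).2 (hF.polarNorm_nonneg hn x) (hF.polarNorm_nonneg hn y) ha hb hab

theorem polarNorm_le (hF : IsFinslerNorm p F) (hn : n ≠ 0) :
    ∃ C, 0 < C ∧ (∀ ξ, F ξ = 1 → ‖ξ‖ ≤ C) ∧ ∀ v, polarNorm F v ≤ C * ‖v‖ := by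
  obtain ⟨a, ha, h⟩ := hF.lower_bound
  have hC : ∀ ξ, F ξ = 1 → ‖ξ‖ ≤ 1 / a := fun ξ hξ => by
    rw [le_div_iff₀ ha, mul_comm, ← hξ]
    exact h ξ
  refine ⟨1 / a, by positivity, hC, fun v => ?_⟩
  obtain ⟨ξ, hξ, h⟩ := hF.exists_inner_eq_polarNorm hn v
  rw [← h]
  refine (real_inner_le_norm _ _).trans ?_
  gcongr
  exact hC ξ hξ

/-- The maximiser in the definition of the polar norm is unique. -/
theorem eq_of_inner_eq_polarNorm (hF : IsFinslerNorm p F) {v ξ η : EuclideanSpace ℝ (Fin n)}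
    (hv : v ≠ 0) (hξ : F ξ = 1) (hη : F η = 1) (hξv : ⟪ξ, v⟫ = polarNorm F v)
    (hηv : ⟪η, v⟫ = polarNorm F v) : ξ = η := by
  have hm := hF.polarNorm_pos hv
  -- Convexity gives F ≤ 1 on the segment. Every point of it pairs with `v` to the full value F°(v)
  -- > 0, which forces F ≥ 1.
  have hseg : ∀ s : ℝ, 0 ≤ s → s ≤ 1 → F (ξ + s • (η - ξ)) = 1 := by
    intro s hs0 hs1
    have hcomb : ξ + s • (η - ξ) = (1 - s) • ξ + s • η := by
      rw [smul_sub, sub_smul, one_smul]; abel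
    rw [hcomb]
    refine le_antisymm ?_ ?_
    · have := hF.convexOn.2 (mem_univ ξ) (mem_univ η) (sub_nonneg.2 hs1) hs0 (by ring)
      rw [hξ, hη, smul_eq_mul, smul_eq_mul] at this
      linarith
    · have := hF.inner_le_mul_polarNorm ((1 - s) • ξ + s • η) v
      rw [inner_add_left, inner_smul_left, inner_smul_left, hξv, hηv, conj_trivial, conj_trivial,
        ← add_mul, sub_add_cancel] at this
      exact le_of_mul_le_mul_right this hm
  have hmid := hseg (1 / 2) (by norm_num) (by norm_num)
  have h0 : ξ + (1 / 2 : ℝ) • (η - ξ) ≠ 0 := by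
    intro h0
    rw [h0, hF.map_zero] at hmid
    exact zero_ne_one hmid
  have := hF.eq_of_midpoint h0 (w := η - ξ) (by
    filter_upwards [eventually_gt_nhds (show (-(1 / 2) : ℝ) < 0 by norm_num),
      eventually_lt_nhds (show (0 : ℝ) < 1 / 2 by norm_num)] with s hs1 hs2
    rw [add_assoc, ← add_smul]
    exact hseg _ (by linarith) (by linarith))
  exact (sub_eq_zero.1 this).symm

theorem continuous_polarNorm (hF : IsFinslerNorm p F) (hn : n ≠ 0) : Continuous (polarNorm F) :=
  (hF.convexOn_polarNorm hn).locallyLipschitz.continuous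

/-- By compactness and uniqueness, unit vectors at distance at least `ε` from `ξ` pair with `v` to
at most a value strictly below F°(v). This gap survives small changes of `v`. -/
theorem eventually_maximizer_mem_ball (hF : IsFinslerNorm p F) (hn : n ≠ 0)
    {v ξ : EuclideanSpace ℝ (Fin n)} (hv : v ≠ 0) (hξ : F ξ = 1) (hξv : ⟪ξ, v⟫ = polarNorm F v)
    {ε : ℝ} (hε : 0 < ε) :
    ∀ᶠ u in 𝓝 v, ∀ η, F η = 1 → ⟪η, u⟫ = polarNorm F u → ‖η - ξ‖ < ε := by
  obtain ⟨C, hC0, hC, -⟩ := hF.polarNorm_le hn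
  have hK : IsCompact ({η | F η = 1} ∩ {η | ε ≤ ‖η - ξ‖}) := by
    refine Metric.isCompact_of_isClosed_isBounded
      ((isClosed_eq hF.continuous continuous_const).inter
        (isClosed_le continuous_const (by fun_prop))) ?_
    exact (Metric.isBounded_closedBall (x := (0 : EuclideanSpace ℝ (Fin n))) (r := C)).subset
      fun η hη => by simpa using hC η hη.1
  rcases ({η | F η = 1} ∩ {η | ε ≤ ‖η - ξ‖}).eq_empty_or_nonempty with hempty | hne
  · refine Eventually.of_forall fun u η hη _ => ?_
    by_contra hcon
    exact (eq_empty_iff_forall_notMem.1 hempty η) ⟨hη, not_lt.1 hcon⟩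
  obtain ⟨ζ, hζ, hmax⟩ := hK.exists_isMaxOn hne (f := fun η => ⟪η, v⟫)
    (continuous_id.inner continuous_const).continuousOn
  have hlt : ⟪ζ, v⟫ < polarNorm F v := by
    refine lt_of_le_of_ne (hF.inner_le_polarNorm hζ.1 v) fun heq => ?_
    have : ζ = ξ := hF.eq_of_inner_eq_polarNorm hv hζ.1 hξ heq hξv
    have h2 : ε ≤ ‖ζ - ξ‖ := hζ.2
    rw [this, sub_self, norm_zero] at h2
    linarith
  have hcont : Tendsto (fun u => ⟪ζ, v⟫ + C * ‖u - v‖ - polarNorm F u) (𝓝 v)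
      (𝓝 (⟪ζ, v⟫ + C * ‖v - v‖ - polarNorm F v)) := by
    have : Continuous fun u => ⟪ζ, v⟫ + C * ‖u - v‖ - polarNorm F u :=
      (by fun_prop : Continuous fun u => ⟪ζ, v⟫ + C * ‖u - v‖).sub (hF.continuous_polarNorm hn)
    exact this.tendsto v
  rw [sub_self, norm_zero, mul_zero, add_zero] at hcont
  filter_upwards [hcont.eventually_lt_const (sub_neg.2 hlt)] with u hu η hη hηu
  by_contra hcon
  have h1 : ⟪η, v⟫ ≤ ⟪ζ, v⟫ := hmax ⟨hη, not_lt.1 hcon⟩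
  have h2 : ⟪η, u - v⟫ ≤ C * ‖u - v‖ :=
    (real_inner_le_norm _ _).trans (by gcongr; exact hC η hη)
  rw [inner_sub_right, hηu] at h2
  linarith

/-- Envelope argument: if `η` is a maximiser at `u`, then 0 ≤ F°(u) − F°(v) − ⟨ξ, u − v⟩ ≤ ⟨η − ξ, u
− v⟩, and `η` tends to `ξ` as `u` tends to `v`. -/
theorem hasGradientAt_polarNorm (hF : IsFinslerNorm p F) (hn : n ≠ 0)
    {v ξ : EuclideanSpace ℝ (Fin n)} (hv : v ≠ 0) (hξ : F ξ = 1) (hξv : ⟪ξ, v⟫ = polarNorm F v) :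
    HasGradientAt (polarNorm F) ξ v := by
  rw [hasGradientAt_iff_hasFDerivAt, hasFDerivAt_iff_isLittleO, Asymptotics.isLittleO_iff]
  intro ε hε
  filter_upwards [hF.eventually_maximizer_mem_ball hn hv hξ hξv hε] with u hu
  obtain ⟨η, hη, hηu⟩ := hF.exists_inner_eq_polarNorm hn u
  have h1 := hu η hη hηu
  have h2 := hF.inner_le_polarNorm hξ u
  have h3 := hF.inner_le_polarNorm hη v
  have h4 : ⟪η - ξ, u - v⟫ ≤ ε * ‖u - v‖ :=
    (real_inner_le_norm _ _).trans (by gcongr)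
  rw [InnerProductSpace.toDual_apply_apply, Real.norm_eq_abs, abs_le]
  simp only [inner_sub_left, inner_sub_right] at h4 ⊢
  constructor
  · have : 0 ≤ ε * ‖u - v‖ := by positivity
    linarith
  · linarith

theorem differentiableAt_polarNorm (hF : IsFinslerNorm p F) (hn : n ≠ 0)
    {v : EuclideanSpace ℝ (Fin n)} (hv : v ≠ 0) : DifferentiableAt ℝ (polarNorm F) v := by
  obtain ⟨ξ, hξ, hξv⟩ := hF.exists_inner_eq_polarNorm hn v
  exact (hF.hasGradientAt_polarNorm hn hv hξ hξv).differentiableAt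

/-- Off the origin this is the chain rule. At the origin (F°)^p = O(‖v‖^p) with p > 1, so the
derivative is zero; the formula agrees because 0^(p−1) = 0, whatever value `gradient` takes there.
-/
theorem hasFDerivAt_polarNorm_rpow (hF : IsFinslerNorm p F) (hn : n ≠ 0) (hp : 1 < p)
    (v : EuclideanSpace ℝ (Fin n)) :
    HasFDerivAt (fun v => polarNorm F v ^ p)
      ((p * polarNorm F v ^ (p - 1)) • innerSL ℝ (gradient (polarNorm F) v)) v := by
  rcases eq_or_ne v 0 with rfl | hv
  · obtain ⟨C, hC0, -, hC⟩ := hF.polarNorm_le hn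
    rw [hF.polarNorm_zero hn, Real.zero_rpow (by linarith), mul_zero, zero_smul,
      hasFDerivAt_iff_isLittleO_nhds_zero]
    simp only [zero_add, hF.polarNorm_zero hn, Real.zero_rpow (by linarith : p ≠ 0), sub_zero,
      zero_apply]
    have h1 : (fun v => polarNorm F v ^ p) =O[𝓝 0]
        fun v : EuclideanSpace ℝ (Fin n) => ‖v‖ ^ p := by
      refine Asymptotics.IsBigO.of_bound (C ^ p) (Eventually.of_forall fun v => ?_)
      rw [Real.norm_of_nonneg (Real.rpow_nonneg (hF.polarNorm_nonneg hn v) _),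
        Real.norm_of_nonneg (Real.rpow_nonneg (norm_nonneg v) _),
        ← Real.mul_rpow hC0.le (norm_nonneg v)]
      exact Real.rpow_le_rpow (hF.polarNorm_nonneg hn v) (hC v) (by linarith)
    refine h1.trans_isLittleO ?_
    rw [← Asymptotics.isLittleO_norm_right]
    have h2 : (fun t : ℝ => t ^ p) =o[𝓝 0] fun t => t := by
      have := (Real.hasDerivAt_rpow_const (x := 0) (p := p) (Or.inr hp.le)).isLittleO
      simpa [Real.zero_rpow (by linarith : p ≠ 0), Real.zero_rpow (by linarith : p - 1 ≠ 0)]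
        using this
    exact h2.comp_tendsto (by simpa using (continuous_norm (E := EuclideanSpace ℝ (Fin n))).tendsto 0)
  · have h1 := (hF.differentiableAt_polarNorm hn hv).hasFDerivAt.rpow_const (p := p)
      (Or.inr hp.le)
    rwa [innerSL_gradient]

end IsFinslerNorm

/-! ### Derivatives of the determinant and of the cofactor map. -/

section CofactorMap

variable {V : Type*} [NormedAddCommGroup V] [InnerProductSpace ℝ V] [FiniteDimensional ℝ V]

/-- The adjoint of the inverse of `A`, with junk value `0` if `A` is not invertible. -/
noncomputable def inverseTranspose (A : V →L[ℝ] V) : V →L[ℝ] V :=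
  ContinuousLinearMap.adjoint (Ring.inverse A)

/-- The cofactor map `det A • (A⁻¹)ᵀ`. -/
noncomputable def cofactorMap (A : V →L[ℝ] V) : V →L[ℝ] V := A.det • inverseTranspose A

theorem inner_inverseTranspose {A : V →L[ℝ] V} (hA : IsUnit A) (ν v : V) :
    ⟪inverseTranspose A ν, A v⟫ = ⟪ν, v⟫ := by
  rw [inverseTranspose, ContinuousLinearMap.adjoint_inner_left, ← mul_apply_eq_comp,
    Ring.inverse_mul_cancel A hA, one_apply_eq_self]

omit [FiniteDimensional ℝ V] in
theorem injective_of_isUnit {A : V →L[ℝ] V} (hA : IsUnit A) : Function.Injective A := by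
  refine Function.LeftInverse.injective (g := (Ring.inverse A : V →L[ℝ] V)) fun v => ?_
  rw [← mul_apply_eq_comp, Ring.inverse_mul_cancel A hA, one_apply_eq_self]

theorem continuousAt_inverseTranspose {A : V →L[ℝ] V} (hA : IsUnit A) :
    ContinuousAt inverseTranspose A := by
  have h := NormedRing.inverse_continuousAt hA.unit
  rw [hA.unit_spec] at h
  exact (LinearIsometryEquiv.continuous _).continuousAt.comp h

theorem contDiff_det : ContDiff ℝ ∞ fun A : V →L[ℝ] V => A.det := by
  have h : ∀ A : V →L[ℝ] V, A.det = ∑ σ : Equiv.Perm (Fin (Module.finrank ℝ V)),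
      (Equiv.Perm.sign σ : ℤ) * ∏ i, ⟪stdOrthonormalBasis ℝ V (σ i), A (stdOrthonormalBasis ℝ V i)⟫ := by
    intro A
    rw [ContinuousLinearMap.det, ← LinearMap.det_toMatrix (stdOrthonormalBasis ℝ V).toBasis,
      Matrix.det_apply']
    simp [LinearMap.toMatrix_apply, OrthonormalBasis.repr_apply_apply]
  simp_rw [funext h]
  refine ContDiff.sum fun σ _ => contDiff_const.mul (contDiff_prod fun i _ => ?_)
  exact contDiff_const.inner ℝ
    (ContinuousLinearMap.apply ℝ V (stdOrthonormalBasis ℝ V i)).contDiff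

theorem hasDerivAt_det_one_add_smul (B : V →L[ℝ] V) :
    HasDerivAt (fun t : ℝ => (1 + t • B).det) (LinearMap.trace ℝ V B.toLinearMap) 0 := by
  set b := (stdOrthonormalBasis ℝ V).toBasis
  set M := LinearMap.toMatrix b b B.toLinearMap
  have h : ∀ t : ℝ, (1 + t • B).det = (1 + t • M).det := by
    intro t
    rw [ContinuousLinearMap.det, ← LinearMap.det_toMatrix b]
    congr 1
    rw [show ((1 + t • B : V →L[ℝ] V) : V →ₗ[ℝ] V) = LinearMap.id + t • (B : V →ₗ[ℝ] V) from rfl,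
      map_add, map_smul, LinearMap.toMatrix_id]
  rw [LinearMap.trace_eq_matrix_trace ℝ b]
  simp only [h]
  rw [funext fun t : ℝ => Matrix.det_one_add_smul t M]
  have h1 : HasDerivAt (fun t : ℝ => t) 1 0 := hasDerivAt_id 0
  have h2 := (((h1.const_mul (Matrix.trace M)).const_add 1).add
    ((Polynomial.hasDerivAt (Matrix.det (1 + (Polynomial.X : Polynomial ℝ) •
      M.map Polynomial.C)).divX.divX (0 : ℝ)).mul (h1.pow 2)))
  exact h2.congr_deriv (by simp [M])

/-- Taking adjoints, as a real continuous linear map. -/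
noncomputable def adjointCLM : (V →L[ℝ] V) →L[ℝ] (V →L[ℝ] V) :=
  LinearMap.toContinuousLinearMap
    { toFun := fun A => ContinuousLinearMap.adjoint A
      map_add' := fun A B => map_add _ A B
      map_smul' := fun c A => by simp }

theorem differentiableAt_cofactorMap_one :
    DifferentiableAt ℝ (cofactorMap : (V →L[ℝ] V) → V →L[ℝ] V) 1 := by
  refine (contDiff_det.differentiable (by simp) _).smul ?_
  have h := (hasFDerivAt_ringInverse (𝕜 := ℝ) (1 : (V →L[ℝ] V)ˣ)).differentiableAt
  exact adjointCLM.differentiableAt.comp (1 : V →L[ℝ] V) h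

theorem cofactorMap_one : cofactorMap (1 : V →L[ℝ] V) = 1 := by
  rw [cofactorMap, inverseTranspose, Ring.inverse_one, ContinuousLinearMap.one_def,
    ContinuousLinearMap.adjoint_id, ContinuousLinearMap.det, ContinuousLinearMap.coe_id,
    LinearMap.det_id, one_smul]

/-- Product rule at the identity: the determinant contributes the trace, and the inverse transpose
contributes minus the adjoint. -/
theorem hasDerivAt_cofactorMap_one_add_smul (B : V →L[ℝ] V) :
    HasDerivAt (fun t : ℝ => cofactorMap (1 + t • B))
      (LinearMap.trace ℝ V B.toLinearMap • 1 - ContinuousLinearMap.adjoint B) 0 := by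
  have hl : HasDerivAt (fun t : ℝ => 1 + t • B) B 0 := by
    simpa using ((hasDerivAt_id (0 : ℝ)).smul_const B).const_add 1
  have h := hasFDerivAt_ringInverse (𝕜 := ℝ) (1 : (V →L[ℝ] V)ˣ)
  have h1 : HasDerivAt (fun t : ℝ => Ring.inverse (1 + t • B)) (-B) 0 := by
    have := h.comp_hasDerivAt_of_eq (0 : ℝ) hl (by simp)
    simpa using! this
  have h2 : HasDerivAt (fun t : ℝ => inverseTranspose (1 + t • B))
      (-ContinuousLinearMap.adjoint B) 0 := by
    have := (adjointCLM (V := V)).hasFDerivAt.comp_hasDerivAt (0 : ℝ) h1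
    simpa [adjointCLM] using! this
  have h3 := (hasDerivAt_det_one_add_smul B).smul h2
  have h4 : inverseTranspose (1 : V →L[ℝ] V) = 1 := by
    rw [inverseTranspose, Ring.inverse_one, ContinuousLinearMap.one_def,
      ContinuousLinearMap.adjoint_id]
  have h5 : (1 : V →L[ℝ] V).det = 1 := LinearMap.det_id
  rw [zero_smul, add_zero, h4, h5, one_smul, neg_add_eq_sub] at h3
  exact h3

theorem continuousAt_cofactorMap {A : V →L[ℝ] V} (hA : IsUnit A) : ContinuousAt cofactorMap A :=
  contDiff_det.continuous.continuousAt.smul (continuousAt_inverseTranspose hA)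

theorem isUnit_one_add_of_norm_lt_one {B : V →L[ℝ] V} (hB : ‖B‖ < 1) : IsUnit (1 + B) := by
  have := isUnit_one_sub_of_norm_lt_one (x := -B) (by rwa [norm_neg])
  rwa [sub_neg_eq_add] at this

end CofactorMap

/-- Dominated convergence needs a Lipschitz bound only between time `t` and time 0. Integrability of
the derivative is part of the conclusion, so integrands containing the mean curvature need no
separate regularity argument. -/
theorem hasDerivAt_setIntegral_of_norm_sub_le {α : Type*} [MeasurableSpace α] {μ : Measure α}
    {K : Set α} (hK : MeasurableSet K) (hμ : μ K < ⊤) {f : ℝ → α → ℝ} {f' : α → ℝ} {C : ℝ}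
    (hm : ∀ᶠ t in 𝓝 0, AEStronglyMeasurable (f t) (μ.restrict K)) (hi : IntegrableOn (f 0) K μ)
    (hC : ∀ᶠ t in 𝓝 0, ∀ x ∈ K, |f t x - f 0 x| ≤ C * |t|)
    (hd : ∀ x ∈ K, HasDerivAt (fun t => f t x) (f' x) 0) :
    IntegrableOn f' K μ ∧ HasDerivAt (fun t => ∫ x in K, f t x ∂μ) (∫ x in K, f' x ∂μ) 0 := by
  classical
  -- The derivative is a pointwise limit of difference quotients. Those at times where measurability
  -- is not known are replaced by 0, which does not affect the limit.
  have hf' : AEStronglyMeasurable f' (μ.restrict K) := by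
    refine aestronglyMeasurable_of_tendsto_ae (𝓝[≠] (0 : ℝ))
      (f := fun t x => if AEStronglyMeasurable (f t) (μ.restrict K) then
        t⁻¹ * (f t x - f 0 x) else 0) (fun t => ?_) ?_
    · by_cases h : AEStronglyMeasurable (f t) (μ.restrict K)
      · simp only [h, if_true]
        exact (h.sub hi.aestronglyMeasurable).const_mul _
      · simp only [h, if_false]
        exact aestronglyMeasurable_const
    · filter_upwards [ae_restrict_mem hK] with x hx
      have h1 := hasDerivAt_iff_tendsto_slope_zero.1 (hd x hx)
      refine h1.congr' ?_
      filter_upwards [hm.filter_mono nhdsWithin_le_nhds] with t ht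
      simp [ht]
  have hset := hm.and hC
  have : IsFiniteMeasure (μ.restrict K) := ⟨by rwa [Measure.restrict_apply_univ]⟩
  obtain ⟨h1, h2⟩ := hasFDerivAt_integral_of_dominated_loc_of_lip' (𝕜 := ℝ) (μ := μ.restrict K)
    (F := f) (x₀ := 0) (bound := fun _ => C)
    (F' := fun x => ContinuousLinearMap.toSpanSingleton ℝ (f' x)) hset
    (fun t ht => ht.1) hi
    ((ContinuousLinearMap.toSpanSingletonCLE.continuous).comp_aestronglyMeasurable hf')
    ((ae_restrict_mem hK).mono fun x hx t ht => by simpa using ht.2 x hx)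
    (integrable_const _) ((ae_restrict_mem hK).mono fun x hx => (hd x hx).hasFDerivAt)
  have h3 : IntegrableOn f' K μ := by
    have := h1.apply_continuousLinearMap (1 : ℝ)
    simpa using! this
  refine ⟨h3, ?_⟩
  have h4 := h2.hasDerivAt
  rw [ContinuousLinearMap.integral_apply h1] at h4
  simpa using h4

/-! ### Transport of normals, boundary integrals and volume under the deformation. -/

section Deformation

variable {n : ℕ}

/-- Outward normals are transported by homeomorphisms through the inverse transpose of the
differential. -/
theorem IsOutwardUnitNormal.image {Ω : Set (EuclideanSpace ℝ (Fin n))}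
    {x ν : EuclideanSpace ℝ (Fin n)} (h : IsOutwardUnitNormal Ω x ν)
    (e : EuclideanSpace ℝ (Fin n) ≃ₜ EuclideanSpace ℝ (Fin n))
    {A : EuclideanSpace ℝ (Fin n) →L[ℝ] EuclideanSpace ℝ (Fin n)} (hA : IsUnit A)
    (he : HasFDerivAt e A x) {c : ℝ} (hc : 0 < c) (hce : ∀ z, c * ‖z - x‖ ≤ ‖e z - e x‖) :
    IsOutwardUnitNormal (e '' Ω) (e x)
      (‖inverseTranspose A ν‖⁻¹ • inverseTranspose A ν) := by
  set w := inverseTranspose A ν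
  have hw0 : 0 < ‖w‖ := by
    refine norm_pos_iff.2 fun h0 => ?_
    have h1 := inner_inverseTranspose hA ν ν
    rw [show inverseTranspose A ν = 0 from h0, inner_zero_left, real_inner_self_eq_norm_sq,
      h.1] at h1
    norm_num at h1
  refine ⟨by rw [norm_smul, norm_inv, norm_norm, inv_mul_cancel₀ hw0.ne'], fun ε hε => ?_⟩
  -- Half of the allowed aperture absorbs the linearisation error and half the cone condition for
  -- `ν`; the factor `c` converts distances before the map into distances after it.
  set δ := ε * ‖w‖ * c / 2 with hδ
  have hδ0 : 0 < δ := by positivity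
  have h1 : ∀ᶠ z in 𝓝 x, ‖e z - e x - A (z - x)‖ ≤ (δ / ‖w‖) * ‖z - x‖ :=
    he.isLittleO.def (div_pos hδ0 hw0)
  have h2 := e.symm.continuous.tendsto (e x)
  rw [e.symm_apply_apply] at h2
  filter_upwards [h2.eventually (h1.and (h.2 δ hδ0))] with y hy
  obtain ⟨z, rfl⟩ := e.surjective y
  rw [e.symm_apply_apply] at hy
  obtain ⟨hy1, hy2, hy3⟩ := hy
  rw [e.injective.mem_set_image, inner_smul_right]
  have h3 : ⟪e z - e x, w⟫ = ⟪z - x, ν⟫ + ⟪e z - e x - A (z - x), w⟫ := by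
    rw [inner_sub_left (e z - e x), real_inner_comm w (A (z - x)), inner_inverseTranspose hA,
      real_inner_comm (z - x) ν]
    ring
  have h4 : |⟪e z - e x - A (z - x), w⟫| ≤ δ * ‖z - x‖ := by
    refine (abs_real_inner_le_norm _ _).trans ?_
    calc _ ≤ δ / ‖w‖ * ‖z - x‖ * ‖w‖ := by gcongr
      _ = δ * ‖z - x‖ := by field_simp
  have h5 : 2 * δ * ‖z - x‖ ≤ ‖w‖ * (ε * ‖e z - e x‖) := by
    calc 2 * δ * ‖z - x‖ = ‖w‖ * (ε * (c * ‖z - x‖)) := by rw [hδ]; ring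
      _ ≤ _ := by gcongr; exact hce z
  obtain ⟨h6, h7⟩ := abs_le.1 h4
  constructor
  · intro hlt
    refine hy2 ?_
    rw [inv_mul_eq_div, div_lt_iff₀ hw0] at hlt
    linarith
  · intro hlt
    refine hy3 ?_
    rw [inv_mul_eq_div, lt_div_iff₀ hw0] at hlt
    linarith

/-- The flow map `x ↦ x + t X(x)`. -/
def displacement (X : EuclideanSpace ℝ (Fin n) → EuclideanSpace ℝ (Fin n)) (t : ℝ)
    (x : EuclideanSpace ℝ (Fin n)) : EuclideanSpace ℝ (Fin n) := x + t • X x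

variable {X : EuclideanSpace ℝ (Fin n) → EuclideanSpace ℝ (Fin n)} {K : NNReal} {t : ℝ}

theorem hasStrictFDerivAt_displacement (hX : ContDiff ℝ 1 X) (t : ℝ)
    (x : EuclideanSpace ℝ (Fin n)) :
    HasStrictFDerivAt (displacement X t) (1 + t • fderiv ℝ X x) x :=
  (hasStrictFDerivAt_id x).add ((hX.contDiffAt.hasStrictFDerivAt one_ne_zero).const_smul t)

theorem isUnit_one_add_smul_fderiv (hK : LipschitzWith K X) (ht : |t| * K < 1)
    (x : EuclideanSpace ℝ (Fin n)) : IsUnit (1 + t • fderiv ℝ X x) := by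
  refine isUnit_one_add_of_norm_lt_one ?_
  rw [norm_smul, Real.norm_eq_abs]
  exact (mul_le_mul_of_nonneg_left (norm_fderiv_le_of_lipschitz ℝ hK) (abs_nonneg t)).trans_lt ht

theorem le_norm_displacement_sub (hK : LipschitzWith K X) (x z : EuclideanSpace ℝ (Fin n)) :
    (1 - |t| * K) * ‖z - x‖ ≤ ‖displacement X t z - displacement X t x‖ := by
  have h1 : displacement X t z - displacement X t x = (z - x) + t • (X z - X x) := by
    rw [displacement, displacement, smul_sub]; abel
  have h2 : ‖t • (X z - X x)‖ ≤ |t| * (K * ‖z - x‖) := by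
    rw [norm_smul, Real.norm_eq_abs]
    gcongr
    exact hK.norm_sub_le z x
  rw [h1]
  have h3 := norm_sub_norm_le (z - x) (-(t • (X z - X x)))
  rw [norm_neg, sub_neg_eq_add] at h3
  linarith

/-- For small `t`, the map `x ↦ x + t X(x)` is a homeomorphism. -/
theorem exists_homeomorph_eq_displacement (hK : LipschitzWith K X) (ht : |t| * K < 1) :
    ∃ e : EuclideanSpace ℝ (Fin n) ≃ₜ EuclideanSpace ℝ (Fin n), ⇑e = displacement X t := by
  have h : ApproximatesLinearOn (displacement X t)
      (ContinuousLinearEquiv.refl ℝ (EuclideanSpace ℝ (Fin n)) :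
        EuclideanSpace ℝ (Fin n) →L[ℝ] EuclideanSpace ℝ (Fin n)) univ (‖t‖₊ * K) := by
    intro z _ x _
    have h1 : displacement X t z - displacement X t x -
        (ContinuousLinearEquiv.refl ℝ (EuclideanSpace ℝ (Fin n)) :
          EuclideanSpace ℝ (Fin n) →L[ℝ] EuclideanSpace ℝ (Fin n)) (z - x) =
        t • (X z - X x) := by
      rw [displacement, displacement, smul_sub]
      simp only [ContinuousLinearEquiv.coe_coe, ContinuousLinearEquiv.coe_refl', id]
      abel
    rw [h1, norm_smul, NNReal.coe_mul, coe_nnnorm, mul_assoc]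
    gcongr
    exact hK.norm_sub_le z x
  rcases subsingleton_or_nontrivial (EuclideanSpace ℝ (Fin n)) with hs | hs
  · exact ⟨h.toHomeomorph _ (Or.inl hs), rfl⟩
  · refine ⟨h.toHomeomorph _ (Or.inr ?_), rfl⟩
    rw [← NNReal.coe_lt_coe, NNReal.coe_inv, NNReal.coe_mul, coe_nnnorm, coe_nnnorm]
    have : ‖((ContinuousLinearEquiv.refl ℝ (EuclideanSpace ℝ (Fin n))).symm :
        EuclideanSpace ℝ (Fin n) →L[ℝ] EuclideanSpace ℝ (Fin n))‖ = 1 :=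
      ContinuousLinearMap.norm_id
    rw [this, inv_one]
    exact ht

theorem continuous_fderiv_displacement (hX : ContDiff ℝ 1 X) (t : ℝ) :
    Continuous fun x => 1 + t • fderiv ℝ X x :=
  continuous_const.add ((hX.continuous_fderiv one_ne_zero).const_smul t)

/-- Change of variables for anisotropic boundary integrals along a deformation. -/
theorem setIntegral_frontier_displacement_image {p : ℝ} {F : EuclideanSpace ℝ (Fin n) → ℝ}
    (hF : IsFinslerNorm p F) {Ω : Set (EuclideanSpace ℝ (Fin n))} (h : HasSmoothBoundary Ω)
    (hΩ : IsOpen Ω) (hX : ContDiff ℝ 1 X) (hK : LipschitzWith K X) (ht : |t| * K < 1)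
    (G : EuclideanSpace ℝ (Fin n) → ℝ) :
    ∫ y in frontier (displacement X t '' Ω),
        G y * F (outwardNormal (displacement X t '' Ω) y) ∂μHE[n - 1] =
      ∫ x in frontier Ω, G (displacement X t x) *
        F (cofactorMap (1 + t • fderiv ℝ X x) (outwardNormal Ω x)) ∂μHE[n - 1] := by
  obtain ⟨e, he⟩ := exists_homeomorph_eq_displacement hK ht
  have hu := isUnit_one_add_smul_fderiv hK ht
  have hfr : frontier (displacement X t '' Ω) = displacement X t '' frontier Ω := by
    rw [← he, e.image_frontier]
  have harea := setIntegral_image_euclideanHausdorffMeasure (S := frontier Ω)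
    (ν := outwardNormal Ω) (Φ := displacement X t) (Φ' := fun x => 1 + t • fderiv ℝ X x)
    (w := fun x => inverseTranspose (1 + t • fderiv ℝ X x) (outwardNormal Ω x))
    isClosed_frontier.measurableSet (fun x hx => h.norm_outwardNormal hΩ hx)
    (fun x hx => h.isStrictlyTangentAt hΩ hx) (fun x _ => hasStrictFDerivAt_displacement hX t x)
    (fun x _ => injective_of_isUnit (hu x)) (fun x _ v => inner_inverseTranspose (hu x) _ v)
    (by
      have hc := continuous_fderiv_displacement hX t
      have h2 : Continuous fun x => inverseTranspose (1 + t • fderiv ℝ X x) :=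
        continuous_iff_continuousAt.2 fun x =>
          ContinuousAt.comp (f := fun x => 1 + t • fderiv ℝ X x)
            (continuousAt_inverseTranspose (hu x)) hc.continuousAt
      exact (contDiff_det.continuous.comp hc).abs.continuousOn.mul
        (h2.continuousOn.clm_apply (h.continuousOn_outwardNormal hΩ)).norm)
    (by rw [← he]; exact e.injective.injOn)
    (fun y => G y * F (outwardNormal (displacement X t '' Ω) y))
  rw [finrank_euclideanSpace_fin] at harea
  rw [hfr, harea]
  refine setIntegral_congr_fun isClosed_frontier.measurableSet fun x hx => ?_
  have hν := h.isOutwardUnitNormal_outwardNormal hΩ hx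
  have him := hν.image e (hu x) (by
    rw [he]; exact (hasStrictFDerivAt_displacement hX t x).hasFDerivAt)
    (sub_pos.2 ht) (fun z => by rw [he]; exact le_norm_displacement_sub hK x z)
  rw [he] at him
  have hw0 : 0 < ‖inverseTranspose (1 + t • fderiv ℝ X x) (outwardNormal Ω x)‖ := by
    refine norm_pos_iff.2 fun h0 => ?_
    have := him.1
    rw [h0, smul_zero, norm_zero] at this
    exact zero_ne_one this
  -- Homogeneity of `F` cancels the normalisation of the transported normal against the length
  -- factor of the Jacobian, and |det A| moves inside `F`.
  simp only [surfaceJacobian]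
  rw [him.outwardNormal_eq, hF.homogeneous, abs_of_pos (inv_pos.2 hw0), cofactorMap,
    smul_apply, hF.homogeneous]
  field_simp

theorem volume_real_displacement_image {Ω : Set (EuclideanSpace ℝ (Fin n))}
    (hΩ : IsOpen Ω) (hX : ContDiff ℝ 1 X) (hK : LipschitzWith K X) (ht : |t| * K < 1) :
    volume.real (displacement X t '' Ω) = ∫ x in Ω, |(1 + t • fderiv ℝ X x).det| := by
  obtain ⟨e, he⟩ := exists_homeomorph_eq_displacement hK ht
  have := integral_image_eq_integral_abs_det_fderiv_smul volume hΩ.measurableSet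
    (f := displacement X t) (f' := fun x => 1 + t • fderiv ℝ X x)
    (fun x _ => (hasStrictFDerivAt_displacement hX t x).hasFDerivAt.hasFDerivWithinAt)
    (by rw [← he]; exact e.injective.injOn) (fun _ => (1 : ℝ))
  simpa using this

end Deformation

/-- Such a map has rank at most one: it is v ↦ ⟨ν, v⟩ Dν. -/
theorem trace_eq_inner_of_forall_orthogonal {V : Type*} [NormedAddCommGroup V]
    [InnerProductSpace ℝ V] [FiniteDimensional ℝ V] {D : V →L[ℝ] V} {ν : V} (hν : ‖ν‖ = 1)
    (hD : ∀ τ, ⟪ν, τ⟫ = 0 → D τ = 0) : LinearMap.trace ℝ V D.toLinearMap = ⟪D ν, ν⟫ := by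
  have h : D.toLinearMap = (innerSL ℝ ν).toLinearMap.smulRight (D ν) := by
    ext v
    have h1 := hD (v - ⟪ν, v⟫ • ν) (by
      rw [inner_sub_right, inner_smul_right, real_inner_self_eq_norm_sq, hν]; ring)
    rw [map_sub, map_smul, sub_eq_zero] at h1
    simpa using h1
  rw [h, LinearMap.trace_smulRight]
  simp [real_inner_comm]

/-! ### Anisotropic mean curvature and the first variation of the area element. -/

namespace HasSmoothBoundary

variable {n : ℕ} {p : ℝ} {F : EuclideanSpace ℝ (Fin n) → ℝ} {Ω : Set (EuclideanSpace ℝ (Fin n))}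
  {N : EuclideanSpace ℝ (Fin n) → EuclideanSpace ℝ (Fin n)} {φ : EuclideanSpace ℝ (Fin n) → ℝ}
  {x : EuclideanSpace ℝ (Fin n)}

theorem outwardNormal_ne_zero (h : HasSmoothBoundary Ω) (hΩ : IsOpen Ω) (hx : x ∈ frontier Ω) :
    outwardNormal Ω x ≠ 0 := by
  intro h0
  have := h.norm_outwardNormal hΩ hx
  rw [h0, norm_zero] at this
  exact zero_ne_one this

/-- The differential of the anisotropic normal maps tangent vectors to tangent vectors. -/
theorem inner_fderiv_outwardNormal_eq_zero (h : HasSmoothBoundary Ω) (hΩ : IsOpen Ω)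
    (hF : IsFinslerNorm p F) (hN : ContDiff ℝ 1 N)
    (hNΩ : ∀ x ∈ frontier Ω, N x = anisotropicNormal F Ω x) (hx : x ∈ frontier Ω)
    {τ : EuclideanSpace ℝ (Fin n)} (hτ : ⟪outwardNormal Ω x, τ⟫ = 0) :
    ⟪outwardNormal Ω x, fderiv ℝ N x τ⟫ = 0 := by
  -- At `y = x` the value is F(ν(x)) by Euler's identity, and the gradient inequality bounds all
  -- other values by it. As `τ` and `-τ` are both tangent, the derivative along `τ` then vanishes.
  have hmax : IsLocalMaxOn (fun y => ⟪outwardNormal Ω x, N y⟫) (frontier Ω) x := by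
    refine eventually_mem_nhdsWithin.mono fun y hy => ?_
    change ⟪outwardNormal Ω x, N y⟫ ≤ ⟪outwardNormal Ω x, N x⟫
    rw [hNΩ y hy, hNΩ x hx, anisotropicNormal, anisotropicNormal,
      real_inner_comm (gradient F (outwardNormal Ω y)),
      real_inner_comm (gradient F (outwardNormal Ω x)),
      hF.inner_gradient_self (h.outwardNormal_ne_zero hΩ hx)]
    exact hF.inner_gradient_le (h.outwardNormal_ne_zero hΩ hy) _
  have hd : HasFDerivAt (fun y => ⟪outwardNormal Ω x, N y⟫)
      ((innerSL ℝ (outwardNormal Ω x)).comp (fderiv ℝ N x)) x :=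
    (innerSL ℝ (outwardNormal Ω x)).hasFDerivAt.comp x
      (hN.differentiable one_ne_zero x).hasFDerivAt
  exact hmax.hasFDerivWithinAt_eq_zero hd.hasFDerivWithinAt (h.mem_posTangentConeAt hΩ hx hτ)
    (h.mem_posTangentConeAt hΩ hx (by rw [inner_neg_right, hτ, neg_zero]))

/-- The derivative within the frontier is determined only on tangent vectors, where it agrees with
that of `N`. The difference of the two kills the tangent space, so its trace is its normal entry,
which the tangential divergence subtracts. -/
theorem anisotropicMeanCurvature_eq (h : HasSmoothBoundary Ω) (hΩ : IsOpen Ω)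
    (hN : ContDiff ℝ 1 N) (hNΩ : ∀ x ∈ frontier Ω, N x = anisotropicNormal F Ω x)
    (hx : x ∈ frontier Ω) :
    anisotropicMeanCurvature F Ω x = LinearMap.trace ℝ _ (fderiv ℝ N x).toLinearMap
      - ⟪fderiv ℝ N x (outwardNormal Ω x), outwardNormal Ω x⟫ := by
  have h1 : HasFDerivWithinAt (anisotropicNormal F Ω) (fderiv ℝ N x) (frontier Ω) x :=
    (hN.differentiable one_ne_zero x).hasFDerivAt.hasFDerivWithinAt.congr
      (fun y hy => (hNΩ y hy).symm) (hNΩ x hx).symm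
  have h2 := trace_eq_inner_of_forall_orthogonal (ν := outwardNormal Ω x)
    (D := fderivWithin ℝ (anisotropicNormal F Ω) (frontier Ω) x - fderiv ℝ N x)
    (h.norm_outwardNormal hΩ hx) fun τ hτ => by
      rw [_root_.sub_apply, sub_eq_zero]
      exact h1.differentiableWithinAt.hasFDerivWithinAt.unique_on h1
        (h.mem_tangentConeAt hΩ hx hτ)
  rw [ContinuousLinearMap.toLinearMap_sub, map_sub, _root_.sub_apply, inner_sub_left] at h2
  rw [anisotropicMeanCurvature, tangentialDivergence]
  linarith

/-- The first variation of the anisotropic area element. -/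
theorem trace_mul_sub_inner_eq (h : HasSmoothBoundary Ω) (hΩ : IsOpen Ω)
    (hF : IsFinslerNorm p F) (hφ : ContDiff ℝ 1 φ) (hN : ContDiff ℝ 1 N)
    (hNΩ : ∀ x ∈ frontier Ω, N x = anisotropicNormal F Ω x) (hx : x ∈ frontier Ω) :
    LinearMap.trace ℝ _ (fderiv ℝ (fun y => φ y • N y) x).toLinearMap * F (outwardNormal Ω x)
      - ⟪fderiv ℝ (fun y => φ y • N y) x (N x), outwardNormal Ω x⟫ =
      φ x * (F (outwardNormal Ω x) * anisotropicMeanCurvature F Ω x) := by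
  set ν := outwardNormal Ω x
  have hν : ‖ν‖ = 1 := h.norm_outwardNormal hΩ hx
  have hNν : ⟪N x, ν⟫ = F ν := by
    rw [hNΩ x hx, anisotropicNormal, hF.inner_gradient_self (h.outwardNormal_ne_zero hΩ hx)]
  have hX : fderiv ℝ (fun y => φ y • N y) x = φ x • fderiv ℝ N x + (fderiv ℝ φ x).smulRight (N x) :=
    fderiv_fun_smul (hφ.differentiable one_ne_zero x) (hN.differentiable one_ne_zero x)
  have htr : LinearMap.trace ℝ _ ((fderiv ℝ φ x).smulRight (N x)).toLinearMap =
      fderiv ℝ φ x (N x) :=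
    LinearMap.trace_smulRight (fderiv ℝ φ x).toLinearMap (N x)
  -- Because ⟨N, ν⟩ = F(ν), this vector is tangent; hence ⟨DN N, ν⟩ = F(ν) ⟨DN ν, ν⟩. The terms with
  -- the derivative of `φ` cancel by the same identity.
  have hτ := h.inner_fderiv_outwardNormal_eq_zero hΩ hF hN hNΩ hx (τ := N x - F ν • ν) (by
    rw [inner_sub_right, inner_smul_right, real_inner_self_eq_norm_sq, hν, real_inner_comm, hNν]
    ring)
  rw [map_sub, map_smul, inner_sub_right, inner_smul_right, sub_eq_zero,
    real_inner_comm (fderiv ℝ N x (N x)), real_inner_comm (fderiv ℝ N x ν)] at hτ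
  rw [h.anisotropicMeanCurvature_eq hΩ hN hNΩ hx, hX, ContinuousLinearMap.toLinearMap_add, map_add,
    htr, ContinuousLinearMap.toLinearMap_smul, map_smul, _root_.add_apply, _root_.smul_apply,
    ContinuousLinearMap.smulRight_apply, inner_add_left, inner_smul_left, inner_smul_left, hNν, hτ]
  simp only [conj_trivial, smul_eq_mul]
  ring

end HasSmoothBoundary

/-- A linear bound around the identity, with constants independent of the boundary point, as
domination under the integral requires. -/
theorem exists_norm_cofactorMap_sub_one_le {V : Type*} [NormedAddCommGroup V]
    [InnerProductSpace ℝ V] [FiniteDimensional ℝ V] :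
    ∃ C δ : ℝ, 0 ≤ C ∧ 0 < δ ∧ ∀ B : V →L[ℝ] V, ‖B‖ < δ → ‖cofactorMap (1 + B) - 1‖ ≤ C * ‖B‖ := by
  obtain ⟨C, hC, h⟩ := (differentiableAt_cofactorMap_one (V := V)).isBigO_sub.exists_nonneg
  obtain ⟨δ, hδ, hB⟩ := Metric.eventually_nhds_iff.1 h.bound
  refine ⟨C, δ, hC, hδ, fun B hB' => ?_⟩
  have := hB (y := 1 + B) (by simpa [dist_eq_norm] using hB')
  rwa [cofactorMap_one, add_sub_cancel_left] at this

theorem eventually_abs_mul_lt {c δ : ℝ} (hδ : 0 < δ) :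
    ∀ᶠ t : ℝ in 𝓝 0, |t| * c < δ := by
  have : Tendsto (fun t : ℝ => |t| * c) (𝓝 0) (𝓝 (|0| * c)) :=
    (continuous_abs.mul continuous_const).tendsto 0
  rw [abs_zero, zero_mul] at this
  exact this.eventually_lt_const hδ

/-! ### Differentiation of weighted boundary integrals and of the volume. -/

namespace HasSmoothBoundary

variable {n : ℕ} {p : ℝ} {F : EuclideanSpace ℝ (Fin n) → ℝ} {Ω : Set (EuclideanSpace ℝ (Fin n))}
  {X : EuclideanSpace ℝ (Fin n) → EuclideanSpace ℝ (Fin n)}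

/-- A general weight `G` treats perimeter and momentum together. The integrand `f'` is prescribed
only on the frontier, so it can be supplied in its final form with the mean curvature. -/
theorem hasDerivAt_setIntegral_frontier_displacement (h : HasSmoothBoundary Ω) (hΩ : IsOpen Ω)
    (hb : Bornology.IsBounded Ω) (hF : IsFinslerNorm p F) (hX : ContDiff ℝ 1 X)
    (hc : HasCompactSupport X) {G : EuclideanSpace ℝ (Fin n) → ℝ} (hG : LocallyLipschitz G)
    {G' : EuclideanSpace ℝ (Fin n) → EuclideanSpace ℝ (Fin n) →L[ℝ] ℝ}
    (hG' : ∀ x, HasFDerivAt G (G' x) x) {f' : EuclideanSpace ℝ (Fin n) → ℝ}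
    (hf' : ∀ x ∈ frontier Ω, f' x = G' x (X x) * F (outwardNormal Ω x) + G x *
      (LinearMap.trace ℝ _ (fderiv ℝ X x).toLinearMap * F (outwardNormal Ω x)
        - ⟪fderiv ℝ X x (gradient F (outwardNormal Ω x)), outwardNormal Ω x⟫)) :
    IntegrableOn f' (frontier Ω) μHE[n - 1] ∧
    HasDerivAt (fun t : ℝ => ∫ y in frontier (displacement X t '' Ω),
        G y * F (outwardNormal (displacement X t '' Ω) y) ∂μHE[n - 1])
      (∫ x in frontier Ω, f' x ∂μHE[n - 1]) 0 := by
  obtain ⟨K, hK⟩ := hX.lipschitzWith_of_hasCompactSupport hc one_ne_zero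
  have hfc := isCompact_frontier_of_isBounded hb
  have hν := h.continuousOn_outwardNormal hΩ
  have hsmall : ∀ᶠ t : ℝ in 𝓝 0, |t| * K < 1 :=
    eventually_abs_mul_lt one_pos
  have hcont : ∀ t : ℝ, |t| * K < 1 → ContinuousOn (fun x => G (displacement X t x) *
      F (cofactorMap (1 + t • fderiv ℝ X x) (outwardNormal Ω x))) (frontier Ω) := by
    intro t ht
    have h1 : Continuous (displacement X t) := continuous_id.add (hX.continuous.const_smul t)
    have h2 : Continuous fun x => cofactorMap (1 + t • fderiv ℝ X x) :=
      continuous_iff_continuousAt.2 fun x =>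
        ContinuousAt.comp (f := fun x => 1 + t • fderiv ℝ X x)
          (continuousAt_cofactorMap (isUnit_one_add_smul_fderiv hK ht x))
          (continuous_fderiv_displacement hX t).continuousAt
    exact (hG.continuous.comp h1).continuousOn.mul
      (hF.continuous.comp_continuousOn (h2.continuousOn.clm_apply hν))
  have hzero : ∀ x, cofactorMap (1 + (0 : ℝ) • fderiv ℝ X x) = 1 := fun x => by
    rw [zero_smul ℝ (fderiv ℝ X x), add_zero, cofactorMap_one]
  have hdisp : ∀ x, displacement X 0 x = x := fun x => by rw [displacement, zero_smul, add_zero]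
  obtain ⟨KF, hKF⟩ := hF.exists_lipschitzWith
  obtain ⟨C₁, δ, hC₁, hδ, hcof⟩ :=
    exists_norm_cofactorMap_sub_one_le (V := EuclideanSpace ℝ (Fin n))
  obtain ⟨M, hM⟩ := hc.exists_bound_of_continuous hX.continuous
  obtain ⟨R, hR⟩ := hfc.isBounded.exists_norm_le
  obtain ⟨CG, hCG⟩ := hfc.exists_bound_of_continuousOn hG.continuous.continuousOn
  -- Displaced boundary points stay in the ball of radius `R + 1` once |t|M < 1, so one Lipschitz
  -- constant of `G` serves all of them.
  obtain ⟨L, hL⟩ := LocallyLipschitzOn.exists_lipschitzOnWith_of_compact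
    (isCompact_closedBall (0 : EuclideanSpace ℝ (Fin n)) (R + 1)) (hG.locallyLipschitzOn)
  -- The constant comes from splitting the increment of a product: the increment of `G` times a
  -- bound for `F` of the transported normal, plus a bound for `G` times the increment of `F`.
  have key := hasDerivAt_setIntegral_of_norm_sub_le (μ := μHE[n - 1])
    isClosed_frontier.measurableSet (h.measure_frontier_lt_top hΩ hb)
    (f := fun t x => G (displacement X t x) *
      F (cofactorMap (1 + t • fderiv ℝ X x) (outwardNormal Ω x))) (f' := f')
    (C := L * M * (KF * (1 + C₁ * K)) + CG * (KF * (C₁ * K)))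
    (hsmall.mono fun t ht => (hcont t ht).aestronglyMeasurable_of_isCompact hfc
      isClosed_frontier.measurableSet)
    (h.integrableOn_frontier hΩ hb (hcont 0 (by simp))) ?_ ?_
  · refine ⟨key.1, key.2.congr_of_eventuallyEq ?_⟩
    filter_upwards [hsmall] with t ht
    exact setIntegral_frontier_displacement_image hF h hΩ hX hK ht G
  · filter_upwards [eventually_abs_mul_lt (c := K) hδ,
      eventually_abs_mul_lt (c := M) one_pos,
      eventually_abs_mul_lt (c := 1) one_pos] with t htδ htM ht1 x hx
    rw [hzero, hdisp, one_apply_eq_self]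
    rw [mul_one] at ht1
    have hνx := h.norm_outwardNormal hΩ hx
    have hB : ‖t • fderiv ℝ X x‖ ≤ |t| * K := by
      rw [norm_smul, Real.norm_eq_abs]
      gcongr
      exact norm_fderiv_le_of_lipschitz ℝ hK
    have e1 : ‖cofactorMap (1 + t • fderiv ℝ X x) (outwardNormal Ω x) - outwardNormal Ω x‖ ≤
        C₁ * K * |t| := by
      have := (cofactorMap (1 + t • fderiv ℝ X x) - 1).le_opNorm (outwardNormal Ω x)
      rw [_root_.sub_apply, one_apply_eq_self, hνx, mul_one] at this
      refine this.trans ((hcof _ (hB.trans_lt htδ)).trans ?_)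
      calc C₁ * ‖t • fderiv ℝ X x‖ ≤ C₁ * (|t| * K) := by gcongr
        _ = C₁ * K * |t| := by ring
    set w := cofactorMap (1 + t • fderiv ℝ X x) (outwardNormal Ω x)
    have e2 : |F w - F (outwardNormal Ω x)| ≤ KF * (C₁ * K * |t|) := by
      have := hKF.norm_sub_le w (outwardNormal Ω x)
      rw [Real.norm_eq_abs] at this
      exact this.trans (by gcongr)
    have e3 : |F w| ≤ KF * (1 + C₁ * K) := by
      have := hKF.norm_sub_le w 0
      rw [hF.map_zero, sub_zero, sub_zero, Real.norm_eq_abs] at this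
      refine this.trans ?_
      gcongr
      have h3 := norm_le_norm_add_norm_sub' w (outwardNormal Ω x)
      rw [hνx] at h3
      have : C₁ * K * |t| ≤ C₁ * K * 1 := by gcongr
      linarith
    have hxR := hR x hx
    have hd : ‖displacement X t x - x‖ ≤ M * |t| := by
      rw [displacement, add_sub_cancel_left, norm_smul, Real.norm_eq_abs, mul_comm M]
      gcongr
      exact hM x
    have e4 : |G (displacement X t x) - G x| ≤ L * (M * |t|) := by
      have := hL.norm_sub_le (x := displacement X t x) (y := x)
        (by
          rw [mem_closedBall_zero_iff]
          have := norm_le_norm_add_norm_sub' (displacement X t x) x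
          linarith)
        (by rw [mem_closedBall_zero_iff]; linarith)
      rw [Real.norm_eq_abs] at this
      exact this.trans (by gcongr)
    have e5 : |G x| ≤ CG := hCG x hx
    have hsplit : G (displacement X t x) * F w - G x * F (outwardNormal Ω x) =
      (G (displacement X t x) - G x) * F w + G x * (F w - F (outwardNormal Ω x)) := by ring
    rw [hsplit]
    refine (abs_add_le _ _).trans ?_
    rw [abs_mul, abs_mul]
    have e6 : 0 ≤ M * |t| := (norm_nonneg _).trans hd
    calc _ ≤ L * (M * |t|) * (KF * (1 + C₁ * K)) + CG * (KF * (C₁ * K * |t|)) := by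
          gcongr
          exact (abs_nonneg _).trans e5
      _ = _ := by ring
  · intro x hx
    have hν0 := h.outwardNormal_ne_zero hΩ hx
    have d1 : HasDerivAt (fun t => G (displacement X t x)) (G' x (X x)) 0 := by
      have hl : HasDerivAt (fun t : ℝ => displacement X t x) (X x) 0 := by
        simpa [displacement] using ((hasDerivAt_id (0 : ℝ)).smul_const (X x)).const_add x
      exact (hG' x).comp_hasDerivAt_of_eq (0 : ℝ) hl (hdisp x).symm
    have d2 : HasDerivAt (fun t : ℝ => cofactorMap (1 + t • fderiv ℝ X x) (outwardNormal Ω x))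
        (LinearMap.trace ℝ _ (fderiv ℝ X x).toLinearMap • outwardNormal Ω x
          - ContinuousLinearMap.adjoint (fderiv ℝ X x) (outwardNormal Ω x)) 0 := by
      have := (hasDerivAt_cofactorMap_one_add_smul (fderiv ℝ X x)).clm_apply
        (hasDerivAt_const (0 : ℝ) (outwardNormal Ω x))
      simpa using this
    have d3 := (hF.differentiableAt hν0).hasFDerivAt.comp_hasDerivAt_of_eq (0 : ℝ) d2
      (by rw [hzero, one_apply_eq_self])
    have d4 := d1.mul d3
    refine d4.congr_deriv ?_
    simp only [Function.comp_apply]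
    rw [hzero, hdisp, one_apply_eq_self, hf' x hx, ← inner_gradient_eq_fderiv, inner_sub_right,
      inner_smul_right, hF.inner_gradient_self hν0, ContinuousLinearMap.adjoint_inner_right]

/-- For small `t` the Jacobian determinant is positive uniformly in `x`, so the absolute value drops
out. Differentiating it gives the divergence, which the divergence theorem moves to the boundary. -/
theorem hasDerivAt_volume_displacement (h : HasSmoothBoundary Ω) (hΩ : IsOpen Ω)
    (hb : Bornology.IsBounded Ω) (hX : ContDiff ℝ 1 X) (hc : HasCompactSupport X) :
    HasDerivAt (fun t : ℝ => volume.real (displacement X t '' Ω))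
      (∫ x in frontier Ω, ⟪outwardNormal Ω x, X x⟫ ∂μHE[n - 1]) 0 := by
  obtain ⟨K, hK⟩ := hX.lipschitzWith_of_hasCompactSupport hc one_ne_zero
  have hdet : ∃ C δ : ℝ, 0 ≤ C ∧ 0 < δ ∧
      ∀ B : EuclideanSpace ℝ (Fin n) →L[ℝ] EuclideanSpace ℝ (Fin n), ‖B‖ < δ →
        0 < (1 + B).det ∧ |(1 + B).det - 1| ≤ C * ‖B‖ := by
    have hd : DifferentiableAt ℝ
        (fun A : EuclideanSpace ℝ (Fin n) →L[ℝ] EuclideanSpace ℝ (Fin n) => A.det) 1 :=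
      contDiff_det.differentiable (by simp) _
    have hone : (1 : EuclideanSpace ℝ (Fin n) →L[ℝ] EuclideanSpace ℝ (Fin n)).det = 1 :=
      LinearMap.det_id
    obtain ⟨C, hC, hO⟩ := hd.isBigO_sub.exists_nonneg
    have hpos := hd.continuousAt.eventually (lt_mem_nhds (a := 0) (by simp only [hone, zero_lt_one]))
    obtain ⟨δ, hδ, hB⟩ := Metric.eventually_nhds_iff.1 (hpos.and hO.bound)
    refine ⟨C, δ, hC, hδ, fun B hB' => ?_⟩
    have := hB (y := 1 + B) (by simpa [dist_eq_norm] using hB')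
    rwa [hone, add_sub_cancel_left] at this
  obtain ⟨C, δ, hC, hδ, hdet⟩ := hdet
  have hBn : ∀ (t : ℝ) x, ‖t • fderiv ℝ X x‖ ≤ |t| * K := fun t x => by
    rw [norm_smul, Real.norm_eq_abs]
    gcongr
    exact norm_fderiv_le_of_lipschitz ℝ hK
  have hone : ∀ x, (1 + (0 : ℝ) • fderiv ℝ X x).det = 1 := fun x => by
    rw [zero_smul ℝ (fderiv ℝ X x), add_zero]; exact LinearMap.det_id
  have key := hasDerivAt_setIntegral_of_norm_sub_le (μ := volume) (K := Ω)
    hΩ.measurableSet hb.measure_lt_top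
    (f := fun t x => (1 + t • fderiv ℝ X x).det)
    (f' := fun x => LinearMap.trace ℝ _ (fderiv ℝ X x).toLinearMap) (C := C * K)
    (Eventually.of_forall fun t => (contDiff_det.continuous.comp
      (continuous_fderiv_displacement hX t)).aestronglyMeasurable)
    (by simp only [hone]; exact integrableOn_const hb.measure_lt_top.ne)
    (by
      filter_upwards [eventually_abs_mul_lt (c := K) hδ] with t ht x _
      rw [hone]
      refine (hdet _ ((hBn t x).trans_lt ht)).2.trans ?_
      calc C * ‖t • fderiv ℝ X x‖ ≤ C * (|t| * K) := by gcongr; exact hBn t x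
        _ = C * K * |t| := by ring)
    (fun x _ => hasDerivAt_det_one_add_smul _)
  rw [← h.setIntegral_trace_fderiv_eq hΩ hb hX hc]
  refine key.2.congr_of_eventuallyEq ?_
  filter_upwards [eventually_abs_mul_lt (c := K) hδ,
    eventually_abs_mul_lt (c := K) one_pos] with t ht ht1
  rw [volume_real_displacement_image hΩ hX hK ht1]
  refine setIntegral_congr_fun hΩ.measurableSet fun x _ => ?_
  exact abs_of_pos (hdet _ ((hBn t x).trans_lt ht)).1

end HasSmoothBoundary

namespace HasSmoothBoundary

variable {n : ℕ} {p : ℝ} {F : EuclideanSpace ℝ (Fin n) → ℝ} {Ω : Set (EuclideanSpace ℝ (Fin n))}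

theorem integrableOn_apply_outwardNormal (h : HasSmoothBoundary Ω) (hΩ : IsOpen Ω)
    (hb : Bornology.IsBounded Ω) (hF : IsFinslerNorm p F) :
    IntegrableOn (fun x => F (outwardNormal Ω x)) (frontier Ω) μHE[n - 1] :=
  h.integrableOn_frontier hΩ hb (hF.continuous.comp_continuousOn (h.continuousOn_outwardNormal hΩ))

/-- The lower bound `a` for `F` on unit normals, times the positive measure of the boundary. It
keeps the denominator of the functional nonzero. -/
theorem anisotropicPerimeter_pos (h : HasSmoothBoundary Ω) (hn : n ≠ 0) (hΩ : IsOpen Ω)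
    (hne : Ω.Nonempty) (hb : Bornology.IsBounded Ω) (hF : IsFinslerNorm p F) :
    0 < anisotropicPerimeter F Ω := by
  obtain ⟨a, ha, hle⟩ := hF.lower_bound
  have hfin := h.measure_frontier_lt_top hΩ hb
  have h1 : ∫ _ in frontier Ω, a ∂μHE[n - 1] ≤ anisotropicPerimeter F Ω := by
    refine setIntegral_mono_on (integrableOn_const hfin.ne)
      (h.integrableOn_apply_outwardNormal hΩ hb hF) isClosed_frontier.measurableSet fun x hx => ?_
    have := hle (outwardNormal Ω x)
    rwa [h.norm_outwardNormal hΩ hx, mul_one] at this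
  refine lt_of_lt_of_le ?_ h1
  rw [setIntegral_const, smul_eq_mul]
  exact mul_pos (ENNReal.toReal_pos (h.measure_frontier_pos hn hΩ hne hb).ne' hfin.ne) ha

end HasSmoothBoundary

/-! ### Assembly of the four variation formulas. -/

theorem mainTheorem9 {n : ℕ} (hn : 2 ≤ n) {p : ℝ} (hp : 1 < p)
    {F : EuclideanSpace ℝ (Fin n) → ℝ} (hF : IsFinslerNorm p F)
    {Ω : Set (EuclideanSpace ℝ (Fin n))} (hΩo : IsOpen Ω) (hΩne : Ω.Nonempty)
    (hΩb : Bornology.IsBounded Ω) (hΩs : HasSmoothBoundary Ω)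
    {φ : EuclideanSpace ℝ (Fin n) → ℝ} (hφ : ContDiff ℝ ∞ φ) (hφc : HasCompactSupport φ)
    {N : EuclideanSpace ℝ (Fin n) → EuclideanSpace ℝ (Fin n)} (hN : ContDiff ℝ 1 N)
    (hNΩ : ∀ x ∈ frontier Ω, N x = anisotropicNormal F Ω x) :
    HasDerivAt (fun t : ℝ => anisotropicMomentum p F (deformedSet Ω φ N t))
      (p * boundaryIntegral Ω (fun x => polarNorm F x ^ (p - 1) *
            ⟪gradient (polarNorm F) x, φ x • anisotropicNormal F Ω x⟫ * F (outwardNormal Ω x))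
        + boundaryIntegral Ω (fun x => polarNorm F x ^ p * F (outwardNormal Ω x) *
            anisotropicMeanCurvature F Ω x * φ x)) 0
    ∧ HasDerivAt (fun t : ℝ => anisotropicPerimeter F (deformedSet Ω φ N t))
      (boundaryIntegral Ω fun x =>
        anisotropicMeanCurvature F Ω x * φ x * F (outwardNormal Ω x)) 0
    ∧ HasDerivAt (fun t : ℝ => volume.real (deformedSet Ω φ N t))
      (boundaryIntegral Ω fun x => φ x * F (outwardNormal Ω x)) 0
    ∧ HasDerivAt (fun t : ℝ => momentumFunctional p F (deformedSet Ω φ N t))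
      (1 / (anisotropicPerimeter F Ω * volume.real Ω ^ (p / (n : ℝ))) *
        (p * boundaryIntegral Ω (fun x =>
            (polarNorm F x ^ (p - 1) * ⟪gradient (polarNorm F) x, anisotropicNormal F Ω x⟫ *
                F (outwardNormal Ω x)
              - anisotropicMomentum p F Ω / ((n : ℝ) * volume.real Ω) * F (outwardNormal Ω x))
            * φ x)
          + boundaryIntegral Ω (fun x =>
            (polarNorm F x ^ p - anisotropicMomentum p F Ω / anisotropicPerimeter F Ω) *
              anisotropicMeanCurvature F Ω x * F (outwardNormal Ω x) * φ x))) 0 := by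
  have hn0 : n ≠ 0 := by omega
  set X : EuclideanSpace ℝ (Fin n) → EuclideanSpace ℝ (Fin n) := fun x => φ x • N x with hXdef
  have hφ1 : ContDiff ℝ 1 φ := hφ.of_le (by exact_mod_cast le_top)
  have hX : ContDiff ℝ 1 X := hφ1.smul hN
  have hc : HasCompactSupport X := hφc.smul_right
  have hfc := isCompact_frontier_of_isBounded hΩb
  have hfm : MeasurableSet (frontier Ω) := isClosed_frontier.measurableSet
  set H := anisotropicMeanCurvature F Ω
  set ν := outwardNormal Ω
  have hzero : deformedSet Ω φ N 0 = Ω := by simp [deformedSet]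
  have harea : ∀ x ∈ frontier Ω, LinearMap.trace ℝ _ (fderiv ℝ X x).toLinearMap * F (ν x)
      - ⟪fderiv ℝ X x (gradient F (ν x)), ν x⟫ = H x * φ x * F (ν x) := fun x hx => by
    have h1 := hΩs.trace_mul_sub_inner_eq hΩo hF hφ1 hN hNΩ hx
    rw [hNΩ x hx] at h1
    refine h1.trans ?_
    simp only [H, ν]
    ring
  have hP := hΩs.hasDerivAt_setIntegral_frontier_displacement hΩo hΩb hF hX hc
    (G := fun _ => 1) (G' := fun _ => 0) (f' := fun x => H x * φ x * F (ν x))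
    (LipschitzWith.const 1).locallyLipschitz
    (fun x => hasFDerivAt_const 1 x) (fun x hx => by
      rw [harea x hx, _root_.zero_apply, zero_mul, zero_add, one_mul])
  have hG : Continuous fun x => polarNorm F x ^ p :=
    (hF.convexOn_polarNorm_rpow hn0 hp).locallyLipschitz.continuous
  have hM := hΩs.hasDerivAt_setIntegral_frontier_displacement hΩo hΩb hF hX hc
    (G := fun x => polarNorm F x ^ p)
    (f' := fun x => p * (polarNorm F x ^ (p - 1) *
      ⟪gradient (polarNorm F) x, φ x • anisotropicNormal F Ω x⟫ * F (ν x)) +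
      polarNorm F x ^ p * F (ν x) * H x * φ x)
    (hF.convexOn_polarNorm_rpow hn0 hp).locallyLipschitz
    (hF.hasFDerivAt_polarNorm_rpow hn0 hp) (fun x hx => by
      rw [harea x hx, _root_.smul_apply, innerSL_apply_apply, show X x = φ x • N x from rfl,
        hNΩ x hx, smul_eq_mul]
      ring)
  have hi2 : IntegrableOn (fun x => polarNorm F x ^ p * F (ν x) * H x * φ x) (frontier Ω)
      μHE[n - 1] := by
    have := hP.1.continuousOn_mul hG.continuousOn hfc
    refine this.congr_fun (fun x _ => ?_) hfm
    ring
  -- Integrability of the gradient term is read off as a difference: the full momentum integrand is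
  -- integrable, and so is its curvature part, being a continuous multiple of the perimeter
  -- integrand.
  have hi1 : IntegrableOn (fun x => polarNorm F x ^ (p - 1) *
      ⟪gradient (polarNorm F) x, φ x • anisotropicNormal F Ω x⟫ * F (ν x)) (frontier Ω)
      μHE[n - 1] := by
    have := (hM.1.sub hi2).const_mul p⁻¹
    refine IntegrableOn.congr_fun this (fun x _ => ?_) hfm
    simp only [Pi.sub_apply, add_sub_cancel_right]
    rw [inv_mul_cancel_left₀ (by linarith)]
  have hi3 : IntegrableOn (fun x => φ x * F (ν x)) (frontier Ω) μHE[n - 1] :=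
    hΩs.integrableOn_frontier hΩo hΩb (hφ1.continuous.continuousOn.mul
      (hF.continuous.comp_continuousOn (hΩs.continuousOn_outwardNormal hΩo)))
  have dM : HasDerivAt (fun t : ℝ => anisotropicMomentum p F (deformedSet Ω φ N t))
      (p * boundaryIntegral Ω (fun x => polarNorm F x ^ (p - 1) *
            ⟪gradient (polarNorm F) x, φ x • anisotropicNormal F Ω x⟫ * F (ν x))
        + boundaryIntegral Ω (fun x => polarNorm F x ^ p * F (ν x) * H x * φ x)) 0 := by
    refine hM.2.congr_deriv ?_
    rw [boundaryIntegral, boundaryIntegral, ← integral_const_mul,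
      ← integral_add (hi1.const_mul p) hi2]
  have dP : HasDerivAt (fun t : ℝ => anisotropicPerimeter F (deformedSet Ω φ N t))
      (boundaryIntegral Ω fun x => H x * φ x * F (ν x)) 0 := by
    have := hP.2
    simp only [one_mul] at this
    exact this
  have dV : HasDerivAt (fun t : ℝ => volume.real (deformedSet Ω φ N t))
      (boundaryIntegral Ω fun x => φ x * F (ν x)) 0 := by
    refine (hΩs.hasDerivAt_volume_displacement hΩo hΩb hX hc).congr_deriv ?_
    refine setIntegral_congr_fun hfm fun x hx => ?_
    simp only [hXdef]
    rw [inner_smul_right, hNΩ x hx, anisotropicNormal, real_inner_comm,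
      hF.inner_gradient_self (hΩs.outwardNormal_ne_zero hΩo hx)]
  refine ⟨dM, dP, dV, ?_⟩
  have hPpos : 0 < anisotropicPerimeter F Ω := hΩs.anisotropicPerimeter_pos hn0 hΩo hΩne hΩb hF
  have hVpos : 0 < volume.real Ω :=
    ENNReal.toReal_pos (hΩo.measure_pos volume hΩne).ne' hΩb.measure_lt_top.ne
  have hVq : 0 < volume.real Ω ^ (p / (n : ℝ)) := Real.rpow_pos_of_pos hVpos _
  have dVq := dV.rpow_const (p := p / (n : ℝ)) (Or.inl (by rw [hzero]; exact hVpos.ne'))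
  have dF := dM.div (dP.mul dVq) (by
    simp only [Pi.mul_apply]
    rw [hzero]
    exact (mul_pos hPpos hVq).ne')
  refine dF.congr_deriv ?_
  have e1 : boundaryIntegral Ω (fun x =>
      (polarNorm F x ^ (p - 1) * ⟪gradient (polarNorm F) x, anisotropicNormal F Ω x⟫ * F (ν x)
        - anisotropicMomentum p F Ω / ((n : ℝ) * volume.real Ω) * F (ν x)) * φ x) =
      boundaryIntegral Ω (fun x => polarNorm F x ^ (p - 1) *
        ⟪gradient (polarNorm F) x, φ x • anisotropicNormal F Ω x⟫ * F (ν x)) -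
      anisotropicMomentum p F Ω / ((n : ℝ) * volume.real Ω) *
        boundaryIntegral Ω (fun x => φ x * F (ν x)) := by
    rw [boundaryIntegral, boundaryIntegral, boundaryIntegral, ← integral_const_mul,
      ← integral_sub hi1 (hi3.const_mul _)]
    congr 1 with x
    rw [inner_smul_right]
    ring
  have e2 : boundaryIntegral Ω (fun x =>
      (polarNorm F x ^ p - anisotropicMomentum p F Ω / anisotropicPerimeter F Ω) *
        H x * F (ν x) * φ x) =
      boundaryIntegral Ω (fun x => polarNorm F x ^ p * F (ν x) * H x * φ x) -
      anisotropicMomentum p F Ω / anisotropicPerimeter F Ω *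
        boundaryIntegral Ω (fun x => H x * φ x * F (ν x)) := by
    rw [boundaryIntegral, boundaryIntegral, boundaryIntegral, ← integral_const_mul,
      ← integral_sub hi2 (hP.1.const_mul _)]
    congr 1 with x
    ring
  rw [e1, e2]
  simp only [Pi.mul_apply]
  -- Writing V^(p/n − 1) as V^(p/n)/V lets the common denominator factor out and produces the
  -- coefficient M/(nV).
  rw [hzero, Real.rpow_sub_one hVpos.ne']
  have hn' : (n : ℝ) ≠ 0 := Nat.cast_ne_zero.2 hn0
  field_simp
  ring
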